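/- Let $d\ge 2$, let $\Omega\subset\mathbb R^d$ be open and bounded, and let $g_0(s)=\sum_{i=0}^N a_i s^{\alpha_i}$ ($s\ge 0$) with $N\ge 1$, real exponents $0=\alpha_0<\alpha_1<\dots<\alpha_N$ and coefficients $a_i\ge 0$, $a_0>0$, $a_N>0$. For $\xi\ge 0$ put $K(\xi)=1/g_0(s(\xi))$, where $s(\xi)\ge 0$ is the unique nonnegative solution of $s\,g_0(s)=\xi$. Put $$a=\frac{\alpha_N}{\alpha_N+1},\qquad \beta=2-a,\qquad \lambda=\frac{\beta}{\beta-1},$$ and assume the degree condition $a\le \frac{4}{d+2}$. Write $(\cdot,\cdot)$ and $\|\cdot\|$ for the inner product and norm of $L^2(\Omega)$, $\|\cdot\|_{0,\beta}$ for the norm of $L^\beta(\Omega)$ and $\|\cdot\|_1$ for the norm of $H^1(\Omega)$. Let $\mathcal T_h$ be a subdivision of $\Omega$ into finitely many elements of maximal diameter $h$ which is quasiuniform with constant $\sigma>0$: the elements are nonempty, open and pairwise disjoint, they fill $\Omega$ up to a null set, and each of them is star-shaped with respect to every point of some ball of radius $\sigma h$ contained in it (for instance a quasiuniform triangulation). Let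 $W_h$ be the space of discontinuous piecewise polynomials of degree at most $r\ge 0$ over $\mathcal T_h$, with gradients taken element by element, and let $\pi$ be the $L^2(\Omega)$-projection onto $W_h$. Let the data be $f(t)\in L^2(\Omega)$ for $t\ge 0$, $\rho^0\in H^1(\Omega)$, and $\phi(t)\in H^1(\Omega)$ for $t\ge0$ (an extension to $\Omega$ of the Dirichlet data), differentiable on $[0,\infty)$ as a curve in $L^2(\Omega)$ with $\phi_t(t)\in H^1(\Omega)$ and $\|\phi_t\|_1^2$ locally integrable on $[0,\infty)$. Put $\phi^0=\phi(0)$, $\tilde f=f-\phi_t$ and $$g(t)=\|\tilde f(t)\|^{\lambda}+\|\phi(t)\|_1^2 .$$ Let $\tilde\rho_h=\rho_h-\pi\phi:[0,\infty)\to W_h$ be a solution of the semidiscrete problem, that is, $\tilde\rho_h$ is continuous at $0$, differentiable for $t>0$, $\tilde\rho_h(0)=\pi(\rho^0-\phi^0)$, and for all $t>0$ $$(\tilde\rho_{h,t},w_h)+(K(|\nabla\rho_h|)\nabla\rho_h,\nabla w_h)=(\tilde f,w_h)\qquad\text{for all } w_h\in W_h .$$ Then there is a constant $C>0$, depending only on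 $g_0$, $d$, $\Omega$, $r$ and $\sigma$ (in particular not on $h$, $\mathcal T_h$, the data or the solution), such that the following hold. (i) For every continuous increasing function $\mathrm{Env}\,g\ge g$ on $[0,\infty)$ and all $t\ge 0$, $$\|\nabla\rho_h(t)\|_{0,\beta}^{\beta}\le C\Big(1+\|\rho^0\|_1^2+\|\phi^0\|^2+\int_0^t e^{-\frac12(t-s)}\big(\|\phi_t(s)\|_1^2+(\mathrm{Env}\,g(s))^{2/\beta}\big)\,ds\Big).$$ (ii) In $[0,\infty]$, $$\limsup_{t\to\infty}\|\nabla\rho_h(t)\|_{0,\beta}^{\beta}\le C\Big(1+\limsup_{t\to\infty}\|\phi_t(t)\|_1^2+\big(\limsup_{t\to\infty}g(t)\big)^{2/\beta}\Big).$$ (iii) If $\limsup_{t\to\infty}\|\tilde f(t)\|=\limsup_{t\to\infty}\|\phi(t)\|_1=\limsup_{t\to\infty}\|\phi_t(t)\|_1=0$, then $\limsup_{t\to\infty}\|\nabla\rho_h(t)\|_{0,\beta}=0$. -/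

import Mathlib

open MeasureTheory Set Filter Topology
open scoped ContDiff

noncomputable section

namespace Forchheimer

/-! ### The generalized polynomial `g`, the function `K`, the exponents -/

/-- Generalized polynomial `g(s) = a₀ s^{α₀} + ⋯ + a_N s^{α_N}` with
`α₀ = 0 < α₁ < ⋯ < α_N` real, all `aᵢ ≥ 0`, `a₀ > 0`, `a_N > 0`. -/
structure GenPoly (N : ℕ) where
  coeff : Fin (N + 1) → ℝ
  expo : Fin (N + 1) → ℝ
  expo_zero : expo 0 = 0
  expo_strictMono : StrictMono expo
  coeff_nonneg : ∀ i, 0 ≤ coeff i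
  coeff_zero_pos : 0 < coeff 0
  coeff_last_pos : 0 < coeff (Fin.last N)

namespace GenPoly

variable {N : ℕ} (P : GenPoly N)

/-- The value `g(s)`, for `s ≥ 0`. -/
def eval (s : ℝ) : ℝ := ∑ i, P.coeff i * s ^ P.expo i

/-- `deg g = α_N`. -/
def deg : ℝ := P.expo (Fin.last N)

/-- `a = α_N / (α_N + 1)`. -/
def a : ℝ := P.deg / (P.deg + 1)

/-- `β = 2 - a`. -/
def β : ℝ := 2 - P.a

/-- `λ = β / (β - 1) = (2 - a) / (1 - a)`. -/
def lam : ℝ := P.β / (P.β - 1)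

/-- `s(ξ)`: the unique `s ≥ 0` with `s g(s) = ξ` (see `existsUnique_root`). -/
def root (ξ : ℝ) : ℝ := Classical.epsilon fun s : ℝ => 0 ≤ s ∧ s * P.eval s = ξ

/-- `K(ξ) = 1 / g(s(ξ))`, for `ξ ≥ 0`. -/
def K (ξ : ℝ) : ℝ := 1 / P.eval (P.root ξ)

theorem expo_nonneg (i : Fin (N + 1)) : 0 ≤ P.expo i := by
  rw [← P.expo_zero]
  exact P.expo_strictMono.monotone (Fin.zero_le i)

theorem eval_mono {s t : ℝ} (hs : 0 ≤ s) (hst : s ≤ t) : P.eval s ≤ P.eval t := by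
  unfold eval
  exact Finset.sum_le_sum fun i _ => mul_le_mul_of_nonneg_left
    (Real.rpow_le_rpow hs hst (P.expo_nonneg i)) (P.coeff_nonneg i)

theorem coeff_zero_le_eval {s : ℝ} (hs : 0 ≤ s) : P.coeff 0 ≤ P.eval s := by
  have h := Finset.single_le_sum (f := fun i => P.coeff i * s ^ P.expo i)
    (fun i _ => mul_nonneg (P.coeff_nonneg i) (Real.rpow_nonneg hs _)) (Finset.mem_univ 0)
  simpa [eval, P.expo_zero] using h

theorem continuous_eval : Continuous P.eval := by
  unfold eval
  exact continuous_finsetSum _ fun i _ =>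
    continuous_const.mul (Real.continuous_rpow_const (P.expo_nonneg i))

theorem existsUnique_root {ξ : ℝ} (hξ : 0 ≤ ξ) : ∃! s : ℝ, 0 ≤ s ∧ s * P.eval s = ξ := by
  have h0 := P.coeff_zero_pos
  have hle : 0 ≤ ξ / P.coeff 0 := by positivity
  have hc : ContinuousOn (fun s => s * P.eval s) (Icc 0 (ξ / P.coeff 0)) :=
    (continuous_id.mul P.continuous_eval).continuousOn
  have hmem : ξ ∈ Icc ((0 : ℝ) * P.eval 0) (ξ / P.coeff 0 * P.eval (ξ / P.coeff 0)) := by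
    refine ⟨by simpa using hξ, ?_⟩
    calc ξ = ξ / P.coeff 0 * P.coeff 0 := by field_simp
      _ ≤ _ := mul_le_mul_of_nonneg_left (P.coeff_zero_le_eval hle) hle
  obtain ⟨s, hs, hs'⟩ := intermediate_value_Icc hle hc hmem
  refine ⟨s, ⟨hs.1, hs'⟩, ?_⟩
  have key : ∀ u v : ℝ, 0 ≤ u → u < v → u * P.eval u < v * P.eval v := fun u v hu huv =>
    by
      have h1 : u * P.eval u ≤ u * P.eval v :=
        mul_le_mul_of_nonneg_left (P.eval_mono hu huv.le) hu
      have h2 : 0 < P.eval v := h0.trans_le (P.coeff_zero_le_eval (hu.trans huv.le))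
      have h3 : u * P.eval v < v * P.eval v := mul_lt_mul_of_pos_right huv h2
      linarith
  rintro t ⟨ht, ht'⟩
  rcases lt_trichotomy t s with h | h | h
  · have := key t s ht h
    simp only at hs'
    linarith
  · exact h
  · have := key s t hs.1 h
    simp only at hs'
    linarith

theorem root_spec {ξ : ℝ} (hξ : 0 ≤ ξ) : 0 ≤ P.root ξ ∧ P.root ξ * P.eval (P.root ξ) = ξ :=
  Classical.epsilon_spec (P.existsUnique_root hξ).exists

end GenPoly

/-! ### Norms on `Ω` and the Sobolev space `H¹(Ω)` -/

variable {d : ℕ}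

/-- `‖u‖ = ‖u‖_{L²(Ω)}`. -/
def l2Norm (Ω : Set (EuclideanSpace ℝ (Fin d))) (u : EuclideanSpace ℝ (Fin d) → ℝ) : ℝ :=
  lpNorm u 2 (volume.restrict Ω)

/-- `G` is the weak gradient of `u` in `Ω`: `∫_Ω u ∂ᵢη = - ∫_Ω Gᵢ η` for all `i` and all
test functions `η ∈ C_c^∞(Ω)`. -/
def HasWeakGradient (Ω : Set (EuclideanSpace ℝ (Fin d))) (u : EuclideanSpace ℝ (Fin d) → ℝ)
    (G : EuclideanSpace ℝ (Fin d) → EuclideanSpace ℝ (Fin d)) : Prop :=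
  ∀ η : EuclideanSpace ℝ (Fin d) → ℝ, ContDiff ℝ ∞ η → HasCompactSupport η → tsupport η ⊆ Ω →
    ∀ i : Fin d, ∫ x in Ω, u x * gradient η x i = - ∫ x in Ω, G x i * η x

/-- `u ∈ H¹(Ω)`. -/
def MemH1 (Ω : Set (EuclideanSpace ℝ (Fin d))) (u : EuclideanSpace ℝ (Fin d) → ℝ) : Prop :=
  MemLp u 2 (volume.restrict Ω) ∧
    ∃ G, MemLp G 2 (volume.restrict Ω) ∧ HasWeakGradient Ω u G

open Classical in
/-- The weak gradient of `u ∈ H¹(Ω)` (unique up to a null set). -/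
def weakGradient (Ω : Set (EuclideanSpace ℝ (Fin d))) (u : EuclideanSpace ℝ (Fin d) → ℝ) :
    EuclideanSpace ℝ (Fin d) → EuclideanSpace ℝ (Fin d) :=
  if h : ∃ G, MemLp G 2 (volume.restrict Ω) ∧ HasWeakGradient Ω u G then h.choose else 0

/-- `‖u‖₁ = (‖u‖² + ∑ᵢ ‖∂ᵢ u‖²)^{1/2}`, for `u ∈ H¹(Ω)`. -/
def h1Norm (Ω : Set (EuclideanSpace ℝ (Fin d))) (u : EuclideanSpace ℝ (Fin d) → ℝ) : ℝ :=
  √(l2Norm Ω u ^ 2 + lpNorm (weakGradient Ω u) 2 (volume.restrict Ω) ^ 2)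

/-- `v` is the derivative at time `t` of the curve `u : [0, ∞) → L²(Ω)`
(one-sided at `t = 0`). -/
def HasL2TimeDeriv (Ω : Set (EuclideanSpace ℝ (Fin d)))
    (u : ℝ → EuclideanSpace ℝ (Fin d) → ℝ) (v : EuclideanSpace ℝ (Fin d) → ℝ) (t : ℝ) : Prop :=
  Tendsto (fun s => eLpNorm (fun x => (s - t)⁻¹ * (u s x - u t x) - v x) 2 (volume.restrict Ω))
    (𝓝[Ici 0 \ {t}] t) (𝓝 0)

/-! ### Meshes and discontinuous piecewise polynomials -/

/-- `𝒯` is a subdivision of `Ω` of mesh size `h` (the maximum of the diameters of the elements)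
which is quasiuniform with constant `σ`. The elements are represented by their interiors: they are
nonempty, open, pairwise disjoint and fill `Ω` up to a null set, and each of them is star-shaped
with respect to all points of some ball of radius `σ h`. Simplices (straight, or with curved faces
along the boundary of `Ω`) are the typical elements. -/
structure IsQuasiUniformMesh (Ω : Set (EuclideanSpace ℝ (Fin d))) (σ h : ℝ)
    (𝒯 : Finset (Set (EuclideanSpace ℝ (Fin d)))) : Prop where
  isOpen : ∀ T ∈ 𝒯, IsOpen T
  nonempty : ∀ T ∈ 𝒯, T.Nonempty
  subset : ∀ T ∈ 𝒯, T ⊆ Ω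
  disjoint : ∀ T ∈ 𝒯, ∀ T' ∈ 𝒯, T ≠ T' → Disjoint T T'
  cover : volume (Ω \ ⋃ T ∈ 𝒯, T) = 0
  size : IsGreatest {δ | ∃ T ∈ 𝒯, δ = Metric.diam T} h
  star : ∀ T ∈ 𝒯, ∃ x₀, ∀ y ∈ Metric.ball x₀ (σ * h), y ∈ T ∧ StarConvex ℝ y T

/-- The space `W_h` of discontinuous piecewise polynomials of degree at most `r` over `𝒯`.
The values on the null set outside the (open) elements are irrelevant. The gradient of
`w ∈ W_h` is taken element by element, so it is the classical `gradient w x` at every `x` in an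
element, hence at almost every point of the domain. -/
def feSpace (𝒯 : Finset (Set (EuclideanSpace ℝ (Fin d)))) (r : ℕ) :
    Set (EuclideanSpace ℝ (Fin d) → ℝ) :=
  {w | ∀ T ∈ 𝒯, ∃ p : MvPolynomial (Fin d) ℝ, p.totalDegree ≤ r ∧
    ∀ x ∈ T, w x = MvPolynomial.eval (fun i => x i) p}

/-- `p = π u`, the `L²(Ω)`-projection of `u` on `W_h`. -/
def IsL2Projection (Ω : Set (EuclideanSpace ℝ (Fin d)))
    (𝒯 : Finset (Set (EuclideanSpace ℝ (Fin d)))) (r : ℕ)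
    (u p : EuclideanSpace ℝ (Fin d) → ℝ) : Prop :=
  p ∈ feSpace 𝒯 r ∧ ∀ v ∈ feSpace 𝒯 r, ∫ x in Ω, p x * v x = ∫ x in Ω, u x * v x

/-! ### The semidiscrete problem -/

/-- Admissible data: source `f(t) ∈ L²(Ω)`, extension `φ(t) ∈ H¹(Ω)` of the Dirichlet data with
time derivative `φt(t) ∈ H¹(Ω)`, `‖φt‖₁²` locally integrable on `[0, ∞)`, and initial
density `ρ0 ∈ H¹(Ω)`. -/
structure IsData (Ω : Set (EuclideanSpace ℝ (Fin d)))
    (f φ φt : ℝ → EuclideanSpace ℝ (Fin d) → ℝ) (ρ0 : EuclideanSpace ℝ (Fin d) → ℝ) : Prop where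
  f_mem : ∀ t, 0 ≤ t → MemLp (f t) 2 (volume.restrict Ω)
  φ_mem : ∀ t, 0 ≤ t → MemH1 Ω (φ t)
  φt_mem : ∀ t, 0 ≤ t → MemH1 Ω (φt t)
  φ_deriv : ∀ t, 0 ≤ t → HasL2TimeDeriv Ω φ (φt t) t
  φt_int : ∀ t, 0 ≤ t → IntervalIntegrable (fun s => h1Norm Ω (φt s) ^ 2) volume 0 t
  ρ0_mem : MemH1 Ω ρ0

/-- The shifted source `f̃ = f - φ_t`. -/
def ftilde (f φt : ℝ → EuclideanSpace ℝ (Fin d) → ℝ) (t : ℝ) (x : EuclideanSpace ℝ (Fin d)) : ℝ :=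
  f t x - φt t x

/-- The semidiscrete problem. Here `ρt = ρ̃_h`, `πφ t` is the projection of `φ t`, and
`ρ_h = ρ̃_h + π φ`; the equation
`(ρ̃_{h,t}, w) + (K(|∇ρ_h|) ∇ρ_h, ∇w) = (f̃, w)` holds for all `w ∈ W_h` and `t > 0`, the curve
`ρ̃_h` is continuous at `t = 0`, and `ρ̃_h(0) = π(ρ⁰ - φ(0))`. -/
structure IsSemidiscreteSolution {N : ℕ} (P : GenPoly N) (Ω : Set (EuclideanSpace ℝ (Fin d)))
    (𝒯 : Finset (Set (EuclideanSpace ℝ (Fin d)))) (r : ℕ)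
    (f φ φt : ℝ → EuclideanSpace ℝ (Fin d) → ℝ) (ρ0 : EuclideanSpace ℝ (Fin d) → ℝ)
    (πφ ρt : ℝ → EuclideanSpace ℝ (Fin d) → ℝ) : Prop where
  proj : ∀ t, 0 ≤ t → IsL2Projection Ω 𝒯 r (φ t) (πφ t)
  mem : ∀ t, 0 ≤ t → ρt t ∈ feSpace 𝒯 r
  eqn : ∀ t, 0 < t → ∃ v ∈ feSpace 𝒯 r, HasL2TimeDeriv Ω ρt v t ∧
    ∀ w ∈ feSpace 𝒯 r,
      (∫ x in Ω, v x * w x) +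
        (∫ x in Ω, P.K ‖gradient (ρt t + πφ t) x‖ *
          inner ℝ (gradient (ρt t + πφ t) x) (gradient w x)) =
      ∫ x in Ω, ftilde f φt t x * w x
  cont_zero : Tendsto (fun t => eLpNorm (ρt t - ρt 0) 2 (volume.restrict Ω)) (𝓝[>] 0) (𝓝 0)
  init : IsL2Projection Ω 𝒯 r (ρ0 - φ 0) (ρt 0)

/-- `‖∇ρ‖_{0,β}^β` on `Ω`, with the gradient taken element by element. -/
def gradEnergy (Ω : Set (EuclideanSpace ℝ (Fin d))) (β : ℝ)
    (ρ : EuclideanSpace ℝ (Fin d) → ℝ) : ℝ :=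
  lpNorm (gradient ρ) (ENNReal.ofReal β) (volume.restrict Ω) ^ β

/-- `g(t) = ‖f̃(t)‖^λ + ‖φ(t)‖₁²`. -/
def gData {N : ℕ} (P : GenPoly N) (Ω : Set (EuclideanSpace ℝ (Fin d)))
    (f φ φt : ℝ → EuclideanSpace ℝ (Fin d) → ℝ) (t : ℝ) : ℝ :=
  l2Norm Ω (ftilde f φt t) ^ P.lam + h1Norm Ω (φ t) ^ 2

/-- `F` is a continuous, increasing envelope of `u` on `[0, ∞)`. -/
structure IsEnvelope (u F : ℝ → ℝ) : Prop where
  cont : ContinuousOn F (Ici 0)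
  mono : MonotoneOn F (Ici 0)
  le : ∀ t, 0 ≤ t → u t ≤ F t

/-- `𝒜(t) = 1 + ‖ρ⁰‖₁² + ‖φ⁰‖² + ∫₀ᵗ e^{-(t-s)/2} (‖φ_t(s)‖₁² + F(s)^{2/β}) ds`, where `F` is an
envelope of `g`. -/
def bigA {N : ℕ} (P : GenPoly N) (Ω : Set (EuclideanSpace ℝ (Fin d)))
    (φ φt : ℝ → EuclideanSpace ℝ (Fin d) → ℝ) (ρ0 : EuclideanSpace ℝ (Fin d) → ℝ)
    (F : ℝ → ℝ) (t : ℝ) : ℝ :=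
  1 + h1Norm Ω ρ0 ^ 2 + l2Norm Ω (φ 0) ^ 2 +
    ∫ s in (0 : ℝ)..t, Real.exp (-(1 / 2) * (t - s)) *
      (h1Norm Ω (φt s) ^ 2 + F s ^ (2 / P.β))

/-- `limsup_{t → ∞} u(t) ∈ [0, ∞]` of a nonnegative function `u`. -/
def limsupInfty (u : ℝ → ℝ) : ENNReal := limsup (fun t => ENNReal.ofReal (u t)) atTop

end Forchheimer

end

/-!
Write `ρ̃` for the unknown and `ρ` for `ρ̃ + πφ`. The potential `H(v) = 2 ∫₀^{|v|} K(s) s ds` is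
convex and is comparable to the dissipation density `K(|v|) |v|²`, so testing the equation with the
time derivative of `ρ̃` controls the growth of `∫ H(∇ρ)`. Testing with the oscillation of `ρ̃`, its
difference to the elementwise means, gives the decay of `y = ‖oscillation‖²`: by an inverse
inequality and Hölder, `y^{β/2}` is bounded by `‖∇ρ̃‖_β^β`, uniformly in the mesh, exactly because
the degree condition makes the power `β (1 + d/2) - d` of `h` nonnegative. Both `ρ⁰` and `φ` enter
through the stability of `π` in `H¹`, which follows from the Poincaré inequality on star-shaped
sets.

What is left are scalar inequalities, `y' ≤ -δ y^{β/2} + C (1 + g)` for `y` and an inequality of the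
form `(∫ H + 4y)' ≤ -½ (∫ H + 4y) + …` for the energy. They give (i) and (ii). For (iii), `∫ H + y`
decreases at a definite rate as long as it is not small.
-/

noncomputable section

namespace Forchheimer

/-! ### The constitutive law -/

namespace GenPoly

variable {N : ℕ} (P : GenPoly N)

theorem deg_nonneg : 0 ≤ P.deg := P.expo_nonneg _

theorem a_nonneg : 0 ≤ P.a := div_nonneg P.deg_nonneg (by linarith [P.deg_nonneg])

theorem a_lt_one : P.a < 1 := by
  have h := P.deg_nonneg
  rw [a, div_lt_one (by linarith)]
  linarith

theorem one_lt_β : 1 < P.β := by linarith [P.a_lt_one, show P.β = 2 - P.a from rfl]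

theorem β_pos : 0 < P.β := zero_lt_one.trans P.one_lt_β

theorem β_le_two : P.β ≤ 2 := by linarith [P.a_nonneg, show P.β = 2 - P.a from rfl]

theorem deg_add_one_mul_β_sub_one : (P.deg + 1) * (P.β - 1) = 1 := by
  have h : P.deg + 1 ≠ 0 := by linarith [P.deg_nonneg]
  unfold β a
  field_simp
  ring

theorem eval_pos {s : ℝ} (hs : 0 ≤ s) : 0 < P.eval s :=
  P.coeff_zero_pos.trans_le (P.coeff_zero_le_eval hs)

theorem eval_le_mul_rpow_deg {s : ℝ} (hs : 1 ≤ s) : P.eval s ≤ P.eval 1 * s ^ P.deg := by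
  unfold eval
  rw [Finset.sum_mul]
  refine Finset.sum_le_sum fun i _ => ?_
  rw [Real.one_rpow, mul_one]
  exact mul_le_mul_of_nonneg_left (Real.rpow_le_rpow_of_exponent_le hs
    (P.expo_strictMono.monotone (Fin.le_last i))) (P.coeff_nonneg i)

theorem root_nonneg {ξ : ℝ} (hξ : 0 ≤ ξ) : 0 ≤ P.root ξ := (P.root_spec hξ).1

theorem root_mul_eval_root {ξ : ℝ} (hξ : 0 ≤ ξ) : P.root ξ * P.eval (P.root ξ) = ξ :=
  (P.root_spec hξ).2

theorem K_mul_self {ξ : ℝ} (hξ : 0 ≤ ξ) : P.K ξ * ξ = P.root ξ := by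
  have hpos := P.eval_pos (P.root_nonneg hξ)
  unfold K
  nth_rw 2 [← P.root_mul_eval_root hξ]
  field_simp

theorem K_mul_sq {ξ : ℝ} (hξ : 0 ≤ ξ) : P.K ξ * ξ ^ 2 = P.root ξ * ξ := by
  rw [pow_two, ← mul_assoc, P.K_mul_self hξ]

theorem root_monotoneOn : MonotoneOn P.root (Ici 0) := by
  intro ξ hξ ζ hζ hle
  by_contra! hlt
  have hroot := P.root_nonneg hζ
  have : P.root ζ * P.eval (P.root ζ) < P.root ξ * P.eval (P.root ξ) :=
    mul_lt_mul hlt (P.eval_mono hroot hlt.le) (P.eval_pos hroot) (P.root_nonneg hξ)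
  rw [P.root_mul_eval_root hξ, P.root_mul_eval_root hζ] at this
  exact this.not_ge hle

theorem K_nonneg {ξ : ℝ} (hξ : 0 ≤ ξ) : 0 ≤ P.K ξ :=
  (one_div_pos.2 (P.eval_pos (P.root_nonneg hξ))).le

theorem K_antitoneOn : AntitoneOn P.K (Ici 0) := fun _ hξ _ hζ hle =>
  one_div_le_one_div_of_le (P.eval_pos (P.root_nonneg hξ))
    (P.eval_mono (P.root_nonneg hξ) (P.root_monotoneOn hξ hζ hle))

theorem K_le {ξ : ℝ} (hξ : 0 ≤ ξ) : P.K ξ ≤ 1 / P.coeff 0 :=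
  one_div_le_one_div_of_le P.coeff_zero_pos (P.coeff_zero_le_eval (P.root_nonneg hξ))

theorem rpow_β_le_of_root_le_one {δ ξ : ℝ} (hδ : 0 < δ) (hξ : δ ≤ ξ) (hs : P.root ξ ≤ 1) :
    ξ ^ P.β ≤ P.eval 1 * δ ^ (P.β - 2) * (P.K ξ * ξ ^ 2) := by
  have hξ0 : 0 < ξ := hδ.trans_le hξ
  have hroot := P.root_nonneg hξ0.le
  have hle : ξ ≤ P.root ξ * P.eval 1 := by
    calc ξ = P.root ξ * P.eval (P.root ξ) := (P.root_mul_eval_root hξ0.le).symm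
      _ ≤ P.root ξ * P.eval 1 := mul_le_mul_of_nonneg_left (P.eval_mono hroot hs) hroot
  calc ξ ^ P.β = ξ ^ (P.β - 2) * (ξ * ξ) := by
        rw [← pow_two, ← Real.rpow_natCast ξ 2, ← Real.rpow_add hξ0]; norm_num
    _ ≤ δ ^ (P.β - 2) * (P.root ξ * P.eval 1 * ξ) :=
        mul_le_mul (Real.rpow_le_rpow_of_nonpos hδ hξ (by linarith [P.β_le_two]))
          (mul_le_mul_of_nonneg_right hle hξ0.le) (by positivity) (by positivity)
    _ = P.eval 1 * δ ^ (P.β - 2) * (P.K ξ * ξ ^ 2) := by rw [P.K_mul_sq hξ0.le]; ring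

theorem rpow_β_le_of_one_le_root {ξ : ℝ} (hξ : 0 < ξ) (hs : 1 ≤ P.root ξ) :
    ξ ^ P.β ≤ P.eval 1 ^ (P.β - 1) * (P.K ξ * ξ ^ 2) := by
  have hroot := P.root_nonneg hξ.le
  have hβ := P.one_lt_β
  have hle : ξ ≤ P.eval 1 * P.root ξ ^ (P.deg + 1) := by
    calc ξ = P.root ξ * P.eval (P.root ξ) := (P.root_mul_eval_root hξ.le).symm
      _ ≤ P.root ξ * (P.eval 1 * P.root ξ ^ P.deg) :=
          mul_le_mul_of_nonneg_left (P.eval_le_mul_rpow_deg hs) hroot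
      _ = P.eval 1 * P.root ξ ^ (P.deg + 1) := by rw [Real.rpow_add_one (by positivity)]; ring
  calc ξ ^ P.β = ξ ^ (P.β - 1) * ξ := by
        rw [← Real.rpow_add_one hξ.ne', sub_add_cancel]
    _ ≤ (P.eval 1 * P.root ξ ^ (P.deg + 1)) ^ (P.β - 1) * ξ := by
        gcongr
    _ = P.eval 1 ^ (P.β - 1) * (P.K ξ * ξ ^ 2) := by
        rw [Real.mul_rpow (P.eval_pos zero_le_one).le (by positivity), ← Real.rpow_mul hroot,
          P.deg_add_one_mul_β_sub_one, Real.rpow_one, P.K_mul_sq hξ.le]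
        ring

theorem exists_rpow_β_le {η : ℝ} (hη : 0 < η) :
    ∃ C : ℝ, 0 < C ∧ ∀ ξ : ℝ, 0 ≤ ξ → ξ ^ P.β ≤ η + C * (P.K ξ * ξ ^ 2) := by
  have hA : 0 < P.eval 1 := P.eval_pos zero_le_one
  have hβ := P.β_pos
  set δ := η ^ (1 / P.β) with hδ_def
  have hδ : 0 < δ := Real.rpow_pos_of_pos hη _
  have hδη : δ ^ P.β = η := by
    rw [hδ_def, ← Real.rpow_mul hη.le, one_div_mul_cancel hβ.ne', Real.rpow_one]
  refine ⟨P.eval 1 * δ ^ (P.β - 2) + P.eval 1 ^ (P.β - 1), by positivity, fun ξ hξ => ?_⟩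
  have hKξ : 0 ≤ P.K ξ * ξ ^ 2 := mul_nonneg (P.K_nonneg hξ) (sq_nonneg ξ)
  have hsmall : 0 ≤ P.eval 1 * δ ^ (P.β - 2) * (P.K ξ * ξ ^ 2) := by positivity
  have hlarge : 0 ≤ P.eval 1 ^ (P.β - 1) * (P.K ξ * ξ ^ 2) := by positivity
  rw [add_mul]
  rcases le_or_gt ξ δ with hle | hgt
  · linarith [hδη ▸ Real.rpow_le_rpow hξ hle hβ.le]
  · rcases le_total (P.root ξ) 1 with hs | hs
    · linarith [P.rpow_β_le_of_root_le_one hδ hgt.le hs]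
    · linarith [P.rpow_β_le_of_one_le_root (hδ.trans hgt) hs]

theorem K_sub_K_mul_le {ξ ζ : ℝ} (hξ : 0 ≤ ξ) (h : ξ ≤ ζ) :
    (P.K ξ - P.K ζ) * ξ ≤ P.K ξ * (ζ - ξ) := by
  have hζ : 0 ≤ ζ := hξ.trans h
  rcases hζ.eq_or_lt with h0 | h0
  · simp [le_antisymm (h0 ▸ h) hξ, ← h0]
  have hmono : P.K ξ * ξ ≤ P.K ζ * ζ := by
    rw [P.K_mul_self hξ, P.K_mul_self hζ]; exact P.root_monotoneOn hξ hζ h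
  refine le_of_mul_le_mul_right ?_ h0
  calc (P.K ξ - P.K ζ) * ξ * ζ = P.K ξ * ξ * ζ - P.K ζ * ζ * ξ := by ring
    _ ≤ P.K ξ * ξ * ζ - P.K ξ * ξ * ξ := by gcongr
    _ = P.K ξ * ξ * (ζ - ξ) := by ring
    _ ≤ P.K ξ * ζ * (ζ - ξ) := by
        have := P.K_nonneg hξ
        have : 0 ≤ ζ - ξ := sub_nonneg.2 h
        gcongr
    _ = P.K ξ * (ζ - ξ) * ζ := by ring

theorem intervalIntegrable_root {x y : ℝ} (hx : 0 ≤ x) (hy : 0 ≤ y) :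
    IntervalIntegrable P.root volume x y :=
  (P.root_monotoneOn.mono fun _ hs => (le_min hx hy).trans hs.1).intervalIntegrable

theorem root_mul_sub_le_integral {x y : ℝ} (hx : 0 ≤ x) (hy : 0 ≤ y) :
    P.root x * (y - x) ≤ ∫ s in x..y, P.root s := by
  rcases le_total x y with h | h
  · have := intervalIntegral.integral_mono_on h (f := fun _ => P.root x) (g := P.root)
      (by simp) (P.intervalIntegrable_root hx hy)
      (fun s hs => P.root_monotoneOn hx (hx.trans hs.1) hs.1)
    simp only [intervalIntegral.integral_const, smul_eq_mul] at this
    linarith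
  · have := intervalIntegral.integral_mono_on h (f := P.root) (g := fun _ => P.root x)
      (P.intervalIntegrable_root hy hx) (by simp)
      (fun s hs => P.root_monotoneOn (hy.trans hs.1) hx hs.2)
    simp only [intervalIntegral.integral_const, smul_eq_mul] at this
    rw [intervalIntegral.integral_symm]
    linarith

/-- The potential `v ↦ 2 ∫₀^{|v|} K(s) s ds` of twice the flux, using `K(s) s = s(ξ)` at `ξ = s`. -/
def potential {E : Type*} [NormedAddCommGroup E] (v : E) : ℝ := 2 * ∫ s in (0 : ℝ)..‖v‖, P.root s

theorem potential_zero {E : Type*} [NormedAddCommGroup E] : P.potential (0 : E) = 0 := by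
  simp [potential]

section Flux

variable {E : Type*} [NormedAddCommGroup E] [InnerProductSpace ℝ E]

/-- The (negative) Forchheimer flux `v ↦ K(|v|) v` driven by the density gradient `v`. -/
def flux (v : E) : E := P.K ‖v‖ • v

theorem flux_zero : P.flux (0 : E) = 0 := smul_zero _

theorem inner_flux_self (v : E) : inner ℝ (P.flux v) v = P.K ‖v‖ * ‖v‖ ^ 2 := by
  rw [flux, real_inner_smul_left, real_inner_self_eq_norm_sq]

theorem norm_flux_sq_le (v : E) : ‖P.flux v‖ ^ 2 ≤ 1 / P.coeff 0 * inner ℝ (P.flux v) v := by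
  have hK := P.K_nonneg (norm_nonneg v)
  rw [P.inner_flux_self, flux, norm_smul, Real.norm_of_nonneg hK]
  calc (P.K ‖v‖ * ‖v‖) ^ 2 = P.K ‖v‖ * (P.K ‖v‖ * ‖v‖ ^ 2) := by ring
    _ ≤ 1 / P.coeff 0 * (P.K ‖v‖ * ‖v‖ ^ 2) :=
        mul_le_mul_of_nonneg_right (P.K_le (norm_nonneg v)) (by positivity)

theorem norm_flux_sub_le_of_norm_le {u v : E} (h : ‖u‖ ≤ ‖v‖) :
    ‖P.flux v - P.flux u‖ ≤ 2 / P.coeff 0 * ‖v - u‖ := by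
  have hu := norm_nonneg u
  have hv := norm_nonneg v
  have hc := P.coeff_zero_pos
  have hanti : P.K ‖v‖ ≤ P.K ‖u‖ := P.K_antitoneOn hu hv h
  calc ‖P.flux v - P.flux u‖ = ‖P.K ‖v‖ • (v - u) - (P.K ‖u‖ - P.K ‖v‖) • u‖ := by
        congr 1; simp only [flux]; module
    _ ≤ ‖P.K ‖v‖ • (v - u)‖ + ‖(P.K ‖u‖ - P.K ‖v‖) • u‖ := norm_sub_le _ _
    _ = P.K ‖v‖ * ‖v - u‖ + (P.K ‖u‖ - P.K ‖v‖) * ‖u‖ := by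
        rw [norm_smul, norm_smul, Real.norm_of_nonneg (P.K_nonneg hv),
          Real.norm_of_nonneg (sub_nonneg.2 hanti)]
    _ ≤ 1 / P.coeff 0 * ‖v - u‖ + 1 / P.coeff 0 * ‖v - u‖ := by
        refine add_le_add (mul_le_mul_of_nonneg_right (P.K_le hv) (norm_nonneg _))
          ((P.K_sub_K_mul_le hu h).trans ?_)
        exact mul_le_mul (P.K_le hu) (norm_sub_norm_le v u) (sub_nonneg.2 h) (by positivity)
    _ = 2 / P.coeff 0 * ‖v - u‖ := by ring

theorem norm_flux_sub_le (u v : E) : ‖P.flux v - P.flux u‖ ≤ 2 / P.coeff 0 * ‖v - u‖ := by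
  rcases le_total ‖u‖ ‖v‖ with h | h
  · exact P.norm_flux_sub_le_of_norm_le h
  · rw [norm_sub_rev, norm_sub_rev v]; exact P.norm_flux_sub_le_of_norm_le h

theorem lipschitzWith_flux :
    LipschitzWith (Real.toNNReal (2 / P.coeff 0)) (P.flux : E → E) := by
  refine LipschitzWith.of_dist_le_mul fun v u => ?_
  rw [dist_eq_norm, dist_eq_norm, Real.coe_toNNReal _ (by have := P.coeff_zero_pos; positivity)]
  exact P.norm_flux_sub_le u v

/-- Convexity of the potential: twice the flux is a subgradient. -/
theorem two_inner_flux_le (u v : E) :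
    2 * inner ℝ (P.flux u) (v - u) ≤ P.potential v - P.potential u := by
  have hu := norm_nonneg u
  have hv := norm_nonneg v
  have hflux : inner ℝ (P.flux u) (v - u) ≤ P.root ‖u‖ * (‖v‖ - ‖u‖) := by
    rw [flux, real_inner_smul_left, inner_sub_right, real_inner_self_eq_norm_sq,
      ← P.K_mul_self hu, mul_assoc]
    exact mul_le_mul_of_nonneg_left (by nlinarith [real_inner_le_norm u v]) (P.K_nonneg hu)
  have hsplit : (∫ s in (0 : ℝ)..‖v‖, P.root s) - ∫ s in (0 : ℝ)..‖u‖, P.root s =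
      ∫ s in ‖u‖..‖v‖, P.root s :=
    intervalIntegral.integral_interval_sub_left (P.intervalIntegrable_root le_rfl hv)
      (P.intervalIntegrable_root le_rfl hu)
  unfold potential
  linarith [P.root_mul_sub_le_integral hu hv]

theorem potential_le (v : E) : P.potential v ≤ 2 * inner ℝ (P.flux v) v := by
  have := P.two_inner_flux_le v 0
  rw [potential_zero, zero_sub, inner_neg_right] at this
  linarith

theorem inner_flux_le_potential (v : E) : inner ℝ (P.flux v) v ≤ P.potential v := by
  have hv := norm_nonneg v
  have h := intervalIntegral.integral_mono_on hv (f := fun s => P.K ‖v‖ * s) (g := P.root)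
    (Continuous.intervalIntegrable (by fun_prop) _ _) (P.intervalIntegrable_root le_rfl hv)
    (fun s hs => by
      rw [← P.K_mul_self hs.1]
      exact mul_le_mul_of_nonneg_right (P.K_antitoneOn hs.1 hv hs.2) hs.1)
  rw [intervalIntegral.integral_const_mul, integral_id] at h
  rw [inner_flux_self, potential]
  linarith

theorem potential_sub_le (u v : E) :
    P.potential v - P.potential u ≤
      2 * inner ℝ (P.flux u) (v - u) + 4 / P.coeff 0 * ‖v - u‖ ^ 2 := by
  have hconv := P.two_inner_flux_le v u
  have hlip : inner ℝ (P.flux v - P.flux u) (v - u) ≤ 2 / P.coeff 0 * ‖v - u‖ ^ 2 :=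
    (real_inner_le_norm _ _).trans (by
      rw [pow_two, ← mul_assoc]
      exact mul_le_mul_of_nonneg_right (P.norm_flux_sub_le u v) (norm_nonneg _))
  rw [inner_sub_left] at hlip
  rw [← neg_sub v u, inner_neg_right] at hconv
  have : 4 / P.coeff 0 * ‖v - u‖ ^ 2 = 2 * (2 / P.coeff 0 * ‖v - u‖ ^ 2) := by ring
  linarith

theorem continuous_potential : Continuous (P.potential : E → ℝ) := by
  refine continuous_iff_continuousAt.2 fun u => ?_
  have hlower : Tendsto (fun v => 2 * inner ℝ (P.flux u) (v - u)) (𝓝 u) (𝓝 0) := by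
    have : Continuous fun v => 2 * inner ℝ (P.flux u) (v - u) := by fun_prop
    simpa using this.tendsto u
  have hupper : Tendsto (fun v => 2 * inner ℝ (P.flux u) (v - u) + 4 / P.coeff 0 * ‖v - u‖ ^ 2)
      (𝓝 u) (𝓝 0) := by
    have : Continuous fun v =>
        2 * inner ℝ (P.flux u) (v - u) + 4 / P.coeff 0 * ‖v - u‖ ^ 2 := by fun_prop
    simpa using this.tendsto u
  have hdiff := tendsto_of_tendsto_of_tendsto_of_le_of_le hlower hupper
    (P.two_inner_flux_le u) (P.potential_sub_le u)
  simpa [ContinuousAt] using hdiff.add_const (P.potential u)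

end Flux

end GenPoly

/-! ### Scalar differential inequalities -/

theorem exists_le_of_deriv_le_neg {z z' : ℝ → ℝ} {M κ t₀ : ℝ} (hκ : 0 < κ)
    (hz : ∀ t, t₀ ≤ t → HasDerivAt z (z' t) t) (h0 : ∀ t, t₀ ≤ t → 0 ≤ z t)
    (h : ∀ t, t₀ ≤ t → M ≤ z t → z' t ≤ -κ) : ∃ t, t₀ ≤ t ∧ z t ≤ M := by
  by_contra! hM
  set T := t₀ + (z t₀ + 1) / κ with hT
  have hz0 := h0 t₀ le_rfl
  have ht₀T : t₀ < T := lt_add_of_pos_right _ (by positivity)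
  obtain ⟨c, hc, hslope⟩ := exists_hasDerivAt_eq_slope z z' ht₀T
    (fun t ht => (hz t ht.1).continuousAt.continuousWithinAt) (fun t ht => hz t ht.1.le)
  have hdrop := h c hc.1.le (hM c hc.1.le).le
  rw [hslope, div_le_iff₀ (by linarith)] at hdrop
  have hlength : -κ * (T - t₀) = -(z t₀ + 1) := by rw [hT]; field_simp; ring
  linarith [h0 T ht₀T.le]

theorem eventually_le_of_deriv_le_neg {z z' : ℝ → ℝ} {M κ t₀ : ℝ} (hκ : 0 < κ)
    (hz : ∀ t, t₀ ≤ t → HasDerivAt z (z' t) t) (h0 : ∀ t, t₀ ≤ t → 0 ≤ z t)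
    (h : ∀ t, t₀ ≤ t → M ≤ z t → z' t ≤ -κ) : ∀ᶠ t in atTop, z t ≤ M := by
  obtain ⟨t₁, ht₁, hle⟩ := exists_le_of_deriv_le_neg hκ hz h0 h
  filter_upwards [eventually_ge_atTop t₁] with t ht
  refine image_le_of_deriv_right_lt_deriv_boundary (f := z) (f' := z') (B := fun _ => M)
    (B' := fun _ => 0) (a := t₁) (b := t)
    (fun s hs => (hz s (ht₁.trans hs.1)).continuousAt.continuousWithinAt)
    (fun s hs => (hz s (ht₁.trans hs.1)).hasDerivWithinAt) hle (fun s => hasDerivAt_const s M)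
    (fun s hs hs' => ?_) ⟨ht, le_rfl⟩
  linarith [h s (ht₁.trans hs.1) hs'.ge]

theorem le_max_of_deriv_neg {z z' : ℝ → ℝ} {M t : ℝ} (ht : 0 ≤ t)
    (hc : ContinuousWithinAt z (Ici 0) 0)
    (hz : ∀ s, 0 < s → HasDerivAt z (z' s) s)
    (h : ∀ s, 0 < s → s ≤ t → M ≤ z s → z' s < 0) : z t ≤ max (z 0) M := by
  rcases ht.eq_or_lt with rfl | ht
  · exact le_max_left _ _
  have hlim : Tendsto (fun s => max (z s) M) (𝓝[>] 0) (𝓝 (max (z 0) M)) :=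
    Tendsto.max (hc.mono_left (nhdsWithin_mono _ Ioi_subset_Ici_self)) tendsto_const_nhds
  refine ge_of_tendsto hlim ?_
  filter_upwards [Ioo_mem_nhdsGT ht] with s hs
  refine image_le_of_deriv_right_lt_deriv_boundary (f := z) (f' := z')
    (B := fun _ => max (z s) M) (B' := fun _ => 0) (a := s) (b := t)
    (fun τ hτ => (hz τ (hs.1.trans_le hτ.1)).continuousAt.continuousWithinAt)
    (fun τ hτ => (hz τ (hs.1.trans_le hτ.1)).hasDerivWithinAt) (le_max_left _ _)
    (fun s => hasDerivAt_const s _) (fun τ hτ hτ' => ?_) ⟨hs.2.le, le_rfl⟩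
  exact h τ (hs.1.trans_le hτ.1) hτ.2.le (hτ' ▸ le_max_right _ _)

theorem hasDerivAt_exp_neg_mul_sub (c t s : ℝ) :
    HasDerivAt (fun s : ℝ => Real.exp (-c * (t - s))) (Real.exp (-c * (t - s)) * c) s := by
  have h : HasDerivAt (fun s : ℝ => -c * (t - s)) c s := by
    simpa using ((hasDerivAt_id s).const_sub t).const_mul (-c)
  exact h.exp

theorem continuous_exp_neg_mul_sub (c t : ℝ) :
    Continuous fun s : ℝ => Real.exp (-c * (t - s)) := by
  fun_prop

theorem integral_exp_neg_mul_sub_le {c : ℝ} (hc : 0 < c) (t : ℝ) :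
    ∫ s in (0 : ℝ)..t, Real.exp (-c * (t - s)) ≤ 1 / c := by
  have hderiv : ∀ s ∈ uIcc 0 t, HasDerivAt (fun s : ℝ => Real.exp (-c * (t - s)) / c)
      (Real.exp (-c * (t - s))) s := fun s _ => by
    simpa [hc.ne'] using (hasDerivAt_exp_neg_mul_sub c t s).div_const c
  rw [intervalIntegral.integral_eq_sub_of_hasDerivAt hderiv
    ((continuous_exp_neg_mul_sub c t).intervalIntegrable _ _)]
  have : 0 < Real.exp (-c * (t - 0)) / c := by positivity
  simp only [sub_self, mul_zero, Real.exp_zero]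
  linarith

theorem le_exp_add_integral_of_deriv_le {z z' k : ℝ → ℝ} {c t : ℝ} (ht : 0 ≤ t)
    (hc : ContinuousWithinAt z (Ici 0) 0)
    (hz : ∀ s, 0 < s → HasDerivAt z (z' s) s)
    (hk : IntervalIntegrable k volume 0 t)
    (h : ∀ s, 0 < s → s ≤ t → z' s ≤ -c * z s + k s) :
    z t ≤ Real.exp (-c * t) * z 0 + ∫ s in (0 : ℝ)..t, Real.exp (-c * (t - s)) * k s := by
  have hexp := continuous_exp_neg_mul_sub c t
  have hzc : ContinuousOn z (Icc 0 t) := by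
    intro s hs
    rcases hs.1.eq_or_lt with rfl | hs0
    · exact hc.mono Icc_subset_Ici_self
    · exact (hz s hs0).continuousAt.continuousWithinAt
  have key := intervalIntegral.sub_le_integral_of_hasDeriv_right_of_le (a := 0) (b := t)
    (g := fun s => Real.exp (-c * (t - s)) * z s)
    (g' := fun s => Real.exp (-c * (t - s)) * c * z s + Real.exp (-c * (t - s)) * z' s)
    (φ := fun s => Real.exp (-c * (t - s)) * k s) ht (hexp.continuousOn.mul hzc)
    (fun s hs => ((hasDerivAt_exp_neg_mul_sub c t s).mul (hz s hs.1)).hasDerivWithinAt)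
    ((intervalIntegrable_iff_integrableOn_Icc_of_le ht).1
      (hk.continuousOn_mul hexp.continuousOn))
    (fun s hs => by
      linarith [mul_le_mul_of_nonneg_left (h s hs.1 hs.2.le) (Real.exp_pos (-c * (t - s))).le])
  simp only [sub_self, mul_zero, Real.exp_zero, one_mul, sub_zero] at key
  linarith

theorem le_add_div_add_integral_of_deriv_le {z z' k : ℝ → ℝ} {A c t : ℝ} (ht : 0 ≤ t)
    (hA : 0 ≤ A) (hc : 0 < c) (hz0 : 0 ≤ z 0) (hzc : ContinuousWithinAt z (Ici 0) 0)
    (hz : ∀ s, 0 < s → HasDerivAt z (z' s) s) (hk : IntervalIntegrable k volume 0 t)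
    (h : ∀ s, 0 < s → s ≤ t → z' s ≤ -c * z s + (A + k s)) :
    z t ≤ z 0 + A / c + ∫ s in (0 : ℝ)..t, Real.exp (-c * (t - s)) * k s := by
  have hexp := continuous_exp_neg_mul_sub c t
  have hgronwall := le_exp_add_integral_of_deriv_le ht hzc hz (intervalIntegrable_const.add hk) h
  have hsplit : ∫ s in (0 : ℝ)..t, Real.exp (-c * (t - s)) * (A + k s) =
      A * (∫ s in (0 : ℝ)..t, Real.exp (-c * (t - s))) +
        ∫ s in (0 : ℝ)..t, Real.exp (-c * (t - s)) * k s := by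
    rw [← intervalIntegral.integral_const_mul, ← intervalIntegral.integral_add
      ((hexp.intervalIntegrable _ _).const_mul _) (hk.continuousOn_mul hexp.continuousOn)]
    exact intervalIntegral.integral_congr fun s _ => by ring
  have hinit : Real.exp (-c * t) * z 0 ≤ z 0 :=
    mul_le_of_le_one_left hz0 (Real.exp_le_one_iff.2 (by nlinarith))
  have hconst := mul_le_mul_of_nonneg_left (integral_exp_neg_mul_sub_le hc t) hA
  rw [mul_one_div] at hconst
  linarith

theorem exists_young_const {β : ℝ} (hβ : 1 < β) {δ : ℝ} (hδ : 0 < δ) :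
    ∃ C : ℝ, 0 < C ∧ ∀ a b : ℝ, 0 ≤ a → 0 ≤ b →
      2 * b * a ≤ δ * a ^ β + C * b ^ (β / (β - 1)) := by
  have hβ0 : 0 < β := zero_lt_one.trans hβ
  have hconj : β.HolderConjugate (β / (β - 1)) := Real.HolderConjugate.conjExponent hβ
  set θ := δ ^ (1 / β) with hθ_def
  have hθ : 0 < θ := Real.rpow_pos_of_pos hδ _
  have hθδ : θ ^ β = δ := by
    rw [hθ_def, ← Real.rpow_mul hδ.le, one_div_mul_cancel hβ0.ne', Real.rpow_one]
  refine ⟨(2 / θ) ^ (β / (β - 1)), by positivity, fun a b ha hb => ?_⟩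
  have hfst : (θ * a) ^ β / β ≤ δ * a ^ β := by
    rw [Real.mul_rpow hθ.le ha, hθδ]
    exact div_le_self (by positivity) hβ.le
  have hsnd : (2 / θ * b) ^ (β / (β - 1)) / (β / (β - 1)) ≤
      (2 / θ) ^ (β / (β - 1)) * b ^ (β / (β - 1)) := by
    rw [Real.mul_rpow (by positivity) hb]
    exact div_le_self (by positivity) hconj.symm.lt.le
  calc 2 * b * a = θ * a * (2 / θ * b) := by field_simp
    _ ≤ (θ * a) ^ β / β + (2 / θ * b) ^ (β / (β - 1)) / (β / (β - 1)) :=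
        Real.young_inequality_of_nonneg (by positivity) (by positivity) hconj
    _ ≤ δ * a ^ β + (2 / θ) ^ (β / (β - 1)) * b ^ (β / (β - 1)) := add_le_add hfst hsnd

theorem one_add_rpow_le {x p : ℝ} (hx : 0 ≤ x) (hp : 0 ≤ p) :
    (1 + x) ^ p ≤ 2 ^ p * (1 + x ^ p) := by
  have hsum : 1 + x ≤ 2 * max 1 x := by linarith [le_max_left 1 x, le_max_right 1 x]
  have hmax : max 1 x ^ p ≤ 1 + x ^ p := by
    rcases le_total x 1 with h | h
    · rw [max_eq_left h, Real.one_rpow]; linarith [Real.rpow_nonneg hx p]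
    · rw [max_eq_right h]; linarith
  calc (1 + x) ^ p ≤ (2 * max 1 x) ^ p := Real.rpow_le_rpow (by positivity) hsum hp
    _ = 2 ^ p * max 1 x ^ p := Real.mul_rpow (by norm_num) (by positivity)
    _ ≤ 2 ^ p * (1 + x ^ p) := mul_le_mul_of_nonneg_left hmax (by positivity)

theorem rpow_le_one_add_rpow {x p q : ℝ} (hx : 0 ≤ x) (hp : 0 ≤ p) (hpq : p ≤ q) :
    x ^ p ≤ 1 + x ^ q := by
  rcases le_total x 1 with h | h
  · linarith [Real.rpow_nonneg hx q, Real.rpow_le_one hx h hp]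
  · linarith [Real.rpow_le_rpow_of_exponent_le h hpq]

theorem exists_mul_one_add_le_mul_rpow {β δ K : ℝ} (hβ : 0 < β) (hδ : 0 < δ) (hK : 0 < K) :
    ∃ M : ℝ, 0 < M ∧ ∀ x z : ℝ, 0 ≤ x → M * (1 + x ^ (2 / β)) ≤ z →
      K * (1 + x) ≤ δ * z ^ (β / 2) := by
  refine ⟨(K / δ) ^ (2 / β) * 2 ^ (2 / β), by positivity, fun x z hx hz => ?_⟩
  have hlevel : (K / δ * (1 + x)) ^ (2 / β) ≤ z := by
    rw [Real.mul_rpow (by positivity) (by positivity)]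
    refine (mul_le_mul_of_nonneg_left (one_add_rpow_le hx (by positivity))
      (by positivity)).trans ?_
    rwa [← mul_assoc]
  have hpow := Real.rpow_le_rpow (by positivity) hlevel (by positivity : 0 ≤ β / 2)
  rw [← Real.rpow_mul (by positivity), div_mul_div_cancel₀ hβ.ne', div_self two_ne_zero,
    Real.rpow_one] at hpow
  calc K * (1 + x) = δ * (K / δ * (1 + x)) := by field_simp
    _ ≤ δ * z ^ (β / 2) := mul_le_mul_of_nonneg_left hpow hδ.le

/-! ### Energy systems -/

/-- The quantity `g(t) = q(t)^λ + ψ(t)`, `λ = β / (β - 1)`, which measures the data in the energy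
inequalities, see `gData`. -/
def dataSize (β : ℝ) (q ψ : ℝ → ℝ) (t : ℝ) : ℝ := q t ^ (β / (β - 1)) + ψ t

/-- The scalar inequalities satisfied by the energies of a semidiscrete solution: `y` is the squared
`L²` norm of its oscillating part, `H` the potential energy, `D` the dissipation and `E` the
gradient energy, while `q = ‖f̃‖`, `ψ = ‖φ‖₁²` and `χ = ‖φ_t‖₁²` are the norms of the data. The
constants `C₁` and `Cη` do not depend on the system, and `y'`, `H'` are the derivatives of
`y`, `H`. -/
structure EnergySystem (β C₁ : ℝ) (Cη : ℝ → ℝ) (q ψ χ : ℝ → ℝ) where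
  (y y' H H' D E : ℝ → ℝ)
  y_deriv : ∀ t, 0 < t → HasDerivAt y (y' t) t
  H_deriv : ∀ t, 0 < t → HasDerivAt H (H' t) t
  y_cont : ContinuousWithinAt y (Ici 0) 0
  H_cont : ContinuousWithinAt H (Ici 0) 0
  y_nonneg : ∀ t, 0 ≤ t → 0 ≤ y t
  D_nonneg : ∀ t, 0 ≤ t → 0 ≤ D t
  E_nonneg : ∀ t, 0 ≤ t → 0 ≤ E t
  ψ_nonneg : ∀ t, 0 ≤ t → 0 ≤ ψ t
  q_nonneg : ∀ t, 0 ≤ t → 0 ≤ q t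
  χ_nonneg : ∀ t, 0 ≤ t → 0 ≤ χ t
  y_le : ∀ t, 0 < t → y' t ≤ 2 * q t * √(y t) - D t + C₁ * ψ t
  H_le : ∀ t, 0 < t → H' t ≤ q t ^ 2 + D t / 2 + C₁ * χ t
  D_le_H : ∀ t, 0 ≤ t → D t ≤ H t
  H_le_D : ∀ t, 0 ≤ t → H t ≤ 2 * D t
  y_rpow_le : ∀ η, 0 < η → ∀ t, 0 ≤ t → y t ^ (β / 2) ≤ η + Cη η * (D t + ψ t)
  E_le : ∀ η, 0 < η → ∀ t, 0 ≤ t → E t ≤ η + Cη η * D t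

namespace EnergySystem

variable {β C₁ : ℝ} {Cη : ℝ → ℝ} {q ψ χ : ℝ → ℝ}

theorem H_nonneg (S : EnergySystem β C₁ Cη q ψ χ) {t : ℝ} (ht : 0 ≤ t) : 0 ≤ S.H t :=
  (S.D_nonneg t ht).trans (S.D_le_H t ht)

theorem dataSize_nonneg (S : EnergySystem β C₁ Cη q ψ χ) {t : ℝ} (ht : 0 ≤ t) :
    0 ≤ dataSize β q ψ t :=
  add_nonneg (Real.rpow_nonneg (S.q_nonneg t ht) _) (S.ψ_nonneg t ht)

theorem E_le_of_add_le (S : EnergySystem β C₁ Cη q ψ χ) (hCη : 0 < Cη 1) {t B : ℝ} (ht : 0 ≤ t)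
    (hB : S.H t + 4 * S.y t ≤ B) : S.E t ≤ 1 + Cη 1 * B := by
  refine (S.E_le 1 one_pos t ht).trans (add_le_add_right ?_ 1)
  refine mul_le_mul_of_nonneg_left ?_ hCη.le
  linarith [S.D_le_H t ht, S.y_nonneg t ht]

theorem exists_deriv_y_le (hβ : 1 < β) (hC₁ : 0 < C₁) (hCη : 0 < Cη 1) :
    ∃ δ C : ℝ, 0 < δ ∧ 0 < C ∧
      ∀ {q ψ χ : ℝ → ℝ} (S : EnergySystem β C₁ Cη q ψ χ) (t : ℝ), 0 < t →
        S.y' t ≤ -S.D t / 2 - δ * S.y t ^ (β / 2) + C * (1 + dataSize β q ψ t) := by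
  obtain ⟨δ, hδ, hδ_def⟩ : ∃ δ : ℝ, 0 < δ ∧ 2 * δ * Cη 1 = 1 / 2 :=
    ⟨1 / (4 * Cη 1), by positivity, by field_simp; norm_num⟩
  obtain ⟨Cy, hCy, hyoung⟩ := exists_young_const hβ hδ
  refine ⟨δ, 2 * δ + Cy + C₁ + 1, hδ, by positivity, fun {q ψ χ} S t ht => ?_⟩
  have hy := S.y_nonneg t ht.le
  have hψ := S.ψ_nonneg t ht.le
  have hqp : 0 ≤ q t ^ (β / (β - 1)) := Real.rpow_nonneg (S.q_nonneg t ht.le) _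
  have hwork : 2 * q t * √(S.y t) ≤ δ * S.y t ^ (β / 2) + Cy * q t ^ (β / (β - 1)) := by
    have h := hyoung (√(S.y t)) (q t) (Real.sqrt_nonneg _) (S.q_nonneg t ht.le)
    rwa [Real.sqrt_eq_rpow, ← Real.rpow_mul hy, show (1 : ℝ) / 2 * β = β / 2 by ring,
      ← Real.sqrt_eq_rpow] at h
  have habsorb : 2 * δ * S.y t ^ (β / 2) ≤ 2 * δ + (S.D t + ψ t) / 2 :=
    calc 2 * δ * S.y t ^ (β / 2) ≤ 2 * δ * (1 + Cη 1 * (S.D t + ψ t)) :=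
          mul_le_mul_of_nonneg_left (S.y_rpow_le 1 one_pos t ht.le) (by positivity)
      _ = 2 * δ + 2 * δ * Cη 1 * (S.D t + ψ t) := by ring
      _ = 2 * δ + (S.D t + ψ t) / 2 := by rw [hδ_def]; ring
  have hdata : 2 * δ + Cy * q t ^ (β / (β - 1)) + C₁ * ψ t + ψ t / 2 ≤
      (2 * δ + Cy + C₁ + 1) * (1 + dataSize β q ψ t) := by
    unfold dataSize
    nlinarith [mul_nonneg hδ.le hqp, mul_nonneg hδ.le hψ, mul_nonneg hCy.le hψ,
      mul_nonneg hC₁.le hqp]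
  linarith [S.y_le t ht]

theorem exists_deriv_le (hβ : 1 < β) (hβ2 : β ≤ 2) (hC₁ : 0 < C₁) (hCη : 0 < Cη 1) :
    ∃ δ C : ℝ, 0 < δ ∧ 0 < C ∧
      ∀ {q ψ χ : ℝ → ℝ} (S : EnergySystem β C₁ Cη q ψ χ) (t : ℝ), 0 < t →
        S.y' t ≤ -δ * S.y t ^ (β / 2) + C * (1 + dataSize β q ψ t) ∧
        S.H' t + 4 * S.y' t ≤ -(1 / 2) * (S.H t + 4 * S.y t) +
          (2 * S.y t + C * (1 + dataSize β q ψ t + χ t)) := by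
  obtain ⟨δ, C, hδ, hC, hderiv⟩ := exists_deriv_y_le hβ hC₁ hCη
  refine ⟨δ, 4 * C + C₁ + 1, hδ, by positivity, fun {q ψ χ} S t ht => ?_⟩
  have hD := S.D_nonneg t ht.le
  have hq := S.q_nonneg t ht.le
  have hdiss : 0 ≤ δ * S.y t ^ (β / 2) :=
    mul_nonneg hδ.le (Real.rpow_nonneg (S.y_nonneg t ht.le) _)
  have hsq : q t ^ 2 ≤ 1 + dataSize β q ψ t := by
    have hexp : (2 : ℝ) ≤ β / (β - 1) := by rw [le_div_iff₀ (by linarith)]; linarith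
    have h := rpow_le_one_add_rpow hq zero_le_two hexp
    rw [Real.rpow_two] at h
    unfold dataSize
    linarith [S.ψ_nonneg t ht.le]
  have hg := S.dataSize_nonneg ht.le
  have hχ := S.χ_nonneg t ht.le
  have hy := hderiv S t ht
  constructor
  · nlinarith [mul_nonneg hC.le hg, mul_nonneg hC₁.le hg]
  · nlinarith [mul_nonneg hC.le hχ, mul_nonneg hC₁.le hg, S.H_le t ht, S.H_le_D t ht.le]

theorem exists_y_le_of_envelope (hβ : 1 < β) (hβ2 : β ≤ 2) (hC₁ : 0 < C₁) (hCη : 0 < Cη 1) :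
    ∃ C : ℝ, 0 < C ∧ ∀ {q ψ χ : ℝ → ℝ} (S : EnergySystem β C₁ Cη q ψ χ) (F : ℝ → ℝ),
      MonotoneOn F (Ici 0) → (∀ t, 0 ≤ t → dataSize β q ψ t ≤ F t) →
      ∀ t, 0 ≤ t → S.y t ≤ S.y 0 + C * (1 + F t ^ (2 / β)) := by
  obtain ⟨δ, C, hδ, hC, hderiv⟩ := exists_deriv_le hβ hβ2 hC₁ hCη
  obtain ⟨M, hM, hlevel⟩ := exists_mul_one_add_le_mul_rpow (zero_lt_one.trans hβ) hδ
    (mul_pos two_pos hC)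
  refine ⟨M, hM, fun {q ψ χ} S F hF_mono hF t ht => ?_⟩
  have hFt : 0 ≤ F t := (S.dataSize_nonneg ht).trans (hF t ht)
  have hbarrier : S.y t ≤ max (S.y 0) (M * (1 + F t ^ (2 / β))) := by
    refine le_max_of_deriv_neg ht S.y_cont S.y_deriv fun s hs hst hle => ?_
    have hdata : C * (1 + dataSize β q ψ s) ≤ C * (1 + F t) :=
      mul_le_mul_of_nonneg_left
        (by linarith [hF s hs.le, hF_mono (mem_Ici.2 hs.le) (mem_Ici.2 ht) hst]) hC.le
    linarith [(hderiv S s hs).1, hlevel _ _ hFt hle, mul_pos hC (by linarith : 0 < 1 + F t)]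
  refine hbarrier.trans (max_le_add_of_nonneg (S.y_nonneg 0 le_rfl) ?_)
  have := Real.rpow_nonneg hFt (2 / β)
  positivity

theorem exists_eventually_y_le (hβ : 1 < β) (hβ2 : β ≤ 2) (hC₁ : 0 < C₁) (hCη : 0 < Cη 1) :
    ∃ C : ℝ, 0 < C ∧ ∀ {q ψ χ : ℝ → ℝ} (S : EnergySystem β C₁ Cη q ψ χ) (G : ℝ), 0 ≤ G →
      (∀ᶠ t in atTop, dataSize β q ψ t ≤ G) →
      ∀ᶠ t in atTop, S.y t ≤ C * (1 + G ^ (2 / β)) := by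
  obtain ⟨δ, C, hδ, hC, hderiv⟩ := exists_deriv_le hβ hβ2 hC₁ hCη
  obtain ⟨M, hM, hlevel⟩ := exists_mul_one_add_le_mul_rpow (zero_lt_one.trans hβ) hδ
    (mul_pos two_pos hC)
  refine ⟨M, hM, fun {q ψ χ} S G hG hdata => ?_⟩
  obtain ⟨t₀, h₀⟩ := eventually_atTop.1 (hdata.and (eventually_gt_atTop 0))
  refine eventually_le_of_deriv_le_neg hC (fun t ht => S.y_deriv t (h₀ t ht).2)
    (fun t ht => S.y_nonneg t (h₀ t ht).2.le) fun t ht hle => ?_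
  have hdata : C * (1 + dataSize β q ψ t) ≤ C * (1 + G) :=
    mul_le_mul_of_nonneg_left (by linarith [(h₀ t ht).1]) hC.le
  nlinarith [(hderiv S t (h₀ t ht).2).1, hlevel _ _ hG hle, mul_nonneg hC.le hG]

theorem hasDerivAt_H_add_four_mul_y (S : EnergySystem β C₁ Cη q ψ χ) {t : ℝ} (ht : 0 < t) :
    HasDerivAt (fun t => S.H t + 4 * S.y t) (S.H' t + 4 * S.y' t) t :=
  (S.H_deriv t ht).add ((S.y_deriv t ht).const_mul 4)

theorem exists_deriv_le_of_envelope (hβ : 1 < β) (hβ2 : β ≤ 2) (hC₁ : 0 < C₁) (hCη : 0 < Cη 1) :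
    ∃ C : ℝ, 0 < C ∧ ∀ {q ψ χ : ℝ → ℝ} (S : EnergySystem β C₁ Cη q ψ χ) (F : ℝ → ℝ),
      MonotoneOn F (Ici 0) → (∀ t, 0 ≤ t → dataSize β q ψ t ≤ F t) → ∀ t, 0 < t →
        S.H' t + 4 * S.y' t ≤ -(1 / 2) * (S.H t + 4 * S.y t) +
          (C * (1 + S.y 0) + C * (χ t + F t ^ (2 / β))) := by
  have hp : 1 ≤ 2 / β := by rwa [le_div_iff₀ (zero_lt_one.trans hβ), one_mul]
  obtain ⟨δ, C, -, hC, hderiv⟩ := exists_deriv_le hβ hβ2 hC₁ hCη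
  obtain ⟨M, hM, hy⟩ := exists_y_le_of_envelope hβ hβ2 hC₁ hCη
  refine ⟨2 + 2 * M + 2 * C, by positivity, fun {q ψ χ} S F hF_mono hF t ht => ?_⟩
  have hFt : 0 ≤ F t := (S.dataSize_nonneg ht.le).trans (hF t ht.le)
  have hFp : 0 ≤ F t ^ (2 / β) := Real.rpow_nonneg hFt _
  have hy0 := S.y_nonneg 0 le_rfl
  have hχ := S.χ_nonneg t ht.le
  have hdata : C * (1 + dataSize β q ψ t + χ t) ≤ C * (2 + F t ^ (2 / β) + χ t) := by
    have h := rpow_le_one_add_rpow hFt zero_le_one hp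
    rw [Real.rpow_one] at h
    exact mul_le_mul_of_nonneg_left (by linarith [hF t ht.le]) hC.le
  nlinarith [(hderiv S t ht).2, hy S F hF_mono hF t ht.le, mul_nonneg hM.le hχ,
    mul_nonneg hC.le hχ, mul_nonneg hM.le hy0, mul_nonneg hC.le hy0, mul_nonneg hM.le hFp,
    mul_nonneg hC.le hFp]

theorem exists_E_le_of_envelope (hβ : 1 < β) (hβ2 : β ≤ 2) (hC₁ : 0 < C₁) (hCη : 0 < Cη 1) :
    ∃ C : ℝ, 0 < C ∧ ∀ {q ψ χ : ℝ → ℝ} (S : EnergySystem β C₁ Cη q ψ χ) (F : ℝ → ℝ),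
      ContinuousOn F (Ici 0) → MonotoneOn F (Ici 0) → (∀ t, 0 ≤ t → dataSize β q ψ t ≤ F t) →
      ∀ t, 0 ≤ t → IntervalIntegrable χ volume 0 t →
        S.E t ≤ C * (1 + S.H 0 + S.y 0 + ∫ s in (0 : ℝ)..t,
          Real.exp (-(1 / 2) * (t - s)) * (χ s + F s ^ (2 / β))) := by
  obtain ⟨C, hC, hderiv⟩ := exists_deriv_le_of_envelope hβ hβ2 hC₁ hCη
  refine ⟨1 + Cη 1 * (4 + 2 * C), by positivity, fun {q ψ χ} S F hF_cont hF_mono hF t ht hχ => ?_⟩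
  have hF0 : ∀ s, 0 ≤ s → 0 ≤ F s := fun s hs => (S.dataSize_nonneg hs).trans (hF s hs)
  have hH0 := S.H_nonneg le_rfl
  have hy0 := S.y_nonneg 0 le_rfl
  have hint : IntervalIntegrable (fun s => χ s + F s ^ (2 / β)) volume 0 t := by
    refine hχ.add (ContinuousOn.intervalIntegrable ?_)
    rw [uIcc_of_le ht]
    exact (hF_cont.mono Icc_subset_Ici_self).rpow_const fun s _ =>
      Or.inr (div_nonneg zero_le_two (by linarith))
  have hgronwall := le_add_div_add_integral_of_deriv_le (z := fun t => S.H t + 4 * S.y t) ht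
    (A := C * (1 + S.y 0)) (by positivity) (one_half_pos (α := ℝ)) (by positivity)
    (S.H_cont.add (S.y_cont.const_mul 4)) (fun s hs => S.hasDerivAt_H_add_four_mul_y hs)
    (hint.const_mul C) (fun s hs _ => hderiv S F hF_mono hF s hs)
  simp only [mul_left_comm _ C, intervalIntegral.integral_const_mul] at hgronwall
  have hI : 0 ≤ ∫ s in (0 : ℝ)..t, Real.exp (-(1 / 2) * (t - s)) * (χ s + F s ^ (2 / β)) :=
    intervalIntegral.integral_nonneg ht fun s hs => mul_nonneg (Real.exp_pos _).le
      (add_nonneg (S.χ_nonneg s hs.1) (Real.rpow_nonneg (hF0 s hs.1) _))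
  set I := ∫ s in (0 : ℝ)..t, Real.exp (-(1 / 2) * (t - s)) * (χ s + F s ^ (2 / β))
  have hsum : S.H t + 4 * S.y t ≤ (4 + 2 * C) * (1 + S.H 0 + S.y 0 + I) := by
    nlinarith [mul_nonneg hC.le hH0, mul_nonneg hC.le hI]
  linarith [S.E_le_of_add_le hCη ht hsum]

theorem exists_eventually_E_le (hβ : 1 < β) (hβ2 : β ≤ 2) (hC₁ : 0 < C₁) (hCη : 0 < Cη 1) :
    ∃ C : ℝ, 0 < C ∧ ∀ {q ψ χ : ℝ → ℝ} (S : EnergySystem β C₁ Cη q ψ χ) (G Φ : ℝ), 0 ≤ G →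
      0 ≤ Φ → (∀ᶠ t in atTop, dataSize β q ψ t ≤ G) → (∀ᶠ t in atTop, χ t ≤ Φ) →
      ∀ᶠ t in atTop, S.E t ≤ C * (1 + Φ + G ^ (2 / β)) := by
  have hp : 1 ≤ 2 / β := by rwa [le_div_iff₀ (zero_lt_one.trans hβ), one_mul]
  obtain ⟨δ, C, -, hC, hderiv⟩ := exists_deriv_le hβ hβ2 hC₁ hCη
  obtain ⟨M, hM, hy⟩ := exists_eventually_y_le hβ hβ2 hC₁ hCη
  set B := 2 * M + 2 * C
  refine ⟨1 + Cη 1 * (2 * B + 2), by positivity, fun {q ψ χ} S G Φ hG hΦ hdata hχ => ?_⟩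
  have hGp : 0 ≤ G ^ (2 / β) := Real.rpow_nonneg hG _
  obtain ⟨t₀, h₀⟩ := eventually_atTop.1
    ((hy S G hG hdata).and (hdata.and (hχ.and (eventually_gt_atTop 0))))
  have hsum : ∀ᶠ t in atTop, S.H t + 4 * S.y t ≤ (2 * B + 2) * (1 + Φ + G ^ (2 / β)) := by
    refine eventually_le_of_deriv_le_neg one_pos
      (fun t ht => S.hasDerivAt_H_add_four_mul_y (h₀ t ht).2.2.2) (fun t ht => ?_)
      fun t ht hle => ?_
    · have ht0 := (h₀ t ht).2.2.2.le
      linarith [S.H_nonneg ht0, S.y_nonneg t ht0]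
    · obtain ⟨hyt, hgt, hχt, ht0⟩ := h₀ t ht
      have hsource : C * (1 + dataSize β q ψ t + χ t) ≤ C * (2 + G ^ (2 / β) + Φ) := by
        have h := rpow_le_one_add_rpow hG zero_le_one hp
        rw [Real.rpow_one] at h
        exact mul_le_mul_of_nonneg_left (by linarith) hC.le
      nlinarith [(hderiv S t ht0).2, mul_nonneg hM.le hΦ, mul_nonneg hC.le hΦ,
        mul_nonneg hC.le hGp]
  filter_upwards [hsum, eventually_ge_atTop 0] with t ht ht0
  linarith [S.E_le_of_add_le hCη ht0 ht]

theorem eventually_H_add_y_le (S : EnergySystem β C₁ Cη q ψ χ) (hβ : 0 < β)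
    (hCη : ∀ η, 0 < η → 0 < Cη η) {Y : ℝ} (hY : ∀ᶠ t in atTop, S.y t ≤ Y)
    (hq : Tendsto q atTop (𝓝 0)) (hψ : Tendsto ψ atTop (𝓝 0)) (hχ : Tendsto χ atTop (𝓝 0))
    {ε : ℝ} (hε : 0 < ε) : ∀ᶠ t in atTop, S.H t + S.y t ≤ ε := by
  obtain ⟨η, hη, hη_def⟩ : ∃ η : ℝ, 0 < η ∧ 2 * η = (ε / 4) ^ (β / 2) :=
    ⟨(ε / 4) ^ (β / 2) / 2, by positivity, by ring⟩
  have hC := hCη η hη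
  obtain ⟨δ, hδ, hδη, hδε⟩ : ∃ δ : ℝ, 0 < δ ∧ Cη η * (2 * δ) ≤ η ∧ 2 * δ ≤ ε / 4 := by
    refine ⟨min (η / (2 * Cη η)) (ε / 8), by positivity, ?_, ?_⟩
    · calc Cη η * (2 * min (η / (2 * Cη η)) (ε / 8)) ≤ Cη η * (2 * (η / (2 * Cη η))) := by
            gcongr; exact min_le_left _ _
        _ = η := by field_simp
    · linarith [min_le_right (η / (2 * Cη η)) (ε / 8)]
  have hsource : Tendsto (fun t => 2 * q t * √Y + q t ^ 2 + C₁ * ψ t + C₁ * χ t) atTop (𝓝 0) := by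
    simpa using ((((hq.const_mul 2).mul_const √Y).add (hq.pow 2)).add (hψ.const_mul C₁)).add
      (hχ.const_mul C₁)
  obtain ⟨t₀, h₀⟩ := eventually_atTop.1
    ((hsource.eventually_le_const (by positivity : (0 : ℝ) < δ / 4)).and
      ((hψ.eventually_le_const hδ).and (hY.and (eventually_gt_atTop 0))))
  refine eventually_le_of_deriv_le_neg (z' := fun t => S.H' t + S.y' t) (t₀ := t₀) (κ := δ / 4)
    (by positivity) (fun t ht => (S.H_deriv t (h₀ t ht).2.2.2).add (S.y_deriv t (h₀ t ht).2.2.2))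
    (fun t ht => add_nonneg (S.H_nonneg (h₀ t ht).2.2.2.le) (S.y_nonneg t (h₀ t ht).2.2.2.le))
    fun t ht hle => ?_
  obtain ⟨hsmall, hψt, hYt, ht0⟩ := h₀ t ht
  have hD : δ < S.D t := by
    by_contra! hD
    have hdata : Cη η * (S.D t + ψ t) ≤ Cη η * (2 * δ) :=
      mul_le_mul_of_nonneg_left (by linarith) hC.le
    have hy : S.y t ≤ ε / 4 := by
      rw [← Real.rpow_le_rpow_iff (S.y_nonneg t ht0.le) (by positivity) (half_pos hβ)]
      linarith [S.y_rpow_le η hη t ht0.le]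
    linarith [S.H_le_D t ht0.le]
  have hwork : 2 * q t * √(S.y t) ≤ 2 * q t * √Y :=
    mul_le_mul_of_nonneg_left (Real.sqrt_le_sqrt hYt)
      (mul_nonneg zero_le_two (S.q_nonneg t ht0.le))
  linarith [S.y_le t ht0, S.H_le t ht0]

theorem tendsto_E (S : EnergySystem β C₁ Cη q ψ χ) (hβ : 1 < β) (hβ2 : β ≤ 2) (hC₁ : 0 < C₁)
    (hCη : ∀ η, 0 < η → 0 < Cη η) (hq : Tendsto q atTop (𝓝 0)) (hψ : Tendsto ψ atTop (𝓝 0))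
    (hχ : Tendsto χ atTop (𝓝 0)) : Tendsto S.E atTop (𝓝 0) := by
  have hexp : 0 < β / (β - 1) := div_pos (by linarith) (by linarith)
  have hdata : Tendsto (dataSize β q ψ) atTop (𝓝 0) := by
    unfold dataSize
    simpa [Real.zero_rpow hexp.ne'] using (hq.rpow_const (Or.inr hexp.le)).add hψ
  obtain ⟨M, -, hM⟩ := exists_eventually_y_le hβ hβ2 hC₁ (hCη 1 one_pos)
  have hY := hM S 1 zero_le_one (hdata.eventually_le_const one_pos)
  rw [tendsto_order]
  refine ⟨fun b hb => ?_, fun b hb => ?_⟩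
  · filter_upwards [eventually_ge_atTop 0] with t ht using hb.trans_le (S.E_nonneg t ht)
  have hC := hCη (b / 2) (half_pos hb)
  filter_upwards [S.eventually_H_add_y_le (zero_lt_one.trans hβ) hCη hY hq hψ hχ
    (show 0 < b / 4 / Cη (b / 2) by positivity), eventually_ge_atTop 0] with t ht ht0
  have hD : Cη (b / 2) * S.D t ≤ b / 4 := by
    rw [← le_div_iff₀' hC]
    linarith [S.D_le_H t ht0, S.y_nonneg t ht0]
  linarith [S.E_le (b / 2) (half_pos hb) t ht0]

end EnergySystem

/-! ### Polynomials on a scaled ball -/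

section Polynomial

variable {d : ℕ}

/-- The polynomial function of `p` on Euclidean space. -/
def polyEval (p : MvPolynomial (Fin d) ℝ) (x : EuclideanSpace ℝ (Fin d)) : ℝ :=
  MvPolynomial.eval (fun i => x i) p

/-- The gradient of the polynomial function of `p`, formed from the formal derivatives. -/
def polyGrad (p : MvPolynomial (Fin d) ℝ) (x : EuclideanSpace ℝ (Fin d)) :
    EuclideanSpace ℝ (Fin d) :=
  WithLp.toLp 2 fun i => polyEval (MvPolynomial.pderiv i p) x

theorem continuous_polyEval (p : MvPolynomial (Fin d) ℝ) : Continuous (polyEval p) :=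
  (MvPolynomial.continuous_eval p).comp (by fun_prop)

theorem continuous_polyGrad (p : MvPolynomial (Fin d) ℝ) : Continuous (polyGrad p) :=
  (PiLp.continuous_toLp 2 _).comp (continuous_pi fun _ => continuous_polyEval _)

theorem polyEval_C (c : ℝ) (x : EuclideanSpace ℝ (Fin d)) :
    polyEval (MvPolynomial.C c) x = c := by simp [polyEval]

theorem polyEval_add (p q : MvPolynomial (Fin d) ℝ) (x : EuclideanSpace ℝ (Fin d)) :
    polyEval (p + q) x = polyEval p x + polyEval q x := by simp [polyEval]

theorem polyEval_smul (c : ℝ) (p : MvPolynomial (Fin d) ℝ) (x : EuclideanSpace ℝ (Fin d)) :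
    polyEval (c • p) x = c * polyEval p x := by simp [polyEval]

theorem polyGrad_C (c : ℝ) (x : EuclideanSpace ℝ (Fin d)) :
    polyGrad (MvPolynomial.C c) x = 0 := by
  ext i; simp [polyGrad, polyEval]

theorem polyGrad_add (p q : MvPolynomial (Fin d) ℝ) (x : EuclideanSpace ℝ (Fin d)) :
    polyGrad (p + q) x = polyGrad p x + polyGrad q x := by
  ext i; simp [polyGrad, polyEval]

theorem polyGrad_smul (c : ℝ) (p : MvPolynomial (Fin d) ℝ) (x : EuclideanSpace ℝ (Fin d)) :
    polyGrad (c • p) x = c • polyGrad p x := by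
  ext i; simp [polyGrad, polyEval]

theorem polyGrad_mul_X (p : MvPolynomial (Fin d) ℝ) (j : Fin d) (x : EuclideanSpace ℝ (Fin d)) :
    polyGrad (p * MvPolynomial.X j) x =
      x j • polyGrad p x + polyEval p x • EuclideanSpace.single j (1 : ℝ) := by
  ext i
  rcases eq_or_ne i j with rfl | hij
  · simp [polyGrad, polyEval, add_comm, mul_comm]
  · simp [polyGrad, polyEval, hij, mul_comm]

theorem hasFDerivAt_polyEval (p : MvPolynomial (Fin d) ℝ) (x : EuclideanSpace ℝ (Fin d)) :
    HasFDerivAt (polyEval p) (innerSL ℝ (polyGrad p x)) x := by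
  induction p using MvPolynomial.induction_on with
  | C a =>
    rw [polyGrad_C, map_zero, funext (polyEval_C a)]
    exact hasFDerivAt_const a x
  | add p q hp hq =>
    rw [funext (polyEval_add p q), polyGrad_add, map_add]
    exact hp.add hq
  | mul_X p j hp =>
    have hmul : polyEval (p * MvPolynomial.X j) = fun y => polyEval p y * y j := by
      funext y; simp [polyEval]
    rw [hmul]
    refine (hp.mul (EuclideanSpace.proj (𝕜 := ℝ) j).hasFDerivAt).congr_fderiv ?_
    ext v
    simp [polyGrad_mul_X, EuclideanSpace.inner_single_left, add_comm]

theorem hasGradientAt_polyEval (p : MvPolynomial (Fin d) ℝ) (x : EuclideanSpace ℝ (Fin d)) :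
    HasGradientAt (polyEval p) (polyGrad p x) x :=
  hasGradientAt_iff_hasFDerivAt.2 (hasFDerivAt_polyEval p x)

theorem totalDegree_pderiv_le {ι R : Type*} [CommSemiring R] (p : MvPolynomial ι R) (i : ι) :
    (MvPolynomial.pderiv i p).totalDegree ≤ p.totalDegree := by
  refine Finset.sup_le fun m hm => ?_
  rw [MvPolynomial.mem_support_iff, MvPolynomial.coeff_pderiv] at hm
  refine le_trans ?_ (MvPolynomial.le_totalDegree
    (MvPolynomial.mem_support_iff.2 (left_ne_zero_of_mul hm)))
  rw [Finsupp.sum_add_index' (fun _ => rfl) (fun _ _ _ => rfl)]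
  exact Nat.le_add_right _ _

/-- The polynomial `z ↦ p (x₀ + h z)`, that is, `p` transported to the reference configuration. -/
def polyScale (x₀ : EuclideanSpace ℝ (Fin d)) (h : ℝ) (p : MvPolynomial (Fin d) ℝ) :
    MvPolynomial (Fin d) ℝ :=
  MvPolynomial.bind₁ (fun i => MvPolynomial.C (x₀ i) + MvPolynomial.C h * MvPolynomial.X i) p

theorem polyEval_polyScale (x₀ : EuclideanSpace ℝ (Fin d)) (h : ℝ) (p : MvPolynomial (Fin d) ℝ)
    (z : EuclideanSpace ℝ (Fin d)) : polyEval (polyScale x₀ h p) z = polyEval p (x₀ + h • z) := by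
  simp only [polyEval, polyScale, MvPolynomial.eval, MvPolynomial.eval₂Hom_bind₁]
  congr 2
  funext i
  simp

theorem polyGrad_polyScale (x₀ : EuclideanSpace ℝ (Fin d)) (h : ℝ) (p : MvPolynomial (Fin d) ℝ)
    (z : EuclideanSpace ℝ (Fin d)) :
    polyGrad (polyScale x₀ h p) z = h • polyGrad p (x₀ + h • z) := by
  have hchain := (hasFDerivAt_polyEval p (x₀ + h • z)).comp z
    (((hasFDerivAt_id z).const_smul h).const_add x₀)
  have hscale := hasFDerivAt_polyEval (polyScale x₀ h p) z
  rw [funext (polyEval_polyScale x₀ h p)] at hscale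
  refine ext_inner_right ℝ fun v => ?_
  simpa [real_inner_smul_left] using DFunLike.congr_fun (hscale.unique hchain) v

theorem totalDegree_polyScale_le (x₀ : EuclideanSpace ℝ (Fin d)) (h : ℝ)
    (p : MvPolynomial (Fin d) ℝ) : (polyScale x₀ h p).totalDegree ≤ p.totalDegree := by
  have hlinear (i : Fin d) : (MvPolynomial.C (x₀ i) + MvPolynomial.C h * MvPolynomial.X i :
      MvPolynomial (Fin d) ℝ).totalDegree ≤ 1 := by
    refine (MvPolynomial.totalDegree_add _ _).trans (max_le (by simp) ?_)
    exact (MvPolynomial.totalDegree_mul _ _).trans (by simp)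
  rw [polyScale, MvPolynomial.bind₁, MvPolynomial.aeval_def, MvPolynomial.eval₂_eq]
  refine MvPolynomial.totalDegree_finsetSum_le fun m hm => ?_
  refine (MvPolynomial.totalDegree_mul _ _).trans ?_
  rw [MvPolynomial.algebraMap_eq, MvPolynomial.totalDegree_C, zero_add]
  refine (MvPolynomial.totalDegree_finsetProd _ _).trans ?_
  refine le_trans (Finset.sum_le_sum fun i _ => ?_) (MvPolynomial.le_totalDegree hm)
  refine (MvPolynomial.totalDegree_pow _ _).trans ?_
  simpa using Nat.mul_le_mul_left (m i) (hlinear i)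

theorem polyScale_mem (x₀ : EuclideanSpace ℝ (Fin d)) (h : ℝ) {p : MvPolynomial (Fin d) ℝ}
    {r : ℕ} (hp : p.totalDegree ≤ r) :
    polyScale x₀ h p ∈ MvPolynomial.restrictTotalDegree (Fin d) ℝ r :=
  (MvPolynomial.mem_restrictTotalDegree _ _ _).2 ((totalDegree_polyScale_le x₀ h p).trans hp)

theorem integrableOn_of_isBounded {F : Type*} [NormedAddCommGroup F]
    {f : EuclideanSpace ℝ (Fin d) → F} {T : Set (EuclideanSpace ℝ (Fin d))} (hf : Continuous f)
    (hT : Bornology.IsBounded T) : IntegrableOn f T :=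
  (hf.continuousOn.integrableOn_compact hT.isCompact_closure).mono_set subset_closure

theorem eq_zero_of_polyEval_eq_zero_on_ball {σ : ℝ} (hσ : 0 < σ) {p : MvPolynomial (Fin d) ℝ}
    (h : ∀ x ∈ Metric.ball (0 : EuclideanSpace ℝ (Fin d)) σ, polyEval p x = 0) : p = 0 := by
  have hmem : WithLp.toLp 2 ⁻¹' Metric.ball (0 : EuclideanSpace ℝ (Fin d)) σ ∈
      𝓝 (0 : Fin d → ℝ) :=
    (PiLp.continuous_toLp 2 _).continuousAt.preimage_mem_nhds
      (by simpa using Metric.ball_mem_nhds (0 : EuclideanSpace ℝ (Fin d)) hσ)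
  obtain ⟨ε, hε, hball⟩ := Metric.mem_nhds_iff.1 hmem
  refine MvPolynomial.funext_set (fun _ => Metric.ball (0 : ℝ) ε)
    (fun _ => infinite_of_mem_nhds 0 (Metric.ball_mem_nhds 0 hε)) fun x hx => ?_
  rw [map_zero]
  refine h (WithLp.toLp 2 x) (hball ?_)
  rw [ball_pi _ hε]
  exact hx

theorem integrable_polyEval (p : MvPolynomial (Fin d) ℝ) (σ : ℝ) :
    Integrable (polyEval p) (volume.restrict (Metric.ball 0 σ)) :=
  integrableOn_of_isBounded (continuous_polyEval p) Metric.isBounded_ball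

/-- Polynomials of degree at most `r`, as elements of `L¹` of the ball of radius `σ`. -/
def polyToL1 (d : ℕ) (σ : ℝ) (r : ℕ) : MvPolynomial.restrictTotalDegree (Fin d) ℝ r →ₗ[ℝ]
    (EuclideanSpace ℝ (Fin d) →₁[volume.restrict (Metric.ball 0 σ)] ℝ) where
  toFun q := (integrable_polyEval q.1 σ).toL1 _
  map_add' p q := by
    rw [← Integrable.toL1_add]
    exact (Integrable.toL1_eq_toL1_iff _ _ _ _).2 (ae_of_all _ fun x => polyEval_add p.1 q.1 x)
  map_smul' c q := by
    rw [RingHom.id_apply, ← Integrable.toL1_smul]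
    exact (Integrable.toL1_eq_toL1_iff _ _ _ _).2 (ae_of_all _ fun x => polyEval_smul c q.1 x)

theorem norm_polyToL1 (σ : ℝ) {r : ℕ} (q : MvPolynomial.restrictTotalDegree (Fin d) ℝ r) :
    ‖polyToL1 d σ r q‖ = ∫ x in Metric.ball (0 : EuclideanSpace ℝ (Fin d)) σ, |polyEval q.1 x| :=
  L1.norm_of_fun_eq_integral_norm (integrable_polyEval q.1 σ)

theorem polyToL1_injective {σ : ℝ} (hσ : 0 < σ) (d r : ℕ) :
    Function.Injective (polyToL1 d σ r) := by
  rw [← LinearMap.ker_eq_bot, LinearMap.ker_eq_bot']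
  intro q hq
  have hae : polyEval q.1 =ᵐ[volume.restrict (Metric.ball 0 σ)] fun _ => 0 := by
    refine (integrable_polyEval q.1 σ).coeFn_toL1.symm.trans ?_
    rw [show (integrable_polyEval q.1 σ).toL1 _ = 0 from hq]
    exact Lp.coeFn_zero ℝ 1 _
  exact Subtype.ext (eq_zero_of_polyEval_eq_zero_on_ball hσ
    (Measure.eqOn_open_of_ae_eq hae Metric.isOpen_ball (continuous_polyEval q.1).continuousOn
      continuousOn_const))

theorem exists_norm_linearMap_le_integral {σ : ℝ} (hσ : 0 < σ) {r : ℕ} {F : Type*}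
    [NormedAddCommGroup F] [NormedSpace ℝ F]
    (Λ : MvPolynomial.restrictTotalDegree (Fin d) ℝ r →ₗ[ℝ] F) :
    ∃ C : ℝ, 0 < C ∧ ∀ q : MvPolynomial.restrictTotalDegree (Fin d) ℝ r,
      ‖Λ q‖ ≤ C * ∫ x in Metric.ball (0 : EuclideanSpace ℝ (Fin d)) σ, |polyEval q.1 x| := by
  let e := LinearEquiv.ofInjective (polyToL1 d σ r) (polyToL1_injective hσ d r)
  let M : LinearMap.range (polyToL1 d σ r) →L[ℝ] F :=
    LinearMap.toContinuousLinearMap (Λ ∘ₗ e.symm.toLinearMap)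
  refine ⟨‖M‖ + 1, by positivity, fun q => ?_⟩
  calc ‖Λ q‖ = ‖M (e q)‖ := by simp [M]
    _ ≤ ‖M‖ * ‖e q‖ := M.le_opNorm _
    _ ≤ (‖M‖ + 1) * ‖e q‖ := by gcongr; linarith
    _ = _ := by rw [← norm_polyToL1]; rfl

theorem integral_ball_comp_scale (x₀ : EuclideanSpace ℝ (Fin d)) {h : ℝ} (hh : 0 < h) (σ : ℝ)
    (f : EuclideanSpace ℝ (Fin d) → ℝ) :
    ∫ z in Metric.ball (0 : EuclideanSpace ℝ (Fin d)) σ, f (x₀ + h • z) =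
      (h ^ d)⁻¹ * ∫ x in Metric.ball x₀ (σ * h), f x := by
  rw [Measure.setIntegral_comp_smul_of_pos volume (fun z => f (x₀ + z)) _ hh,
    finrank_euclideanSpace_fin, smul_eq_mul, smul_ball hh.ne', smul_zero,
    Real.norm_of_nonneg hh.le, mul_comm h σ,
    ← (measurePreserving_add_left volume x₀).setIntegral_preimage_emb
      (measurableEmbedding_addLeft x₀) f, preimage_add_ball, sub_self]

/-- The bound which finite dimensionality gives on the unit ball, transported to a ball of
radius `h`. -/
theorem exists_norm_apply_polyScale_le {σ : ℝ} (hσ : 0 < σ) {r : ℕ} {F : Type*}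
    [NormedAddCommGroup F] [NormedSpace ℝ F]
    (Λ : MvPolynomial.restrictTotalDegree (Fin d) ℝ r →ₗ[ℝ]
      C(Metric.closedBall (0 : EuclideanSpace ℝ (Fin d)) 1, F)) :
    ∃ C : ℝ, 0 < C ∧ ∀ (x₀ : EuclideanSpace ℝ (Fin d)) (h : ℝ), 0 < h →
      ∀ (p : MvPolynomial (Fin d) ℝ) (hp : p.totalDegree ≤ r) (z : _),
        ‖Λ ⟨polyScale x₀ h p, polyScale_mem x₀ h hp⟩ z‖ ≤
          C * ((h ^ d)⁻¹ * ∫ y in Metric.ball x₀ (σ * h), |polyEval p y|) := by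
  obtain ⟨C, hC, hbound⟩ := exists_norm_linearMap_le_integral hσ Λ
  refine ⟨C, hC, fun x₀ h hh p hp z => ?_⟩
  refine (ContinuousMap.norm_coe_le_norm _ z).trans ((hbound _).trans_eq ?_)
  simp only [polyEval_polyScale, integral_ball_comp_scale x₀ hh σ (fun x => |polyEval p x|)]

/-- Restriction of polynomials of degree at most `r` to the closed unit ball. -/
def polyEvalLinear (d r : ℕ) : MvPolynomial.restrictTotalDegree (Fin d) ℝ r →ₗ[ℝ]
    C(Metric.closedBall (0 : EuclideanSpace ℝ (Fin d)) 1, ℝ) where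
  toFun q := ⟨fun x => polyEval q.1 x, (continuous_polyEval _).comp continuous_subtype_val⟩
  map_add' p q := by ext x; exact polyEval_add _ _ _
  map_smul' c q := by ext x; exact polyEval_smul _ _ _

/-- Gradients of polynomials of degree at most `r` on the closed unit ball. -/
def polyGradLinear (d r : ℕ) : MvPolynomial.restrictTotalDegree (Fin d) ℝ r →ₗ[ℝ]
    C(Metric.closedBall (0 : EuclideanSpace ℝ (Fin d)) 1, EuclideanSpace ℝ (Fin d)) where
  toFun q := ⟨fun x => polyGrad q.1 x, (continuous_polyGrad _).comp continuous_subtype_val⟩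
  map_add' p q := by ext1 x; exact polyGrad_add _ _ _
  map_smul' c q := by ext1 x; exact polyGrad_smul _ _ _

theorem exists_add_smul_eq_of_dist_le {x₀ x : EuclideanSpace ℝ (Fin d)} {h : ℝ} (hh : 0 < h)
    (hx : dist x x₀ ≤ h) :
    ∃ z : Metric.closedBall (0 : EuclideanSpace ℝ (Fin d)) 1, x₀ + h • (z : _) = x := by
  refine ⟨⟨h⁻¹ • (x - x₀), ?_⟩, ?_⟩
  · rwa [mem_closedBall_zero_iff, norm_smul, norm_inv, Real.norm_of_nonneg hh.le,
      inv_mul_le_iff₀ hh, mul_one, ← dist_eq_norm]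
  · simp [smul_smul, hh.ne']

theorem exists_abs_polyEval_le {σ : ℝ} (hσ : 0 < σ) (d r : ℕ) : ∃ C : ℝ, 0 < C ∧
    ∀ (x₀ : EuclideanSpace ℝ (Fin d)) (h : ℝ), 0 < h → ∀ p : MvPolynomial (Fin d) ℝ,
      p.totalDegree ≤ r → ∀ x, dist x x₀ ≤ h →
      |polyEval p x| ≤ C * ((h ^ d)⁻¹ * ∫ y in Metric.ball x₀ (σ * h), |polyEval p y|) := by
  obtain ⟨C, hC, hbound⟩ := exists_norm_apply_polyScale_le hσ (polyEvalLinear d r)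
  refine ⟨C, hC, fun x₀ h hh p hp x hx => ?_⟩
  obtain ⟨z, rfl⟩ := exists_add_smul_eq_of_dist_le hh hx
  simpa [polyEvalLinear, polyEval_polyScale] using hbound x₀ h hh p hp z

theorem exists_norm_polyGrad_le {σ : ℝ} (hσ : 0 < σ) (d r : ℕ) : ∃ C : ℝ, 0 < C ∧
    ∀ (x₀ : EuclideanSpace ℝ (Fin d)) (h : ℝ), 0 < h → ∀ p : MvPolynomial (Fin d) ℝ,
      p.totalDegree ≤ r → ∀ x, dist x x₀ ≤ h →
      h * ‖polyGrad p x‖ ≤ C * ((h ^ d)⁻¹ * ∫ y in Metric.ball x₀ (σ * h), |polyEval p y|) := by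
  obtain ⟨C, hC, hbound⟩ := exists_norm_apply_polyScale_le hσ (polyGradLinear d r)
  refine ⟨C, hC, fun x₀ h hh p hp x hx => ?_⟩
  obtain ⟨z, rfl⟩ := exists_add_smul_eq_of_dist_le hh hx
  simpa [polyGradLinear, polyGrad_polyScale, norm_smul, abs_of_pos hh] using hbound x₀ h hh p hp z

theorem norm_le_sum_abs {ι : Type*} [Fintype ι] (v : EuclideanSpace ℝ ι) : ‖v‖ ≤ ∑ i, |v i| := by
  classical
  calc ‖v‖ = ‖∑ i, EuclideanSpace.single i (v i)‖ := by
        congr 1; ext j; simp [Finset.sum_apply]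
    _ ≤ ∑ i, ‖EuclideanSpace.single i (v i)‖ := norm_sum_le _ _
    _ = ∑ i, |v i| := by simp

theorem exists_norm_polyGrad_le_integral_norm {σ : ℝ} (hσ : 0 < σ) (d r : ℕ) : ∃ C : ℝ, 0 < C ∧
    ∀ (x₀ : EuclideanSpace ℝ (Fin d)) (h : ℝ), 0 < h → ∀ p : MvPolynomial (Fin d) ℝ,
      p.totalDegree ≤ r → ∀ x, dist x x₀ ≤ h →
      ‖polyGrad p x‖ ≤ C * ((h ^ d)⁻¹ * ∫ y in Metric.ball x₀ (σ * h), ‖polyGrad p y‖) := by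
  obtain ⟨C, hC, hbound⟩ := exists_abs_polyEval_le hσ d r
  refine ⟨(d + 1) * C, by positivity, fun x₀ h hh p hp x hx => ?_⟩
  set I := (h ^ d)⁻¹ * ∫ y in Metric.ball x₀ (σ * h), ‖polyGrad p y‖
  have hI : 0 ≤ I := by positivity
  have hpartial (i : Fin d) : |polyGrad p x i| ≤ C * I := by
    refine (hbound x₀ h hh _ ((totalDegree_pderiv_le p i).trans hp) x hx).trans ?_
    refine mul_le_mul_of_nonneg_left (mul_le_mul_of_nonneg_left
      (integral_mono ?_ ?_ fun y => ?_) (by positivity)) hC.le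
    · exact (integrableOn_of_isBounded (continuous_polyEval _) Metric.isBounded_ball).abs
    · exact (integrableOn_of_isBounded (continuous_polyGrad _) Metric.isBounded_ball).norm
    · exact PiLp.norm_apply_le (polyGrad p _) i
  calc ‖polyGrad p x‖ ≤ ∑ i, |polyGrad p x i| := norm_le_sum_abs _
    _ ≤ ∑ _ : Fin d, C * I := Finset.sum_le_sum fun i _ => hpartial i
    _ = d * C * I := by simp [mul_assoc]
    _ ≤ (d + 1) * C * I := by linarith [mul_nonneg hC.le hI]

end Polynomial

/-! ### The Poincaré inequality on star-shaped sets -/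

section Segments

variable {α : Type*} [MeasurableSpace α] {μ : Measure α}

theorem sq_lintegral_le [IsProbabilityMeasure μ] {f : α → ENNReal} (hf : AEMeasurable f μ) :
    (∫⁻ x, f x ∂μ) ^ 2 ≤ ∫⁻ x, f x ^ 2 ∂μ := by
  have holder := ENNReal.lintegral_mul_le_Lp_mul_Lq μ Real.HolderConjugate.two_two hf
    (aemeasurable_const (b := (1 : ENNReal)))
  simp only [Pi.mul_apply, mul_one, lintegral_const, measure_univ, ENNReal.rpow_two, one_pow,
    ENNReal.one_rpow] at holder
  calc (∫⁻ x, f x ∂μ) ^ 2 ≤ ((∫⁻ x, f x ^ 2 ∂μ) ^ (1 / 2 : ℝ)) ^ 2 := by gcongr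
    _ = _ := by rw [← ENNReal.rpow_natCast, ← ENNReal.rpow_mul]; norm_num

theorem sq_lintegral_mul_le {k f : α → ENNReal} (hk : Measurable k) (hk1 : ∫⁻ x, k x ∂μ = 1)
    (hf : AEMeasurable f μ) : (∫⁻ x, k x * f x ∂μ) ^ 2 ≤ ∫⁻ x, k x * f x ^ 2 ∂μ := by
  have : IsProbabilityMeasure (μ.withDensity k) := ⟨by
    rw [withDensity_apply _ MeasurableSet.univ, Measure.restrict_univ, hk1]⟩
  have jensen := sq_lintegral_le (hf.mono_ac (withDensity_absolutelyContinuous μ k))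
  rw [lintegral_withDensity_eq_lintegral_mul₀ hk.aemeasurable hf,
    lintegral_withDensity_eq_lintegral_mul₀ hk.aemeasurable (hf.pow_const 2)] at jensen
  simpa only [Pi.mul_apply] using jensen

variable {E : Type*} [NormedAddCommGroup E] [NormedSpace ℝ E]

theorem enorm_sub_sq_le_lintegral {v : E → ℝ} (hv : ContDiff ℝ 1 v) (x y : E) :
    ‖v x - v y‖ₑ ^ 2 ≤ ∫⁻ t in Icc (0 : ℝ) 1, ‖fderiv ℝ v (y + t • (x - y)) (x - y)‖ₑ ^ 2 := by
  have hcont : Continuous fun t : ℝ => fderiv ℝ v (y + t • (x - y)) (x - y) := by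
    have := hv.continuous_fderiv one_ne_zero
    fun_prop
  have hderiv (t : ℝ) : HasDerivAt (fun t : ℝ => v (y + t • (x - y)))
      (fderiv ℝ v (y + t • (x - y)) (x - y)) t := by
    have hline : HasDerivAt (fun t : ℝ => y + t • (x - y)) (x - y) t := by
      simpa using ((hasDerivAt_id t).smul_const (x - y)).const_add y
    exact (hv.differentiable one_ne_zero _).hasFDerivAt.comp_hasDerivAt t hline
  have ftc := intervalIntegral.integral_eq_sub_of_hasDerivAt (fun t _ => hderiv t)
    (hcont.intervalIntegrable 0 1)
  simp only [one_smul, zero_smul, add_zero, add_sub_cancel] at ftc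
  rw [← ftc, intervalIntegral.integral_of_le zero_le_one, ← integral_Icc_eq_integral_Ioc]
  have : IsProbabilityMeasure (volume.restrict (Icc (0 : ℝ) 1)) := ⟨by simp⟩
  calc ‖∫ t in Icc (0 : ℝ) 1, fderiv ℝ v (y + t • (x - y)) (x - y)‖ₑ ^ 2
      ≤ (∫⁻ t in Icc (0 : ℝ) 1, ‖fderiv ℝ v (y + t • (x - y)) (x - y)‖ₑ) ^ 2 := by
        gcongr; exact enorm_integral_le_lintegral_enorm _
    _ ≤ _ := sq_lintegral_le hcont.measurable.enorm.aemeasurable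

/-- The pairs of points whose connecting segment stays at distance at least `δ` from the
complement of `T`. -/
def deepPairs (T : Set E) (δ : ℝ) : Set (E × E) :=
  {p | ∀ t ∈ Icc (0 : ℝ) 1, Metric.ball (p.2 + t • (p.1 - p.2)) δ ⊆ T}

theorem isClosed_deepPairs (T : Set E) (δ : ℝ) : IsClosed (deepPairs T δ) := by
  have hset : deepPairs T δ = ⋂ t ∈ Icc (0 : ℝ) 1, ⋂ w ∈ Tᶜ,
      {p : E × E | δ ≤ dist (p.2 + t • (p.1 - p.2)) w} := by
    ext p
    simp only [deepPairs, mem_ofPred_eq, mem_iInter, subset_def, Metric.mem_ball, dist_comm]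
    grind
  rw [hset]
  exact isClosed_biInter fun t _ => isClosed_biInter fun w _ =>
    isClosed_le continuous_const (by fun_prop)

theorem exists_mem_deepPairs {T : Set E} (hT : IsOpen T) {p : E × E}
    (hstar : StarConvex ℝ p.2 T) (hp : p.1 ∈ T) : ∃ δ > 0, ∀ ε ≤ δ, p ∈ deepPairs T ε := by
  have hcompact : IsCompact ((fun t : ℝ => p.2 + t • (p.1 - p.2)) '' Icc 0 1) :=
    isCompact_Icc.image (by fun_prop)
  have hsub : (fun t : ℝ => p.2 + t • (p.1 - p.2)) '' Icc 0 1 ⊆ T := by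
    rintro _ ⟨t, ht, rfl⟩
    convert hstar hp (sub_nonneg.2 ht.2) ht.1 (sub_add_cancel 1 t) using 1
    module
  obtain ⟨δ, hδ, hδT⟩ := hcompact.exists_thickening_subset_open hT hsub
  refine ⟨δ, hδ, fun ε hε t ht => ?_⟩
  exact (Metric.ball_subset_ball hε).trans
    ((Metric.ball_subset_thickening (mem_image_of_mem _ ht) δ).trans hδT)

variable [FiniteDimensional ℝ E] [MeasurableSpace E] [BorelSpace E] {ν : Measure E}
  [ν.IsAddHaarMeasure]

theorem lintegral_comp_smul_add {R : ℝ} (hR : 0 < R) (c : E) {M : E → ENNReal}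
    (hM : Measurable M) :
    ∫⁻ x, M (R • x + c) ∂ν = ENNReal.ofReal ((R ^ Module.finrank ℝ E)⁻¹) * ∫⁻ x, M x ∂ν := by
  have hmap : ∫⁻ x, M (R • x + c) ∂ν = ∫⁻ x, M (x + c) ∂(Measure.map (R • ·) ν) := by
    rw [lintegral_map (by fun_prop) (by fun_prop)]
  rw [hmap, Measure.map_addHaar_smul _ hR.ne', lintegral_smul_measure,
    lintegral_add_right_eq_self M c, abs_of_pos (by positivity), smul_eq_mul]

theorem lintegral_comp_smul_add_le {R : ℝ} (hR : 1 / 2 ≤ R) (c : E) {M : E → ENNReal}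
    (hM : Measurable M) :
    ∫⁻ x, M (R • x + c) ∂ν ≤ 2 ^ Module.finrank ℝ E * ∫⁻ x, M x ∂ν := by
  have hR0 : 0 < R := by linarith
  rw [lintegral_comp_smul_add hR0 c hM]
  gcongr
  calc ENNReal.ofReal ((R ^ Module.finrank ℝ E)⁻¹)
      ≤ ENNReal.ofReal (2 ^ Module.finrank ℝ E) := by
        refine ENNReal.ofReal_le_ofReal ?_
        rw [← inv_pow]
        gcongr
        rw [inv_le_comm₀ hR0 (by norm_num)]
        linarith
    _ = 2 ^ Module.finrank ℝ E := by rw [ENNReal.ofReal_pow (by norm_num)]; norm_num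

/- One of the weights `t`, `1 - t` is at least `1 / 2`; the integral over the corresponding endpoint
is then a change of variables with bounded Jacobian. -/
theorem lintegral_segment_le {M : E → ENNReal} (hM : Measurable M) {T B : Set E}
    (hBT : ν B ≤ ν T) (t : ℝ) :
    ∫⁻ x in T, ∫⁻ y in B, M (y + t • (x - y)) ∂ν ∂ν ≤
      2 ^ Module.finrank ℝ E * ν T * ∫⁻ z, M z ∂ν := by
  rcases le_total t (1 / 2) with ht | ht
  · have inner_le (x : E) : ∫⁻ y in B, M (y + t • (x - y)) ∂ν ≤
        2 ^ Module.finrank ℝ E * ∫⁻ z, M z ∂ν := by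
      have hpoint (y : E) : y + t • (x - y) = (1 - t) • y + t • x := by module
      simp only [hpoint]
      exact (setLIntegral_le_lintegral _ _).trans
        (lintegral_comp_smul_add_le (by linarith) _ hM)
    calc ∫⁻ x in T, ∫⁻ y in B, M (y + t • (x - y)) ∂ν ∂ν
        ≤ ∫⁻ _ in T, 2 ^ Module.finrank ℝ E * ∫⁻ z, M z ∂ν ∂ν := lintegral_mono inner_le
      _ = _ := by rw [setLIntegral_const]; ring
  · have inner_le (y : E) : ∫⁻ x in T, M (y + t • (x - y)) ∂ν ≤
        2 ^ Module.finrank ℝ E * ∫⁻ z, M z ∂ν := by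
      have hpoint (x : E) : y + t • (x - y) = t • x + (1 - t) • y := by module
      simp only [hpoint]
      exact (setLIntegral_le_lintegral _ _).trans (lintegral_comp_smul_add_le ht _ hM)
    rw [lintegral_lintegral_swap (by
      apply Measurable.aemeasurable
      simp only [Function.uncurry_def]
      fun_prop)]
    calc ∫⁻ y in B, ∫⁻ x in T, M (y + t • (x - y)) ∂ν ∂ν
        ≤ ∫⁻ _ in B, 2 ^ Module.finrank ℝ E * ∫⁻ z, M z ∂ν ∂ν := lintegral_mono inner_le
      _ = 2 ^ Module.finrank ℝ E * (∫⁻ z, M z ∂ν) * ν B := by rw [setLIntegral_const]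
      _ ≤ 2 ^ Module.finrank ℝ E * (∫⁻ z, M z ∂ν) * ν T := by gcongr
      _ = _ := by ring

end Segments

section Mollify

variable {d : ℕ} {T : Set (EuclideanSpace ℝ (Fin d))} {u : EuclideanSpace ℝ (Fin d) → ℝ}
  {G : EuclideanSpace ℝ (Fin d) → EuclideanSpace ℝ (Fin d)}

theorem gradient_inner (η : EuclideanSpace ℝ (Fin d) → ℝ) (x e : EuclideanSpace ℝ (Fin d)) :
    inner ℝ (gradient η x) e = fderiv ℝ η x e := by
  rw [gradient, InnerProductSpace.toDual_symm_apply]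

theorem HasWeakGradient.mono {Ω : Set (EuclideanSpace ℝ (Fin d))} (h : HasWeakGradient Ω u G)
    (hΩ : NullMeasurableSet Ω) (hT : T ⊆ Ω) : HasWeakGradient T u G := by
  intro η hη hc hs i
  have hη_zero : ∀ x, x ∉ T → η x = 0 := fun x hx =>
    image_eq_zero_of_notMem_tsupport fun h => hx (hs h)
  have hgrad_zero : ∀ x, x ∉ T → gradient η x = 0 := fun x hx => by
    have hfderiv : fderiv ℝ η x = 0 := by
      by_contra hne
      exact hx (hs (support_fderiv_subset ℝ hne))
    rw [gradient, hfderiv, map_zero]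
  have hΩη := h η hη hc (hs.trans hT) i
  rwa [setIntegral_eq_of_subset_of_ae_sdiff_eq_zero hΩ hT
      (f := fun x => u x * gradient η x i)
      (ae_of_all _ fun x hx => by simp [hgrad_zero x hx.2]),
    setIntegral_eq_of_subset_of_ae_sdiff_eq_zero hΩ hT
      (f := fun x => G x i * η x) (ae_of_all _ fun x hx => by simp [hη_zero x hx.2])] at hΩη

theorem HasWeakGradient.integral_fderiv (h : HasWeakGradient T u G) (hu : IntegrableOn u T)
    (hG : IntegrableOn G T) {η : EuclideanSpace ℝ (Fin d) → ℝ} (hη : ContDiff ℝ ∞ η)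
    (hc : HasCompactSupport η) (hs : tsupport η ⊆ T) (e : EuclideanSpace ℝ (Fin d)) :
    ∫ x in T, u x * fderiv ℝ η x e = - ∫ x in T, inner ℝ (G x) e * η x := by
  have integrable_mul {f w : EuclideanSpace ℝ (Fin d) → ℝ} (hf : Continuous f)
      (hfc : HasCompactSupport f) (hw : IntegrableOn w T) :
      IntegrableOn (fun x => w x * f x) T := by
    obtain ⟨C, hC⟩ := hfc.exists_bound_of_continuous hf
    exact hw.mul_bdd hf.aestronglyMeasurable (ae_of_all _ hC)
  have hη' : Continuous (fderiv ℝ η) := hη.continuous_fderiv (by simp)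
  have gradient_apply (x) (i : Fin d) :
      gradient η x i = fderiv ℝ η x (EuclideanSpace.single i 1) := by
    rw [← gradient_inner, EuclideanSpace.inner_single_right]
    simp
  have hGi (i : Fin d) : IntegrableOn (fun x => G x i) T :=
    (EuclideanSpace.proj i : EuclideanSpace ℝ (Fin d) →L[ℝ] ℝ).integrable_comp hG
  have sum_left (x) : u x * fderiv ℝ η x e = ∑ i, e i * (u x * gradient η x i) := by
    rw [← gradient_inner, PiLp.inner_apply, Finset.mul_sum]
    refine Finset.sum_congr rfl fun i _ => ?_
    simp; ring
  have sum_right (x) : inner ℝ (G x) e * η x = ∑ i, e i * (G x i * η x) := by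
    rw [PiLp.inner_apply, Finset.sum_mul]
    refine Finset.sum_congr rfl fun i _ => ?_
    simp; ring
  simp_rw [sum_left, sum_right]
  rw [integral_finsetSum, integral_finsetSum, ← Finset.sum_neg_distrib]
  · refine Finset.sum_congr rfl fun i _ => ?_
    rw [integral_const_mul, integral_const_mul, h η hη hc hs i]
    ring
  · exact fun i _ => (integrable_mul hη.continuous hc (hGi i)).const_mul _
  · intro i _
    refine Integrable.const_mul ?_ _
    simp_rw [gradient_apply]
    exact integrable_mul (by fun_prop) (hc.fderiv_apply ℝ _) hu

variable (b : ContDiffBump (0 : EuclideanSpace ℝ (Fin d)))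

/-- The convolution of a smooth bump function with the extension by zero of `u` from `T`. -/
def mollify (T : Set (EuclideanSpace ℝ (Fin d))) (u : EuclideanSpace ℝ (Fin d) → ℝ) :
    EuclideanSpace ℝ (Fin d) → ℝ :=
  convolution (b.normed volume) (T.indicator u) (ContinuousLinearMap.lsmul ℝ ℝ) volume

theorem contDiff_mollify (hT : MeasurableSet T) (hu : IntegrableOn u T) :
    ContDiff ℝ 1 (mollify b T u) :=
  HasCompactSupport.contDiff_convolution_left (n := 1) _ b.hasCompactSupport_normed
    b.contDiff_normed (hu.integrable_indicator hT).locallyIntegrable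

theorem fderiv_mollify_eq_integral (hT : MeasurableSet T) (hu : IntegrableOn u T)
    (z e : EuclideanSpace ℝ (Fin d)) :
    fderiv ℝ (mollify b T u) z e =
      ∫ w in T, u w * fderiv ℝ (b.normed volume) (z - w) e := by
  have hbump : HasCompactSupport (b.normed volume) := b.hasCompactSupport_normed
  have hsmooth : ContDiff ℝ 1 (b.normed volume) := b.contDiff_normed
  have hloc : LocallyIntegrable (T.indicator u) :=
    (hu.integrable_indicator hT).locallyIntegrable
  have hexists : ConvolutionExists (fderiv ℝ (b.normed volume)) (T.indicator u)
      ((ContinuousLinearMap.lsmul ℝ ℝ).precompL (EuclideanSpace ℝ (Fin d))) volume :=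
    (hbump.fderiv ℝ).convolutionExists_left _ (hsmooth.continuous_fderiv one_ne_zero) hloc
  unfold mollify
  rw [(hbump.hasFDerivAt_convolution_left (ContinuousLinearMap.lsmul ℝ ℝ) hsmooth hloc z).fderiv,
    convolution_eq_swap, ContinuousLinearMap.integral_apply (hexists z).integrable_swap,
    ← integral_indicator hT]
  refine integral_congr_ae (ae_of_all _ fun w => ?_)
  by_cases hw : w ∈ T
  · simp [hw, mul_comm]
  · simp [hw]

theorem fderiv_comp_const_sub {k : EuclideanSpace ℝ (Fin d) → ℝ} (hk : Differentiable ℝ k)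
    (z w e : EuclideanSpace ℝ (Fin d)) :
    fderiv ℝ (fun w => k (z - w)) w e = - fderiv ℝ k (z - w) e := by
  have hcomp := (hk (z - w)).hasFDerivAt.comp w ((hasFDerivAt_id w).const_sub z)
  have heq : fderiv ℝ (fun w => k (z - w)) w = _ := hcomp.fderiv
  simp [heq]

theorem tsupport_normed_sub_subset (z : EuclideanSpace ℝ (Fin d)) :
    tsupport (fun w => b.normed volume (z - w)) ⊆ Metric.closedBall z b.rOut := by
  refine closure_minimal (fun w hw => ?_) Metric.isClosed_closedBall
  have hmem : z - w ∈ Function.support (b.normed volume) := hw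
  rw [b.support_normed_eq, mem_ball_zero_iff] at hmem
  rw [mem_closedBall_iff_norm, norm_sub_rev]
  exact hmem.le

variable {b}

theorem fderiv_mollify (hT : MeasurableSet T) (hu : IntegrableOn u T) (hG : IntegrableOn G T)
    (h : HasWeakGradient T u G) {z : EuclideanSpace ℝ (Fin d)}
    (hz : Metric.closedBall z b.rOut ⊆ T) (e : EuclideanSpace ℝ (Fin d)) :
    fderiv ℝ (mollify b T u) z e = ∫ w in T, inner ℝ (G w) e * b.normed volume (z - w) := by
  have hsmooth : ContDiff ℝ ∞ (b.normed volume) := b.contDiff_normed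
  have by_parts := h.integral_fderiv hu hG (η := fun w => b.normed volume (z - w))
    (hsmooth.comp (contDiff_const.sub contDiff_id))
    (b.hasCompactSupport_normed.comp_homeomorph (Homeomorph.subLeft z))
    ((tsupport_normed_sub_subset b z).trans hz) e
  simp_rw [fderiv_comp_const_sub (hsmooth.differentiable (by simp)), mul_neg, integral_neg,
    neg_inj] at by_parts
  rw [fderiv_mollify_eq_integral b hT hu, by_parts]

variable (b) in
/-- The mollification of a `[0, ∞]`-valued function. -/
def lmollify (g : EuclideanSpace ℝ (Fin d) → ENNReal) (z : EuclideanSpace ℝ (Fin d)) : ENNReal :=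
  ∫⁻ w, ENNReal.ofReal (b.normed volume (z - w)) * g w

theorem lintegral_ofReal_normed : ∫⁻ w, ENNReal.ofReal (b.normed volume w) = 1 := by
  rw [← ofReal_integral_eq_lintegral_ofReal b.integrable_normed (ae_of_all _ b.nonneg_normed),
    b.integral_normed, ENNReal.ofReal_one]

variable {g : EuclideanSpace ℝ (Fin d) → ENNReal}

theorem lmollify_congr {g' : EuclideanSpace ℝ (Fin d) → ENNReal} (h : g =ᵐ[volume] g') :
    lmollify b g = lmollify b g' :=
  funext fun z => lintegral_congr_ae (h.mono fun w hw => by simp only [hw])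

theorem measurable_lmollify (hg : AEMeasurable g) : Measurable (lmollify b g) := by
  have hbump : Measurable (b.normed volume) := b.continuous_normed.measurable
  have := hg.measurable_mk
  rw [lmollify_congr hg.ae_eq_mk]
  refine Measurable.lintegral_prod_right' (f := fun p : EuclideanSpace ℝ (Fin d) ×
    EuclideanSpace ℝ (Fin d) => ENNReal.ofReal (b.normed volume (p.1 - p.2)) * hg.mk g p.2) ?_
  fun_prop

theorem lintegral_lmollify (hg : AEMeasurable g) : ∫⁻ z, lmollify b g z = ∫⁻ w, g w := by
  have hbump : Measurable (b.normed volume) := b.continuous_normed.measurable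
  have := hg.measurable_mk
  rw [lmollify_congr hg.ae_eq_mk, lintegral_congr_ae hg.ae_eq_mk]
  unfold lmollify
  rw [lintegral_lintegral_swap (by
    apply Measurable.aemeasurable
    simp only [Function.uncurry_def]
    fun_prop)]
  refine lintegral_congr fun w => ?_
  rw [lintegral_mul_const _ (by fun_prop),
    lintegral_sub_right_eq_self (fun z => ENNReal.ofReal (b.normed volume z)) w,
    lintegral_ofReal_normed, one_mul]

theorem enorm_fderiv_mollify_le (hT : MeasurableSet T) (hu : IntegrableOn u T)
    (hG : IntegrableOn G T) (h : HasWeakGradient T u G) {z : EuclideanSpace ℝ (Fin d)}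
    (hz : Metric.closedBall z b.rOut ⊆ T) (e : EuclideanSpace ℝ (Fin d)) :
    ‖fderiv ℝ (mollify b T u) z e‖ₑ ≤ ‖e‖ₑ * lmollify b (T.indicator fun w => ‖G w‖ₑ) z := by
  have inner_le (v : EuclideanSpace ℝ (Fin d)) : ‖inner ℝ v e‖ₑ ≤ ‖v‖ₑ * ‖e‖ₑ := by
    rw [← ofReal_norm, ← ofReal_norm, ← ofReal_norm, ← ENNReal.ofReal_mul (norm_nonneg _)]
    exact ENNReal.ofReal_le_ofReal (norm_inner_le_norm _ _)
  rw [fderiv_mollify hT hu hG h hz e, lmollify, ← lintegral_const_mul' _ _ enorm_ne_top]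
  calc ‖∫ w in T, inner ℝ (G w) e * b.normed volume (z - w)‖ₑ
      ≤ ∫⁻ w in T, ‖inner ℝ (G w) e * b.normed volume (z - w)‖ₑ :=
        enorm_integral_le_lintegral_enorm _
    _ ≤ ∫⁻ w in T, ‖e‖ₑ * (ENNReal.ofReal (b.normed volume (z - w)) * ‖G w‖ₑ) := by
        refine lintegral_mono fun w => ?_
        rw [enorm_mul, Real.enorm_of_nonneg (b.nonneg_normed _)]
        calc _ ≤ ‖G w‖ₑ * ‖e‖ₑ * ENNReal.ofReal (b.normed volume (z - w)) := by
              gcongr; exact inner_le _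
          _ = _ := by ring
    _ = _ := by
        rw [← lintegral_indicator hT]
        refine lintegral_congr fun w => ?_
        by_cases hw : w ∈ T <;> simp [hw]

theorem enorm_fderiv_mollify_sq_le (hT : MeasurableSet T) (hu : IntegrableOn u T)
    (hG : IntegrableOn G T) (h : HasWeakGradient T u G) {z : EuclideanSpace ℝ (Fin d)}
    (hz : Metric.closedBall z b.rOut ⊆ T) (e : EuclideanSpace ℝ (Fin d)) :
    ‖fderiv ℝ (mollify b T u) z e‖ₑ ^ 2 ≤
      ‖e‖ₑ ^ 2 * lmollify b (T.indicator fun w => ‖G w‖ₑ ^ 2) z := by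
  have hbump : Measurable (b.normed volume) := b.continuous_normed.measurable
  have hsq : (T.indicator fun w => ‖G w‖ₑ ^ 2) = fun w => (T.indicator fun w => ‖G w‖ₑ) w ^ 2 := by
    ext w
    by_cases hw : w ∈ T <;> simp [hw]
  calc ‖fderiv ℝ (mollify b T u) z e‖ₑ ^ 2
      ≤ (‖e‖ₑ * lmollify b (T.indicator fun w => ‖G w‖ₑ) z) ^ 2 := by
        gcongr; exact enorm_fderiv_mollify_le hT hu hG h hz e
    _ ≤ _ := by
        rw [mul_pow, hsq]
        gcongr
        refine sq_lintegral_mul_le (by fun_prop) ?_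
          ((aemeasurable_indicator_iff hT).2 hG.aestronglyMeasurable.enorm)
        rw [lintegral_sub_left_eq_self (fun w => ENNReal.ofReal (b.normed volume w)) z,
          lintegral_ofReal_normed]

theorem exists_mollify_ae_tendsto (hT : MeasurableSet T) (hu : IntegrableOn u T) :
    ∃ b : ℕ → ContDiffBump (0 : EuclideanSpace ℝ (Fin d)),
      Tendsto (fun n => (b n).rOut) atTop (𝓝 0) ∧
      ∀ᵐ x, Tendsto (fun n => mollify (b n) T u x) atTop (𝓝 (T.indicator u x)) := by
  have hpos (n : ℕ) : (0 : ℝ) < 1 / ((n : ℝ) + 1) := Nat.one_div_pos_of_nat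
  have hlim : Tendsto (fun n : ℕ => 1 / ((n : ℝ) + 1)) atTop (𝓝 0) :=
    tendsto_one_div_add_atTop_nhds_zero_nat
  refine ⟨fun n => ⟨1 / ((n : ℝ) + 1) / 2, 1 / ((n : ℝ) + 1), half_pos (hpos n),
    half_lt_self (hpos n)⟩, hlim, ?_⟩
  refine ContDiffBump.ae_convolution_tendsto_right_of_locallyIntegrable (K := 2) hlim
    (Eventually.of_forall fun n => ?_) (hu.integrable_indicator hT).locallyIntegrable
  exact (mul_div_cancel₀ _ two_ne_zero).ge

end Mollify

section PoincareStar

variable {d : ℕ} {T B : Set (EuclideanSpace ℝ (Fin d))} {u : EuclideanSpace ℝ (Fin d) → ℝ}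
  {G : EuclideanSpace ℝ (Fin d) → EuclideanSpace ℝ (Fin d)} {h : ℝ}

theorem enorm_mollify_sub_sq_le (hT : MeasurableSet T) (hu : IntegrableOn u T)
    (hG : IntegrableOn G T) (hw : HasWeakGradient T u G)
    {b : ContDiffBump (0 : EuclideanSpace ℝ (Fin d))} {x y : EuclideanSpace ℝ (Fin d)}
    (hxy : ‖x - y‖ ≤ h) (hdeep : (x, y) ∈ deepPairs T (2 * b.rOut)) :
    ‖mollify b T u x - mollify b T u y‖ₑ ^ 2 ≤ ∫⁻ t in Icc (0 : ℝ) 1,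
      ENNReal.ofReal h ^ 2 * lmollify b (T.indicator fun w => ‖G w‖ₑ ^ 2) (y + t • (x - y)) := by
  refine (enorm_sub_sq_le_lintegral (contDiff_mollify b hT hu) x y).trans
    (setLIntegral_mono' measurableSet_Icc fun t ht => ?_)
  have hball : Metric.closedBall (y + t • (x - y)) b.rOut ⊆ T :=
    (Metric.closedBall_subset_ball (by linarith [b.rOut_pos])).trans (hdeep t ht)
  refine (enorm_fderiv_mollify_sq_le hT hu hG hw hball _).trans ?_
  have hnorm : ‖x - y‖ₑ ≤ ENNReal.ofReal h := by
    rw [← ofReal_norm]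
    exact ENNReal.ofReal_le_ofReal hxy
  gcongr

theorem lintegral_deepPairs_mollify_le (hT : MeasurableSet T) (hB : MeasurableSet B)
    (hBT : B ⊆ T) (hdiam : ∀ x ∈ T, ∀ y ∈ B, ‖x - y‖ ≤ h) (hu : IntegrableOn u T)
    (hG : IntegrableOn G T) (hw : HasWeakGradient T u G)
    (b : ContDiffBump (0 : EuclideanSpace ℝ (Fin d))) :
    ∫⁻ p in deepPairs T (2 * b.rOut), ‖mollify b T u p.1 - mollify b T u p.2‖ₑ ^ 2
        ∂((volume.restrict T).prod (volume.restrict B)) ≤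
      ENNReal.ofReal h ^ 2 * (2 ^ d * volume T * ∫⁻ x in T, ‖G x‖ₑ ^ 2) := by
  have hGm : AEMeasurable (T.indicator fun w => ‖G w‖ₑ ^ 2) :=
    (aemeasurable_indicator_iff hT).2 (hG.aestronglyMeasurable.enorm.pow_const 2)
  set M := lmollify b (T.indicator fun w => ‖G w‖ₑ ^ 2)
  have hM : Measurable M := measurable_lmollify hGm
  set μ := (volume.restrict T).prod (volume.restrict B) with hμ
  have hmem : ∀ᵐ p ∂μ, p.1 ∈ T ∧ p.2 ∈ B :=
    (Measure.quasiMeasurePreserving_fst.ae (ae_restrict_mem hT)).and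
      (Measure.quasiMeasurePreserving_snd.ae (ae_restrict_mem hB))
  have increment_le : ∀ᵐ p ∂(μ.restrict (deepPairs T (2 * b.rOut))),
      ‖mollify b T u p.1 - mollify b T u p.2‖ₑ ^ 2 ≤
        ∫⁻ t in Icc (0 : ℝ) 1, ENNReal.ofReal h ^ 2 * M (p.2 + t • (p.1 - p.2)) := by
    filter_upwards [ae_restrict_of_ae hmem,
      ae_restrict_mem (isClosed_deepPairs T (2 * b.rOut)).measurableSet] with p hp hdeep
    exact enorm_mollify_sub_sq_le hT hu hG hw (hdiam _ hp.1 _ hp.2) hdeep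
  have segment_le (t : ℝ) : ∫⁻ p, ENNReal.ofReal h ^ 2 * M (p.2 + t • (p.1 - p.2)) ∂μ ≤
      ENNReal.ofReal h ^ 2 * (2 ^ d * volume T * ∫⁻ x in T, ‖G x‖ₑ ^ 2) := by
    have hMt : Measurable fun p : EuclideanSpace ℝ (Fin d) × EuclideanSpace ℝ (Fin d) =>
        M (p.2 + t • (p.1 - p.2)) := by fun_prop
    rw [lintegral_const_mul _ hMt, hμ, lintegral_prod _ hMt.aemeasurable,
      ← lintegral_indicator hT (fun x => ‖G x‖ₑ ^ 2), ← lintegral_lmollify (b := b) hGm]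
    gcongr
    simpa using lintegral_segment_le hM (measure_mono hBT) t
  calc _ ≤ ∫⁻ p in deepPairs T (2 * b.rOut), (∫⁻ t in Icc (0 : ℝ) 1,
          ENNReal.ofReal h ^ 2 * M (p.2 + t • (p.1 - p.2))) ∂μ := lintegral_mono_ae increment_le
    _ ≤ ∫⁻ p, (∫⁻ t in Icc (0 : ℝ) 1, ENNReal.ofReal h ^ 2 * M (p.2 + t • (p.1 - p.2))) ∂μ :=
        setLIntegral_le_lintegral _ _
    _ = ∫⁻ t in Icc (0 : ℝ) 1, ∫⁻ p, ENNReal.ofReal h ^ 2 * M (p.2 + t • (p.1 - p.2)) ∂μ :=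
        lintegral_lintegral_swap (Measurable.aemeasurable (by fun_prop))
    _ ≤ ∫⁻ _ in Icc (0 : ℝ) 1, ENNReal.ofReal h ^ 2 *
          (2 ^ d * volume T * ∫⁻ x in T, ‖G x‖ₑ ^ 2) := lintegral_mono segment_le
    _ = _ := by simp

theorem lintegral_prod_sub_sq_le (hT : IsOpen T) (hB : MeasurableSet B) (hBT : B ⊆ T)
    (hstar : ∀ y ∈ B, StarConvex ℝ y T) (hdiam : ∀ x ∈ T, ∀ y ∈ B, ‖x - y‖ ≤ h)
    (hu : IntegrableOn u T) (hG : IntegrableOn G T) (hw : HasWeakGradient T u G) :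
    ∫⁻ p, ‖u p.1 - u p.2‖ₑ ^ 2 ∂((volume.restrict T).prod (volume.restrict B)) ≤
      ENNReal.ofReal h ^ 2 * (2 ^ d * volume T * ∫⁻ x in T, ‖G x‖ₑ ^ 2) := by
  have hTm := hT.measurableSet
  obtain ⟨b, hb, hlim⟩ := exists_mollify_ae_tendsto hTm hu
  set μ := (volume.restrict T).prod (volume.restrict B)
  set F : ℕ → EuclideanSpace ℝ (Fin d) × EuclideanSpace ℝ (Fin d) → ENNReal := fun n =>
    (deepPairs T (2 * (b n).rOut)).indicator fun p =>
      ‖mollify (b n) T u p.1 - mollify (b n) T u p.2‖ₑ ^ 2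
  have hdeep (n : ℕ) : MeasurableSet (deepPairs T (2 * (b n).rOut)) :=
    (isClosed_deepPairs T _).measurableSet
  have hF (n : ℕ) : Measurable (F n) := by
    have := (contDiff_mollify (b n) hTm hu).continuous
    exact (Continuous.measurable (by fun_prop)).indicator (hdeep n)
  have tendsto_F : ∀ᵐ p ∂μ, Tendsto (fun n => F n p) atTop (𝓝 (‖u p.1 - u p.2‖ₑ ^ 2)) := by
    filter_upwards [Measure.quasiMeasurePreserving_fst.ae (ae_restrict_mem hTm),
      Measure.quasiMeasurePreserving_snd.ae (ae_restrict_mem hB),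
      Measure.quasiMeasurePreserving_fst.ae (ae_restrict_of_ae hlim),
      Measure.quasiMeasurePreserving_snd.ae (ae_restrict_of_ae hlim)] with p hpT hpB hlim₁ hlim₂
    rw [indicator_of_mem hpT] at hlim₁
    rw [indicator_of_mem (hBT hpB)] at hlim₂
    obtain ⟨δ, hδ, hpδ⟩ := exists_mem_deepPairs hT (hstar p.2 hpB) hpT
    refine (((ENNReal.continuous_pow 2).tendsto _).comp
      ((continuous_enorm.tendsto _).comp (hlim₁.sub hlim₂))).congr' ?_
    filter_upwards [hb.eventually_lt_const (half_pos hδ)] with n hn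
    have hp : p ∈ deepPairs T (2 * (b n).rOut) := hpδ _ (by linarith)
    simp only [F, indicator_of_mem hp, Function.comp_apply]
  calc ∫⁻ p, ‖u p.1 - u p.2‖ₑ ^ 2 ∂μ = ∫⁻ p, liminf (fun n => F n p) atTop ∂μ :=
        lintegral_congr_ae (tendsto_F.mono fun p hp => hp.liminf_eq.symm)
    _ ≤ liminf (fun n => ∫⁻ p, F n p ∂μ) atTop := lintegral_liminf_le hF
    _ ≤ _ := by
        refine liminf_le_of_le (by isBoundedDefault) fun a ha => ?_
        obtain ⟨n, hn⟩ := ha.exists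
        rw [lintegral_indicator (hdeep n)] at hn
        exact hn.trans (lintegral_deepPairs_mollify_le hTm hB hBT hdiam hu hG hw (b n))

theorem exists_const_lintegral_sub_sq_le (hT : IsOpen T) {x₀ : EuclideanSpace ℝ (Fin d)} {ρ : ℝ}
    (hρ : 0 < ρ) (hstar : ∀ y ∈ Metric.ball x₀ ρ, y ∈ T ∧ StarConvex ℝ y T)
    (hdiam : ∀ x ∈ T, ∀ y ∈ T, ‖x - y‖ ≤ h) (hu : IntegrableOn u T) (hG : IntegrableOn G T)
    (hw : HasWeakGradient T u G) :
    ∃ c : ℝ, volume (Metric.ball x₀ ρ) * ∫⁻ x in T, ‖u x - c‖ₑ ^ 2 ≤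
      ENNReal.ofReal h ^ 2 * (2 ^ d * volume T * ∫⁻ x in T, ‖G x‖ₑ ^ 2) := by
  have hBT : Metric.ball x₀ ρ ⊆ T := fun y hy => (hstar y hy).1
  have hB0 : volume (Metric.ball x₀ ρ) ≠ 0 := (Metric.measure_ball_pos volume x₀ hρ).ne'
  have hBtop : volume (Metric.ball x₀ ρ) ≠ ⊤ := measure_ball_lt_top.ne
  have hpairs := lintegral_prod_sub_sq_le hT measurableSet_ball hBT (fun y hy => (hstar y hy).2)
    (fun x hx y hy => hdiam x hx y (hBT hy)) hu hG hw
  have hmeas : AEMeasurable (fun p : EuclideanSpace ℝ (Fin d) × EuclideanSpace ℝ (Fin d) =>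
      ‖u p.1 - u p.2‖ₑ ^ 2) ((volume.restrict T).prod (volume.restrict (Metric.ball x₀ ρ))) :=
    ((hu.aestronglyMeasurable.aemeasurable.comp_quasiMeasurePreserving
      Measure.quasiMeasurePreserving_fst).sub
      ((hu.mono_set hBT).aestronglyMeasurable.aemeasurable.comp_quasiMeasurePreserving
        Measure.quasiMeasurePreserving_snd)).enorm.pow_const 2
  rw [lintegral_prod_symm _ hmeas] at hpairs
  -- `c` is the value of `u` at a point of the ball where the inner integral is at most its mean.
  obtain ⟨y, -, hy⟩ := exists_le_setLAverage hB0 hBtop hmeas.prod_swap.lintegral_prod_right'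
  refine ⟨u y, ?_⟩
  rw [setLAverage_eq, ENNReal.le_div_iff_mul_le (Or.inl hB0) (Or.inl hBtop), mul_comm] at hy
  exact hy.trans hpairs

end PoincareStar

/-! ### Estimates on one element -/

theorem rpow_integral_le {α : Type*} [MeasurableSpace α] {μ : Measure α} [IsFiniteMeasure μ]
    {p : ℝ} (hp : 1 < p) {f : α → ℝ} (hf0 : ∀ x, 0 ≤ f x) (hf : MemLp f (ENNReal.ofReal p) μ) :
    (∫ x, f x ∂μ) ^ p ≤ μ.real univ ^ (p - 1) * ∫ x, f x ^ p ∂μ := by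
  have hp0 : 0 < p := by linarith
  have holder := integral_mul_le_Lp_mul_Lq_of_nonneg (Real.HolderConjugate.conjExponent hp)
    (ae_of_all μ hf0) (ae_of_all μ fun _ => zero_le_one (α := ℝ)) hf (memLp_const 1)
  simp only [mul_one, Real.one_rpow, integral_const, smul_eq_mul] at holder
  have hI : 0 ≤ ∫ x, f x ^ p ∂μ := integral_nonneg fun x => Real.rpow_nonneg (hf0 x) _
  have hpow := Real.rpow_le_rpow (integral_nonneg hf0) holder hp0.le
  rw [Real.mul_rpow (by positivity) (by positivity), ← Real.rpow_mul hI, ← Real.rpow_mul (by simp),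
    one_div_mul_cancel hp0.ne', Real.rpow_one, Real.conjExponent, one_div_div,
    div_mul_cancel₀ _ hp0.ne'] at hpow
  linarith

section Element

variable {d : ℕ}

theorem memLp_of_isBounded {F : Type*} [NormedAddCommGroup F]
    {f : EuclideanSpace ℝ (Fin d) → F} {T : Set (EuclideanSpace ℝ (Fin d))} (hf : Continuous f)
    (hTm : MeasurableSet T) (hT : Bornology.IsBounded T) (p : ENNReal) :
    MemLp f p (volume.restrict T) := by
  have : IsFiniteMeasure (volume.restrict T) := isFiniteMeasure_restrict.2 hT.measure_lt_top.ne
  obtain ⟨C, hC⟩ := hT.isCompact_closure.exists_bound_of_continuousOn hf.continuousOn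
  exact MemLp.of_bound hf.aestronglyMeasurable C
    ((ae_restrict_iff' hTm).2 (ae_of_all _ fun x hx => hC x (subset_closure hx)))

/-- The volume of the unit ball of `ℝᵈ`. -/
def unitBallVolume (d : ℕ) : ℝ :=
  (volume : Measure (EuclideanSpace ℝ (Fin d))).real (Metric.ball 0 1)

theorem unitBallVolume_pos (d : ℕ) : 0 < unitBallVolume d :=
  ENNReal.toReal_pos (Metric.measure_ball_pos volume _ one_pos).ne' measure_ball_lt_top.ne

theorem volume_real_ball (x₀ : EuclideanSpace ℝ (Fin d)) {ρ : ℝ} (hρ : 0 < ρ) :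
    volume.real (Metric.ball x₀ ρ) = ρ ^ d * unitBallVolume d := by
  have hball := Measure.addHaar_ball_of_pos (volume : Measure (EuclideanSpace ℝ (Fin d))) x₀ hρ
  rw [finrank_euclideanSpace_fin] at hball
  rw [Measure.real, hball, ENNReal.toReal_mul, ENNReal.toReal_ofReal (by positivity)]
  rfl

/-- A set `T` which lies in the ball of radius `h` about `x₀` and contains the ball of radius
`σ h`. All the inequalities for polynomials on a mesh element hold on such sets, with constants
that depend on `T` only through `σ`. -/
structure IsRegularElement (σ h : ℝ) (x₀ : EuclideanSpace ℝ (Fin d))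
    (T : Set (EuclideanSpace ℝ (Fin d))) : Prop where
  size_pos : 0 < h
  measurableSet : MeasurableSet T
  subset_closedBall : T ⊆ Metric.closedBall x₀ h
  ball_subset : Metric.ball x₀ (σ * h) ⊆ T

namespace IsRegularElement

variable {σ h : ℝ} {x₀ : EuclideanSpace ℝ (Fin d)} {T : Set (EuclideanSpace ℝ (Fin d))}
  {F : Type*} [NormedAddCommGroup F] {f : EuclideanSpace ℝ (Fin d) → F}

theorem volume_real_le (hT : IsRegularElement σ h x₀ T) :
    volume.real T ≤ h ^ d * unitBallVolume d := by
  have hball := Measure.addHaar_real_closedBall (volume : Measure (EuclideanSpace ℝ (Fin d))) x₀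
    hT.size_pos.le
  rw [finrank_euclideanSpace_fin] at hball
  rw [unitBallVolume, ← hball]
  exact measureReal_mono hT.subset_closedBall measure_closedBall_lt_top.ne

theorem isBounded (hT : IsRegularElement σ h x₀ T) : Bornology.IsBounded T :=
  Metric.isBounded_closedBall.subset hT.subset_closedBall

theorem rpow_integral_ball_le (hT : IsRegularElement σ h x₀ T) {p : ℝ} (hp : 1 < p)
    (hf : Continuous f) :
    (∫ x in Metric.ball x₀ (σ * h), ‖f x‖) ^ p ≤
      (h ^ d * unitBallVolume d) ^ (p - 1) * ∫ x in T, ‖f x‖ ^ p := by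
  set B := Metric.ball x₀ (σ * h)
  have : IsFiniteMeasure (volume.restrict B) := isFiniteMeasure_restrict.2 measure_ball_lt_top.ne
  have hB : MemLp (fun x => ‖f x‖) (ENNReal.ofReal p) (volume.restrict B) :=
    (memLp_of_isBounded hf.norm hT.measurableSet hT.isBounded _).mono_measure
      (Measure.restrict_mono hT.ball_subset le_rfl)
  have hvol : volume.real B ≤ h ^ d * unitBallVolume d :=
    (measureReal_mono hT.ball_subset hT.isBounded.measure_lt_top.ne).trans hT.volume_real_le
  have hint : IntegrableOn (fun x => ‖f x‖ ^ p) T :=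
    integrableOn_of_isBounded (hf.norm.rpow_const fun _ => Or.inr (by linarith))
      hT.isBounded
  calc (∫ x in B, ‖f x‖) ^ p ≤ volume.real B ^ (p - 1) * ∫ x in B, ‖f x‖ ^ p := by
        simpa only [measureReal_restrict_apply_univ] using
          rpow_integral_le hp (fun x => norm_nonneg (f x)) hB
    _ ≤ (h ^ d * unitBallVolume d) ^ (p - 1) * ∫ x in T, ‖f x‖ ^ p := by
        refine mul_le_mul (Real.rpow_le_rpow measureReal_nonneg hvol (by linarith))
          (setIntegral_mono_set hint (ae_of_all _ fun x => by positivity)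
            hT.ball_subset.eventuallyLE)
          (integral_nonneg fun _ => by positivity) ?_
        exact Real.rpow_nonneg (measureReal_nonneg.trans hvol) _

theorem integral_sq_le (hT : IsRegularElement σ h x₀ T) (hf : Continuous f) {M : ℝ}
    (hM : ∀ x ∈ T, ‖f x‖ ≤ M) : ∫ x in T, ‖f x‖ ^ 2 ≤ h ^ d * unitBallVolume d * M ^ 2 :=
  calc ∫ x in T, ‖f x‖ ^ 2 ≤ ∫ _ in T, M ^ 2 :=
        setIntegral_mono_on (integrableOn_of_isBounded (by fun_prop) hT.isBounded)
          (integrableOn_const hT.isBounded.measure_lt_top.ne) hT.measurableSet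
          fun x hx => pow_le_pow_left₀ (norm_nonneg _) (hM x hx) 2
    _ = volume.real T * M ^ 2 := by rw [setIntegral_const, smul_eq_mul]
    _ ≤ h ^ d * unitBallVolume d * M ^ 2 := by
        gcongr
        exact hT.volume_real_le

end IsRegularElement

theorem exists_integral_norm_polyGrad_sq_le {σ : ℝ} (hσ : 0 < σ) (d r : ℕ) : ∃ C : ℝ, 0 < C ∧
    ∀ {T : Set (EuclideanSpace ℝ (Fin d))} {x₀ : EuclideanSpace ℝ (Fin d)} {h : ℝ},
      IsRegularElement σ h x₀ T → ∀ p : MvPolynomial (Fin d) ℝ, p.totalDegree ≤ r →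
      h ^ 2 * ∫ x in T, ‖polyGrad p x‖ ^ 2 ≤ C * ∫ x in T, ‖polyEval p x‖ ^ 2 := by
  obtain ⟨C, hC, hCp⟩ := exists_norm_polyGrad_le hσ d r
  have hv := unitBallVolume_pos d
  refine ⟨C ^ 2 * unitBallVolume d ^ 2, by positivity, fun {T x₀ h} hT p hp => ?_⟩
  have hh := hT.size_pos
  set v := unitBallVolume d
  set I := ∫ y in Metric.ball x₀ (σ * h), ‖polyEval p y‖
  set J := ∫ y in T, ‖polyEval p y‖ ^ 2
  have hI : I ^ 2 ≤ h ^ d * v * J := by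
    have hHölder := hT.rpow_integral_ball_le one_lt_two (continuous_polyEval p)
    norm_num only [Real.rpow_two, Real.rpow_one] at hHölder
    exact hHölder
  have hpt : ∀ x ∈ T, ‖polyGrad p x‖ ≤ h⁻¹ * (C * ((h ^ d)⁻¹ * I)) := fun x hx => by
    rw [le_inv_mul_iff₀ hh]
    exact hCp x₀ h hh p hp x (hT.subset_closedBall hx)
  calc h ^ 2 * ∫ x in T, ‖polyGrad p x‖ ^ 2
      ≤ h ^ 2 * (h ^ d * v * (h⁻¹ * (C * ((h ^ d)⁻¹ * I))) ^ 2) := by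
        gcongr
        exact hT.integral_sq_le (continuous_polyGrad p) hpt
    _ = C ^ 2 * v * (h ^ d)⁻¹ * I ^ 2 := by field_simp
    _ ≤ C ^ 2 * v * (h ^ d)⁻¹ * (h ^ d * v * J) := by gcongr
    _ = C ^ 2 * v ^ 2 * J := by field_simp

theorem norm_polyEval_sub_le {x₀ x : EuclideanSpace ℝ (Fin d)} {h M : ℝ}
    (p : MvPolynomial (Fin d) ℝ) (hM : ∀ y ∈ Metric.closedBall x₀ h, ‖polyGrad p y‖ ≤ M)
    (hx : x ∈ Metric.closedBall x₀ h) : ‖polyEval p x - polyEval p x₀‖ ≤ M * h := by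
  have hh : 0 ≤ h := dist_nonneg.trans hx
  have hM0 : 0 ≤ M := (norm_nonneg _).trans (hM x hx)
  calc ‖polyEval p x - polyEval p x₀‖ ≤ M * ‖x - x₀‖ :=
        (convex_closedBall x₀ h).norm_image_sub_le_of_norm_hasFDerivWithin_le
          (fun y _ => (hasFDerivAt_polyEval p y).hasFDerivWithinAt)
          (fun y hy => by simpa only [innerSL_apply_norm] using hM y hy)
          (Metric.mem_closedBall_self hh) hx
    _ ≤ M * h := by
        gcongr
        exact mem_closedBall_iff_norm.1 hx

/-- The net power of `h` in the Poincaré–Sobolev inequality on an element; the degree condition says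
that it is nonnegative. -/
theorem scaling_rpow {h : ℝ} (hh : 0 < h) (d : ℕ) (β : ℝ) :
    (h ^ d) ^ (β / 2) * ((h ^ d)⁻¹ ^ β * (h ^ d) ^ (β - 1)) * h ^ β =
      h ^ (β * (1 + d / 2) - d) := by
  rw [← Real.rpow_natCast h d, ← Real.rpow_neg hh.le, ← Real.rpow_mul hh.le,
    ← Real.rpow_mul hh.le, ← Real.rpow_mul hh.le, ← Real.rpow_add hh, ← Real.rpow_add hh,
    ← Real.rpow_add hh]
  congr 1
  ring

theorem exists_rpow_integral_polyEval_sub_le {σ : ℝ} (hσ : 0 < σ) (d r : ℕ) {β : ℝ} (hβ : 1 < β)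
    (hdβ : 0 ≤ β * (1 + d / 2) - d) {R : ℝ} (hR : 0 < R) : ∃ C : ℝ, 0 < C ∧
    ∀ {T : Set (EuclideanSpace ℝ (Fin d))} {x₀ : EuclideanSpace ℝ (Fin d)} {h : ℝ}, h ≤ R →
      IsRegularElement σ h x₀ T → ∀ p : MvPolynomial (Fin d) ℝ, p.totalDegree ≤ r →
      (∫ x in T, ‖polyEval p x - polyEval p x₀‖ ^ 2) ^ (β / 2) ≤
        C * ∫ x in T, ‖polyGrad p x‖ ^ β := by
  obtain ⟨C, hC, hCp⟩ := exists_norm_polyGrad_le_integral_norm hσ d r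
  have hv := unitBallVolume_pos d
  set v := unitBallVolume d
  refine ⟨C ^ β * (v ^ (β / 2) * v ^ (β - 1)) * R ^ (β * (1 + d / 2) - d), by positivity,
    fun {T x₀ h} hhR hT p hp => ?_⟩
  have := zero_lt_one.trans hβ
  have hh := hT.size_pos
  set I := ∫ y in Metric.ball x₀ (σ * h), ‖polyGrad p y‖
  set J := ∫ y in T, ‖polyGrad p y‖ ^ β
  have hI0 : 0 ≤ I := integral_nonneg fun _ => norm_nonneg _
  have hI : I ^ β ≤ (h ^ d * v) ^ (β - 1) * J := hT.rpow_integral_ball_le hβ (continuous_polyGrad p)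
  have hosc : ∀ x ∈ T, ‖polyEval p x - polyEval p x₀‖ ≤ C * ((h ^ d)⁻¹ * I) * h := fun x hx =>
    norm_polyEval_sub_le p (hCp x₀ h hh p hp) (hT.subset_closedBall hx)
  calc (∫ x in T, ‖polyEval p x - polyEval p x₀‖ ^ 2) ^ (β / 2)
      ≤ (h ^ d * v * (C * ((h ^ d)⁻¹ * I) * h) ^ 2) ^ (β / 2) := by
        gcongr
        exact hT.integral_sq_le ((continuous_polyEval p).sub continuous_const) hosc
    _ = (h ^ d) ^ (β / 2) * v ^ (β / 2) * (C ^ β * ((h ^ d)⁻¹ ^ β * I ^ β) * h ^ β) := by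
        rw [Real.mul_rpow (by positivity) (by positivity), Real.mul_rpow (by positivity) hv.le,
          ← Real.rpow_natCast _ 2, ← Real.rpow_mul (by positivity), Nat.cast_ofNat,
          mul_div_cancel₀ β two_ne_zero, Real.mul_rpow (by positivity) hh.le,
          Real.mul_rpow hC.le (by positivity), Real.mul_rpow (by positivity) hI0]
    _ ≤ (h ^ d) ^ (β / 2) * v ^ (β / 2) *
          (C ^ β * ((h ^ d)⁻¹ ^ β * ((h ^ d * v) ^ (β - 1) * J)) * h ^ β) := by gcongr
    _ = C ^ β * (v ^ (β / 2) * v ^ (β - 1)) * h ^ (β * (1 + d / 2) - d) * J := by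
        rw [Real.mul_rpow (by positivity) hv.le, ← scaling_rpow hh]
        ring
    _ ≤ C ^ β * (v ^ (β / 2) * v ^ (β - 1)) * R ^ (β * (1 + d / 2) - d) * J := by gcongr

end Element

/-! ### The finite element space -/

theorem norm_sq_eq_integral {α F : Type*} [MeasurableSpace α] {μ : Measure α}
    [NormedAddCommGroup F] [InnerProductSpace ℝ F] (f : Lp F 2 μ) :
    ‖f‖ ^ 2 = ∫ x, ‖f x‖ ^ 2 ∂μ := by
  rw [← real_inner_self_eq_norm_sq, L2.inner_def]
  simp only [real_inner_self_eq_norm_sq]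

theorem lpNorm_eq_norm {α F : Type*} [MeasurableSpace α] {μ : Measure α} [NormedAddCommGroup F]
    {f : α → F} {p : ENNReal} {g : Lp F p μ} (h : f =ᵐ[μ] g) : lpNorm f p μ = ‖g‖ := by
  rw [← toReal_eLpNorm ((Lp.aestronglyMeasurable g).congr h.symm), Lp.norm_def, eLpNorm_congr_ae h]

section Mesh

variable {d : ℕ} {Ω : Set (EuclideanSpace ℝ (Fin d))} {σ h : ℝ}
  {𝒯 : Finset (Set (EuclideanSpace ℝ (Fin d)))}

namespace IsQuasiUniformMesh

theorem h_pos (hm : IsQuasiUniformMesh Ω σ h 𝒯) (hd : 0 < d) (hΩ : Bornology.IsBounded Ω) :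
    0 < h := by
  obtain ⟨T, hT, rfl⟩ := hm.size.1
  obtain ⟨x, hx⟩ := hm.nonempty T hT
  have : Nontrivial (EuclideanSpace ℝ (Fin d)) :=
    Module.nontrivial_of_finrank_pos (R := ℝ) (by rwa [finrank_euclideanSpace_fin])
  have : (𝓝[≠] x).NeBot := Module.punctured_nhds_neBot ℝ (EuclideanSpace ℝ (Fin d)) x
  exact Metric.diam_pos (infinite_of_mem_nhds x ((hm.isOpen T hT).mem_nhds hx)).nontrivial
    (hΩ.subset (hm.subset T hT))

theorem h_le (hm : IsQuasiUniformMesh Ω σ h 𝒯) (hΩ : Bornology.IsBounded Ω) :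
    h ≤ Metric.diam Ω := by
  obtain ⟨T, hT, rfl⟩ := hm.size.1
  exact Metric.diam_mono (hm.subset T hT) hΩ

theorem norm_sub_le (hm : IsQuasiUniformMesh Ω σ h 𝒯) (hΩ : Bornology.IsBounded Ω)
    {T : Set (EuclideanSpace ℝ (Fin d))} (hT : T ∈ 𝒯) : ∀ x ∈ T, ∀ y ∈ T, ‖x - y‖ ≤ h := by
  intro x hx y hy
  rw [← dist_eq_norm]
  exact (Metric.dist_le_diam_of_mem (hΩ.subset (hm.subset T hT)) hx hy).trans
    (hm.size.2 ⟨T, hT, rfl⟩)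

theorem exists_isRegularElement (hm : IsQuasiUniformMesh Ω σ h 𝒯) (hd : 0 < d)
    (hΩ : Bornology.IsBounded Ω) (hσ : 0 < σ) {T : Set (EuclideanSpace ℝ (Fin d))} (hT : T ∈ 𝒯) :
    ∃ x₀, IsRegularElement σ h x₀ T ∧
      ∀ y ∈ Metric.ball x₀ (σ * h), y ∈ T ∧ StarConvex ℝ y T := by
  obtain ⟨x₀, hx₀⟩ := hm.star T hT
  have hh := hm.h_pos hd hΩ
  have hmem : x₀ ∈ T := (hx₀ x₀ (Metric.mem_ball_self (mul_pos hσ hh))).1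
  exact ⟨x₀, ⟨hh, (hm.isOpen T hT).measurableSet,
    fun x hx => mem_closedBall_iff_norm.2 (hm.norm_sub_le hΩ hT x hx x₀ hmem),
    fun y hy => (hx₀ y hy).1⟩, hx₀⟩

theorem measurableSet_biUnion (hm : IsQuasiUniformMesh Ω σ h 𝒯) : MeasurableSet (⋃ T ∈ 𝒯, T) :=
  Finset.measurableSet_biUnion _ fun T hT => (hm.isOpen T hT).measurableSet

theorem ae_eq_biUnion (hm : IsQuasiUniformMesh Ω σ h 𝒯) : Ω =ᵐ[volume] (⋃ T ∈ 𝒯, T : Set _) :=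
  eventuallyLE_antisymm_iff.2 ⟨ae_le_set.2 hm.cover, (iUnion₂_subset hm.subset).eventuallyLE⟩

theorem nullMeasurableSet (hm : IsQuasiUniformMesh Ω σ h 𝒯) : NullMeasurableSet Ω :=
  hm.measurableSet_biUnion.nullMeasurableSet.congr hm.ae_eq_biUnion.symm

theorem ae_eq_restrict (hm : IsQuasiUniformMesh Ω σ h 𝒯) {F : Type*}
    {f g : EuclideanSpace ℝ (Fin d) → F} (hfg : ∀ T ∈ 𝒯, f =ᵐ[volume.restrict T] g) :
    f =ᵐ[volume.restrict Ω] g := by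
  rw [Measure.restrict_congr_set hm.ae_eq_biUnion]
  exact (ae_restrict_biUnion_finset_iff id 𝒯 _).2 hfg

theorem integral_eq_sum (hm : IsQuasiUniformMesh Ω σ h 𝒯) {f : EuclideanSpace ℝ (Fin d) → ℝ}
    {g : 𝒯 → EuclideanSpace ℝ (Fin d) → ℝ} (hfg : ∀ T : 𝒯, f =ᵐ[volume.restrict T.1] g T)
    (hg : ∀ T : 𝒯, IntegrableOn (g T) T.1) :
    ∫ x in Ω, f x = ∑ T : 𝒯, ∫ x in T.1, g T x := by
  rw [setIntegral_congr_set hm.ae_eq_biUnion, integral_biUnion_finset 𝒯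
    (fun T hT => (hm.isOpen T hT).measurableSet)
    (fun T hT T' hT' hne => hm.disjoint T hT T' hT' hne)
    (fun T hT => (hg ⟨T, hT⟩).congr (hfg ⟨T, hT⟩).symm), ← Finset.sum_coe_sort]
  exact Finset.sum_congr rfl fun T _ => integral_congr_ae (hfg T)

theorem norm_sq_eq_sum {F : Type*} [NormedAddCommGroup F] [InnerProductSpace ℝ F]
    (hm : IsQuasiUniformMesh Ω σ h 𝒯) (s : Lp F 2 (volume.restrict Ω))
    {f : 𝒯 → EuclideanSpace ℝ (Fin d) → F} (hs : ∀ T : 𝒯, s =ᵐ[volume.restrict T.1] f T) :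
    ‖s‖ ^ 2 = ∑ T : 𝒯, ∫ x in T.1, ‖f T x‖ ^ 2 := by
  rw [norm_sq_eq_integral]
  refine hm.integral_eq_sum (fun T => (hs T).fun_comp fun v => ‖v‖ ^ 2) fun T => ?_
  exact (((Lp.memLp s).mono_measure (Measure.restrict_mono (hm.subset T T.2) le_rfl)).ae_eq
    (hs T)).integrable_norm_pow two_ne_zero

end IsQuasiUniformMesh

/-- The function which is equal to `f T` on each element `T`, and to zero off the elements. -/
def piecewise {F : Type*} [AddCommMonoid F] (f : 𝒯 → EuclideanSpace ℝ (Fin d) → F)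
    (x : EuclideanSpace ℝ (Fin d)) : F :=
  ∑ T : 𝒯, (T.1).indicator (f T) x

theorem piecewise_of_mem {F : Type*} [AddCommMonoid F] (hm : IsQuasiUniformMesh Ω σ h 𝒯)
    (f : 𝒯 → EuclideanSpace ℝ (Fin d) → F) (T : 𝒯) {x : EuclideanSpace ℝ (Fin d)} (hx : x ∈ T.1) :
    piecewise f x = f T x := by
  have hother : ∀ T' ∈ Finset.univ, T' ≠ T → (T'.1).indicator (f T') x = 0 := fun T' _ hne =>
    indicator_of_notMem (fun hx' => (hm.disjoint T' T'.2 T T.2 (Subtype.coe_ne_coe.2 hne)).le_bot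
      ⟨hx', hx⟩) _
  rw [piecewise, Finset.sum_eq_single T hother (fun hT => absurd (Finset.mem_univ T) hT),
    indicator_of_mem hx]

theorem piecewise_add {F : Type*} [AddCommMonoid F] (f g : 𝒯 → EuclideanSpace ℝ (Fin d) → F)
    (x : EuclideanSpace ℝ (Fin d)) :
    piecewise (fun T x => f T x + g T x) x = piecewise f x + piecewise g x := by
  simp only [piecewise, ← Finset.sum_add_distrib]
  exact Finset.sum_congr rfl fun T _ => congrFun (indicator_add T.1 (f T) (g T)) x

theorem piecewise_smul {F : Type*} [AddCommMonoid F] [Module ℝ F] (c : ℝ)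
    (f : 𝒯 → EuclideanSpace ℝ (Fin d) → F) (x : EuclideanSpace ℝ (Fin d)) :
    piecewise (fun T x => c • f T x) x = c • piecewise f x := by
  simp only [piecewise, Finset.smul_sum, indicator_const_smul_apply]

theorem memLp_piecewise {F : Type*} [NormedAddCommGroup F] (hm : IsQuasiUniformMesh Ω σ h 𝒯)
    (hΩ : Bornology.IsBounded Ω) (p : ENNReal) {f : 𝒯 → EuclideanSpace ℝ (Fin d) → F}
    (hf : ∀ T, Continuous (f T)) : MemLp (piecewise f) p (volume.restrict Ω) := by
  refine memLp_finsetSum _ fun T _ => ?_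
  have hTm := (hm.isOpen T T.2).measurableSet
  rw [memLp_indicator_iff_restrict hTm, Measure.restrict_restrict hTm,
    inter_eq_left.2 (hm.subset T T.2)]
  exact memLp_of_isBounded (hf T) hTm (hΩ.subset (hm.subset T T.2)) p

theorem coeFn_toLp_piecewise_ae_eq {F : Type*} [NormedAddCommGroup F]
    (hm : IsQuasiUniformMesh Ω σ h 𝒯) {f : 𝒯 → EuclideanSpace ℝ (Fin d) → F} {p : ENNReal}
    (hf : MemLp (piecewise f) p (volume.restrict Ω)) (T : 𝒯) :
    hf.toLp =ᵐ[volume.restrict T.1] f T := by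
  filter_upwards [ae_restrict_of_ae_restrict_of_subset (hm.subset T T.2) hf.coeFn_toLp,
    ae_restrict_mem (hm.isOpen T T.2).measurableSet] with x hx hxT
  exact hx.trans (piecewise_of_mem hm f T hxT)

theorem integral_comp_eq_sum {F : Type*} [TopologicalSpace F] (hm : IsQuasiUniformMesh Ω σ h 𝒯)
    (hΩ : Bornology.IsBounded Ω) {u : EuclideanSpace ℝ (Fin d) → F}
    {f : 𝒯 → EuclideanSpace ℝ (Fin d) → F} (hu : ∀ T : 𝒯, u =ᵐ[volume.restrict T.1] f T)
    (hf : ∀ T, Continuous (f T)) {Ψ : F → ℝ} (hΨ : Continuous Ψ) :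
    ∫ x in Ω, Ψ (u x) = ∑ T : 𝒯, ∫ x in T.1, Ψ (f T x) :=
  hm.integral_eq_sum (fun T => (hu T).fun_comp Ψ)
    fun T => integrableOn_of_isBounded (hΨ.comp (hf T)) (hΩ.subset (hm.subset T T.2))

variable {r : ℕ}

/-- Families of polynomials of degree at most `r`, one for each element: the coordinates of the
discontinuous finite element space, as a finite-dimensional vector space. -/
abbrev PolyFamily (𝒯 : Finset (Set (EuclideanSpace ℝ (Fin d)))) (r : ℕ) : Type :=
  𝒯 → MvPolynomial.restrictTotalDegree (Fin d) ℝ r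

/-- The piecewise polynomial of a family of polynomials, in `L²(Ω)`. -/
def feVal (hm : IsQuasiUniformMesh Ω σ h 𝒯) (hΩ : Bornology.IsBounded Ω) (r : ℕ) :
    PolyFamily 𝒯 r →ₗ[ℝ] Lp ℝ 2 (volume.restrict Ω) where
  toFun m := (memLp_piecewise hm hΩ 2 fun T => continuous_polyEval (m T).1).toLp
  map_add' m n := by
    rw [← MemLp.toLp_add, MemLp.toLp_eq_toLp_iff]
    refine ae_of_all _ fun x => ?_
    simp only [Pi.add_apply, ← piecewise_add, ← polyEval_add]
    rfl
  map_smul' c m := by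
    rw [RingHom.id_apply, ← MemLp.toLp_const_smul, MemLp.toLp_eq_toLp_iff]
    refine ae_of_all _ fun x => ?_
    simp only [Pi.smul_apply, ← piecewise_smul]
    simp only [smul_eq_mul, ← polyEval_smul]
    rfl

/-- The elementwise gradient of the piecewise polynomial of a family, in `L²(Ω)`. -/
def feGrad (hm : IsQuasiUniformMesh Ω σ h 𝒯) (hΩ : Bornology.IsBounded Ω) (r : ℕ) :
    PolyFamily 𝒯 r →ₗ[ℝ] Lp (EuclideanSpace ℝ (Fin d)) 2 (volume.restrict Ω) where
  toFun m := (memLp_piecewise hm hΩ 2 fun T => continuous_polyGrad (m T).1).toLp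
  map_add' m n := by
    rw [← MemLp.toLp_add, MemLp.toLp_eq_toLp_iff]
    refine ae_of_all _ fun x => ?_
    simp only [Pi.add_apply, ← piecewise_add, ← polyGrad_add]
    rfl
  map_smul' c m := by
    rw [RingHom.id_apply, ← MemLp.toLp_const_smul, MemLp.toLp_eq_toLp_iff]
    refine ae_of_all _ fun x => ?_
    simp only [Pi.smul_apply, ← piecewise_smul, ← polyGrad_smul]
    rfl

theorem feVal_ae_eq (hm : IsQuasiUniformMesh Ω σ h 𝒯) (hΩ : Bornology.IsBounded Ω)
    (m : PolyFamily 𝒯 r) (T : 𝒯) :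
    feVal hm hΩ r m =ᵐ[volume.restrict T.1] polyEval (m T).1 :=
  coeFn_toLp_piecewise_ae_eq hm (memLp_piecewise hm hΩ 2 fun T => continuous_polyEval (m T).1) T

theorem feGrad_ae_eq (hm : IsQuasiUniformMesh Ω σ h 𝒯) (hΩ : Bornology.IsBounded Ω)
    (m : PolyFamily 𝒯 r) (T : 𝒯) :
    feGrad hm hΩ r m =ᵐ[volume.restrict T.1] polyGrad (m T).1 :=
  coeFn_toLp_piecewise_ae_eq hm (memLp_piecewise hm hΩ 2 fun T => continuous_polyGrad (m T).1) T

/-- The family of constant polynomials with given values. -/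
def constFamily (𝒯 : Finset (Set (EuclideanSpace ℝ (Fin d)))) (r : ℕ) :
    (𝒯 → ℝ) →ₗ[ℝ] PolyFamily 𝒯 r :=
  LinearMap.pi fun T => (LinearMap.proj T).smulRight
    ⟨1, (MvPolynomial.mem_restrictTotalDegree _ _ _).2 (by simp)⟩

theorem coe_constFamily (c : 𝒯 → ℝ) (T : 𝒯) :
    (constFamily 𝒯 r c T).1 = MvPolynomial.C (c T) := by
  simp [constFamily, MvPolynomial.smul_eq_C_mul]

end Mesh

/-! ### The elementwise gradient and its bounds -/

theorem lintegral_enorm_sq_eq_ofReal {α F : Type*} [MeasurableSpace α] {μ : Measure α}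
    [NormedAddCommGroup F] {f : α → F} (hf : MemLp f 2 μ) :
    ∫⁻ x, ‖f x‖ₑ ^ 2 ∂μ = ENNReal.ofReal (∫ x, ‖f x‖ ^ 2 ∂μ) := by
  rw [ofReal_integral_eq_lintegral_ofReal (hf.integrable_norm_pow two_ne_zero)
    (ae_of_all _ fun x => sq_nonneg _)]
  simp only [ENNReal.ofReal_pow (norm_nonneg _), ofReal_norm]

theorem rpow_sum_le_sum_rpow {ι : Type*} (s : Finset ι) {f : ι → ℝ} (hf : ∀ i ∈ s, 0 ≤ f i) {p : ℝ}
    (hp : 0 < p) (hp1 : p ≤ 1) : (∑ i ∈ s, f i) ^ p ≤ ∑ i ∈ s, f i ^ p :=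
  Finset.le_sum_of_subadditive_on_pred (fun x => x ^ p) (0 ≤ ·) (Real.zero_rpow hp.ne').le
    (fun _ _ hx hy => Real.rpow_add_le_add_rpow hx hy hp.le hp1) (fun _ _ => add_nonneg) f hf

theorem exists_clm_comp_eq {M X Y : Type*} [AddCommGroup M] [Module ℝ M] [FiniteDimensional ℝ M]
    [NormedAddCommGroup X] [InnerProductSpace ℝ X] [NormedAddCommGroup Y] [NormedSpace ℝ Y]
    (A : M →ₗ[ℝ] X) (B : M →ₗ[ℝ] Y) (hAB : LinearMap.ker A ≤ LinearMap.ker B) :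
    ∃ G : X →L[ℝ] Y, ∀ m, G (A m) = B m := by
  let G₀ : LinearMap.range A →L[ℝ] Y := LinearMap.toContinuousLinearMap
    ((LinearMap.ker A).liftQ B hAB ∘ₗ A.quotKerEquivRange.symm.toLinearMap)
  refine ⟨G₀ ∘L (LinearMap.range A).orthogonalProjectionOnto, fun m => ?_⟩
  have hproj : (LinearMap.range A).orthogonalProjectionOnto (A m) =
      ⟨A m, A.mem_range_self m⟩ :=
    Submodule.orthogonalProjectionOnto_mem_subspace_eq_self
      (⟨A m, A.mem_range_self m⟩ : LinearMap.range A)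
  rw [ContinuousLinearMap.comp_apply, hproj]
  change (LinearMap.ker A).liftQ B hAB (A.quotKerEquivRange.symm ⟨A m, A.mem_range_self m⟩) = B m
  rw [LinearMap.quotKerEquivRange_symm_apply_image, Submodule.mkQ_apply, Submodule.liftQ_apply]

section DiscreteGradient

variable {d : ℕ} {Ω : Set (EuclideanSpace ℝ (Fin d))} {σ h : ℝ}
  {𝒯 : Finset (Set (EuclideanSpace ℝ (Fin d)))}

/-- `S` is the space of piecewise polynomials as a subspace of `L²(Ω)`, `S₀` is a subspace of
piecewise constants, and `G` is a bounded extension to `L²(Ω)` of the elementwise gradient on `S`;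
they satisfy the inverse inequality on `S`, the Poincaré–Sobolev inequality on `S` and the Poincaré
inequality on `H¹(Ω)`. -/
structure IsDiscreteGradient (Ω : Set (EuclideanSpace ℝ (Fin d)))
    (𝒯 : Finset (Set (EuclideanSpace ℝ (Fin d)))) (r : ℕ) (β C h : ℝ)
    (S S₀ : Submodule ℝ (Lp ℝ 2 (volume.restrict Ω)))
    (G : Lp ℝ 2 (volume.restrict Ω) →L[ℝ]
      Lp (EuclideanSpace ℝ (Fin d)) 2 (volume.restrict Ω)) : Prop where
  finite : FiniteDimensional ℝ S
  finite_const : FiniteDimensional ℝ S₀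
  const_le : S₀ ≤ S
  exists_class : ∀ w ∈ feSpace 𝒯 r, ∃ s ∈ S, w =ᵐ[volume.restrict Ω] s ∧
    gradient w =ᵐ[volume.restrict Ω] G s
  exists_rep : ∀ s ∈ S, ∃ w ∈ feSpace 𝒯 r, w =ᵐ[volume.restrict Ω] s
  map_const : ∀ c ∈ S₀, G c = 0
  inverse : ∀ s ∈ S, h * ‖G s‖ ≤ C * ‖s‖
  sobolev : ∀ s ∈ S, ∃ c ∈ S₀, ‖s - c‖ ^ β ≤ C * ∫ x in Ω, ‖G s x‖ ^ β
  poincare : ∀ (u : EuclideanSpace ℝ (Fin d) → ℝ)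
    (g : EuclideanSpace ℝ (Fin d) → EuclideanSpace ℝ (Fin d)), MemLp g 2 (volume.restrict Ω) →
    HasWeakGradient Ω u g → ∀ s : Lp ℝ 2 (volume.restrict Ω), u =ᵐ[volume.restrict Ω] s →
    ∃ c ∈ S₀, ‖s - c‖ ≤ C * h * lpNorm g 2 (volume.restrict Ω)

theorem IsRegularElement.exists_integral_sub_const_sq_le
    {T : Set (EuclideanSpace ℝ (Fin d))} {x₀ : EuclideanSpace ℝ (Fin d)}
    (hT : IsRegularElement σ h x₀ T) (hσ : 0 < σ) (hTo : IsOpen T)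
    (hstar : ∀ y ∈ Metric.ball x₀ (σ * h), y ∈ T ∧ StarConvex ℝ y T)
    (hdiam : ∀ x ∈ T, ∀ y ∈ T, ‖x - y‖ ≤ h) {u : EuclideanSpace ℝ (Fin d) → ℝ}
    {g : EuclideanSpace ℝ (Fin d) → EuclideanSpace ℝ (Fin d)}
    (hu : MemLp u 2 (volume.restrict T)) (hg : MemLp g 2 (volume.restrict T))
    (hw : HasWeakGradient T u g) :
    ∃ c : ℝ, ∫ x in T, ‖u x - c‖ ^ 2 ≤ 2 ^ d / σ ^ d * h ^ 2 * ∫ x in T, ‖g x‖ ^ 2 := by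
  have hh := hT.size_pos
  have hv := unitBallVolume_pos d
  have : IsFiniteMeasure (volume.restrict T) :=
    isFiniteMeasure_restrict.2 hT.isBounded.measure_lt_top.ne
  obtain ⟨c, hc⟩ := exists_const_lintegral_sub_sq_le hTo (mul_pos hσ hh) hstar hdiam
    (hu.integrable one_le_two) (hg.integrable one_le_two) hw
  refine ⟨c, ?_⟩
  have huc : MemLp (fun x => u x - c) 2 (volume.restrict T) := hu.sub (memLp_const c)
  rw [lintegral_enorm_sq_eq_ofReal huc, lintegral_enorm_sq_eq_ofReal hg] at hc
  set I := ∫ x in T, ‖u x - c‖ ^ 2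
  set J := ∫ x in T, ‖g x‖ ^ 2
  have hI : 0 ≤ I := integral_nonneg fun _ => sq_nonneg _
  have hJ : 0 ≤ J := integral_nonneg fun _ => sq_nonneg _
  have hreal : volume.real (Metric.ball x₀ (σ * h)) * I ≤ h ^ 2 * (2 ^ d * volume.real T * J) := by
    have htop : volume T ≠ ⊤ := hT.isBounded.measure_lt_top.ne
    simpa only [ENNReal.toReal_mul, ENNReal.toReal_pow, ENNReal.toReal_ofReal hI,
      ENNReal.toReal_ofReal hJ, ENNReal.toReal_ofReal hh.le, ENNReal.toReal_ofNat, Measure.real]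
      using ENNReal.toReal_mono (by finiteness) hc
  rw [volume_real_ball x₀ (mul_pos hσ hh)] at hreal
  refine le_of_mul_le_mul_left (a := (σ * h) ^ d * unitBallVolume d) ?_ (by positivity)
  calc (σ * h) ^ d * unitBallVolume d * I ≤ h ^ 2 * (2 ^ d * volume.real T * J) := hreal
    _ ≤ h ^ 2 * (2 ^ d * (h ^ d * unitBallVolume d) * J) := by
        gcongr
        exact hT.volume_real_le
    _ = (σ * h) ^ d * unitBallVolume d * (2 ^ d / σ ^ d * h ^ 2 * J) := by
        rw [mul_pow]
        field_simp

theorem exists_norm_sub_feVal_constFamily_le (hm : IsQuasiUniformMesh Ω σ h 𝒯) (hd : 0 < d)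
    (hΩ : Bornology.IsBounded Ω) (hσ : 0 < σ) (r : ℕ) {u : EuclideanSpace ℝ (Fin d) → ℝ}
    {g : EuclideanSpace ℝ (Fin d) → EuclideanSpace ℝ (Fin d)}
    (hg : MemLp g 2 (volume.restrict Ω)) (hw : HasWeakGradient Ω u g)
    {s : Lp ℝ 2 (volume.restrict Ω)} (hs : u =ᵐ[volume.restrict Ω] s) :
    ∃ c : 𝒯 → ℝ, ‖s - feVal hm hΩ r (constFamily 𝒯 r c)‖ ≤
      √(2 ^ d / σ ^ d) * h * lpNorm g 2 (volume.restrict Ω) := by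
  have hh := hm.h_pos hd hΩ
  have hu : MemLp u 2 (volume.restrict Ω) := (Lp.memLp s).ae_eq hs.symm
  have hlocal : ∀ T : 𝒯, ∃ c : ℝ,
      ∫ x in T.1, ‖u x - c‖ ^ 2 ≤ 2 ^ d / σ ^ d * h ^ 2 * ∫ x in T.1, ‖g x‖ ^ 2 := fun T => by
    obtain ⟨x₀, hT, hstar⟩ := hm.exists_isRegularElement hd hΩ hσ T.2
    have hle := Measure.restrict_mono_set (volume : Measure (EuclideanSpace ℝ (Fin d)))
      (hm.subset T T.2)
    exact hT.exists_integral_sub_const_sq_le hσ (hm.isOpen T T.2) hstar (hm.norm_sub_le hΩ T.2)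
      (hu.mono_measure hle) (hg.mono_measure hle) (hw.mono hm.nullMeasurableSet (hm.subset T T.2))
  choose c hc using hlocal
  refine ⟨c, le_of_sq_le_sq ?_ (mul_nonneg (by positivity) lpNorm_nonneg)⟩
  have hdiff : ∀ T : 𝒯, (s - feVal hm hΩ r (constFamily 𝒯 r c) : Lp ℝ 2 (volume.restrict Ω))
      =ᵐ[volume.restrict T.1] fun x => u x - c T := fun T => by
    filter_upwards [ae_restrict_of_ae_restrict_of_subset (hm.subset T T.2) (Lp.coeFn_sub s _),
      ae_restrict_of_ae_restrict_of_subset (hm.subset T T.2) hs,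
      feVal_ae_eq hm hΩ (constFamily 𝒯 r c) T] with x hsub hsx hcx
    rw [hsub, Pi.sub_apply, ← hsx, hcx, coe_constFamily, polyEval_C]
  rw [mul_pow, mul_pow, Real.sq_sqrt (by positivity), lpNorm_eq_norm hg.coeFn_toLp.symm,
    hm.norm_sq_eq_sum _ hdiff, hm.norm_sq_eq_sum _ fun T =>
      ae_restrict_of_ae_restrict_of_subset (hm.subset T T.2) hg.coeFn_toLp, Finset.mul_sum]
  exact Finset.sum_le_sum fun T _ => hc T

theorem exists_mul_norm_feGrad_le (hd : 0 < d) (hΩ : Bornology.IsBounded Ω) (hσ : 0 < σ) (r : ℕ) :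
    ∃ C : ℝ, 0 < C ∧ ∀ {h : ℝ} {𝒯 : Finset (Set (EuclideanSpace ℝ (Fin d)))}
      (hm : IsQuasiUniformMesh Ω σ h 𝒯) (m : PolyFamily 𝒯 r),
      h * ‖feGrad hm hΩ r m‖ ≤ C * ‖feVal hm hΩ r m‖ := by
  obtain ⟨C, hC, hinv⟩ := exists_integral_norm_polyGrad_sq_le hσ d r
  refine ⟨√C, Real.sqrt_pos.2 hC, fun hm m => le_of_sq_le_sq ?_ (by positivity)⟩
  rw [mul_pow, mul_pow, Real.sq_sqrt hC.le, hm.norm_sq_eq_sum _ (feGrad_ae_eq hm hΩ m),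
    hm.norm_sq_eq_sum _ (feVal_ae_eq hm hΩ m), Finset.mul_sum, Finset.mul_sum]
  refine Finset.sum_le_sum fun T _ => ?_
  obtain ⟨x₀, hT, -⟩ := hm.exists_isRegularElement hd hΩ hσ T.2
  exact hinv hT _ ((MvPolynomial.mem_restrictTotalDegree _ _ _).1 (m T).2)

theorem exists_norm_feVal_sub_rpow_le (hd : 0 < d) (hΩ : Bornology.IsBounded Ω) (hσ : 0 < σ)
    (r : ℕ) {β : ℝ} (hβ : 1 < β) (hβ2 : β ≤ 2) (hdβ : 0 ≤ β * (1 + d / 2) - d) :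
    ∃ C : ℝ, 0 < C ∧ ∀ {h : ℝ} {𝒯 : Finset (Set (EuclideanSpace ℝ (Fin d)))}
      (hm : IsQuasiUniformMesh Ω σ h 𝒯) (m : PolyFamily 𝒯 r), ∃ c : 𝒯 → ℝ,
      ‖feVal hm hΩ r m - feVal hm hΩ r (constFamily 𝒯 r c)‖ ^ β ≤
        C * ∫ x in Ω, ‖feGrad hm hΩ r m x‖ ^ β := by
  have hβ0 : 0 < β := by linarith
  obtain ⟨C, hC, hsob⟩ := exists_rpow_integral_polyEval_sub_le hσ d r hβ hdβ
    (R := Metric.diam Ω + 1) (add_pos_of_nonneg_of_pos Metric.diam_nonneg one_pos)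
  refine ⟨C, hC, fun {h 𝒯} hm m => ?_⟩
  choose x₀ hT _ using fun T : 𝒯 => hm.exists_isRegularElement hd hΩ hσ T.2
  set c : 𝒯 → ℝ := fun T => polyEval (m T).1 (x₀ T)
  refine ⟨c, ?_⟩
  have hdiff : ∀ T : 𝒯, feVal hm hΩ r (m - constFamily 𝒯 r c) =ᵐ[volume.restrict T.1]
      fun x => polyEval (m T).1 x - polyEval (m T).1 (x₀ T) := fun T => by
    filter_upwards [feVal_ae_eq hm hΩ (m - constFamily 𝒯 r c) T] with x hx
    rw [hx, Pi.sub_apply, Submodule.coe_sub, coe_constFamily, polyEval, map_sub,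
      MvPolynomial.eval_C]
    rfl
  rw [← map_sub, integral_comp_eq_sum hm hΩ (feGrad_ae_eq hm hΩ m)
    (fun T => continuous_polyGrad (m T).1) (Ψ := fun v => ‖v‖ ^ β)
    (continuous_norm.rpow_const fun _ => Or.inr hβ0.le), Finset.mul_sum]
  calc ‖feVal hm hΩ r (m - constFamily 𝒯 r c)‖ ^ β
      = (∑ T : 𝒯, ∫ x in T.1, ‖polyEval (m T).1 x - polyEval (m T).1 (x₀ T)‖ ^ 2) ^ (β / 2) := by
        rw [← hm.norm_sq_eq_sum _ hdiff, ← Real.rpow_natCast _ 2, ← Real.rpow_mul (norm_nonneg _),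
          Nat.cast_ofNat, mul_div_cancel₀ β two_ne_zero]
    _ ≤ ∑ T : 𝒯, (∫ x in T.1, ‖polyEval (m T).1 x - polyEval (m T).1 (x₀ T)‖ ^ 2) ^ (β / 2) :=
        rpow_sum_le_sum_rpow _ (fun T _ => integral_nonneg fun _ => sq_nonneg _) (by positivity)
          (by linarith)
    _ ≤ ∑ T : 𝒯, C * ∫ x in T.1, ‖polyGrad (m T).1 x‖ ^ β :=
        Finset.sum_le_sum fun T _ => hsob ((hm.h_le hΩ).trans (by linarith)) (hT T) _
          ((MvPolynomial.mem_restrictTotalDegree _ _ _).1 (m T).2)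

variable {r : ℕ}

theorem exists_ae_eq_feVal (hm : IsQuasiUniformMesh Ω σ h 𝒯) (hΩ : Bornology.IsBounded Ω)
    {w : EuclideanSpace ℝ (Fin d) → ℝ} (hw : w ∈ feSpace 𝒯 r) :
    ∃ m, w =ᵐ[volume.restrict Ω] feVal hm hΩ r m ∧
      gradient w =ᵐ[volume.restrict Ω] feGrad hm hΩ r m := by
  choose p hp hwp using fun T : 𝒯 => hw T.1 T.2
  let m : PolyFamily 𝒯 r := fun T => ⟨p T, (MvPolynomial.mem_restrictTotalDegree _ _ _).2 (hp T)⟩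
  refine ⟨m, hm.ae_eq_restrict fun T hT => ?_, hm.ae_eq_restrict fun T hT => ?_⟩
  · have hval : w =ᵐ[volume.restrict T] polyEval (p ⟨T, hT⟩) :=
      ae_restrict_of_forall_mem (hm.isOpen T hT).measurableSet (hwp ⟨T, hT⟩)
    exact hval.trans (feVal_ae_eq hm hΩ m ⟨T, hT⟩).symm
  · have hgrad : ∀ x ∈ T, gradient w x = polyGrad (p ⟨T, hT⟩) x := fun x hx => by
      have hloc : w =ᶠ[𝓝 x] polyEval (p ⟨T, hT⟩) :=
        Filter.mem_of_superset ((hm.isOpen T hT).mem_nhds hx) (hwp ⟨T, hT⟩)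
      rw [hloc.gradient_eq, (hasGradientAt_polyEval _ _).gradient]
    have hgrad_ae : gradient w =ᵐ[volume.restrict T] polyGrad (p ⟨T, hT⟩) :=
      ae_restrict_of_forall_mem (hm.isOpen T hT).measurableSet hgrad
    exact hgrad_ae.trans (feGrad_ae_eq hm hΩ m ⟨T, hT⟩).symm

theorem exists_mem_feSpace_ae_eq (hm : IsQuasiUniformMesh Ω σ h 𝒯) (hΩ : Bornology.IsBounded Ω)
    (m : PolyFamily 𝒯 r) : ∃ w ∈ feSpace 𝒯 r, w =ᵐ[volume.restrict Ω] feVal hm hΩ r m :=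
  ⟨piecewise fun T => polyEval (m T).1, fun T hT => ⟨(m ⟨T, hT⟩).1,
    (MvPolynomial.mem_restrictTotalDegree _ _ _).1 (m ⟨T, hT⟩).2,
    fun _ hx => piecewise_of_mem hm _ ⟨T, hT⟩ hx⟩,
    (memLp_piecewise hm hΩ 2 fun T => continuous_polyEval (m T).1).coeFn_toLp.symm⟩

theorem feGrad_constFamily (hm : IsQuasiUniformMesh Ω σ h 𝒯) (hΩ : Bornology.IsBounded Ω)
    (c : 𝒯 → ℝ) : feGrad hm hΩ r (constFamily 𝒯 r c) = 0 := by
  refine Lp.eq_zero_iff_ae_eq_zero.2 (hm.ae_eq_restrict fun T hT => ?_)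
  filter_upwards [feGrad_ae_eq hm hΩ (constFamily 𝒯 r c) ⟨T, hT⟩] with x hx
  rw [hx, coe_constFamily, polyGrad_C, Pi.zero_apply]

theorem exists_isDiscreteGradient (hd : 0 < d) (hΩ : Bornology.IsBounded Ω)
    (r : ℕ) (hσ : 0 < σ) {β : ℝ} (hβ : 1 < β) (hβ2 : β ≤ 2) (hdβ : 0 ≤ β * (1 + d / 2) - d) :
    ∃ C : ℝ, 0 < C ∧ ∀ {h : ℝ} {𝒯 : Finset (Set (EuclideanSpace ℝ (Fin d)))},
      IsQuasiUniformMesh Ω σ h 𝒯 → ∃ S S₀ G, IsDiscreteGradient Ω 𝒯 r β C h S S₀ G := by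
  obtain ⟨C₁, hC₁, hinv⟩ := exists_mul_norm_feGrad_le hd hΩ hσ r
  obtain ⟨C₂, hC₂, hsob⟩ := exists_norm_feVal_sub_rpow_le hd hΩ hσ r hβ hβ2 hdβ
  set C₃ := √(2 ^ d / σ ^ d)
  have hC₃ : 0 ≤ C₃ := Real.sqrt_nonneg _
  refine ⟨C₁ + C₂ + C₃, by positivity, fun {h 𝒯} hm => ?_⟩
  have hh := hm.h_pos hd hΩ
  obtain ⟨G, hG⟩ := exists_clm_comp_eq (feVal hm hΩ r) (feGrad hm hΩ r) fun m hm0 => by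
    have hle := hinv hm m
    rw [LinearMap.mem_ker.1 hm0, norm_zero, mul_zero] at hle
    exact norm_le_zero_iff.1 (nonpos_of_mul_nonpos_right hle hh)
  refine ⟨LinearMap.range (feVal hm hΩ r), LinearMap.range (feVal hm hΩ r ∘ₗ constFamily 𝒯 r), G,
    { finite := inferInstance
      finite_const := inferInstance
      const_le := LinearMap.range_comp_le_range _ _
      exists_class := fun w hw => ?_
      exists_rep := ?_
      map_const := ?_
      inverse := ?_
      sobolev := ?_
      poincare := fun u g hg hw s hs => ?_ }⟩
  · obtain ⟨m, hval, hgrad⟩ := exists_ae_eq_feVal hm hΩ hw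
    exact ⟨_, ⟨m, rfl⟩, hval, by rwa [hG]⟩
  · rintro _ ⟨m, rfl⟩
    exact exists_mem_feSpace_ae_eq hm hΩ m
  · rintro _ ⟨c, rfl⟩
    rw [LinearMap.comp_apply, hG, feGrad_constFamily]
  · rintro _ ⟨m, rfl⟩
    rw [hG]
    exact (hinv hm m).trans (by gcongr; linarith)
  · rintro _ ⟨m, rfl⟩
    obtain ⟨c, hc⟩ := hsob hm m
    refine ⟨_, ⟨c, rfl⟩, ?_⟩
    rw [hG]
    exact hc.trans (mul_le_mul_of_nonneg_right (by linarith)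
      (integral_nonneg fun _ => by positivity))
  · obtain ⟨c, hc⟩ := exists_norm_sub_feVal_constFamily_le hm hd hΩ hσ r hg hw hs
    refine ⟨_, ⟨c, rfl⟩, hc.trans ?_⟩
    exact mul_le_mul_of_nonneg_right (by gcongr; linarith) lpNorm_nonneg

end DiscreteGradient

/-! ### The energy functionals on `L²` -/

section Lebesgue

variable {α F : Type*} [MeasurableSpace α] {μ : Measure α} [IsFiniteMeasure μ]
  [NormedAddCommGroup F] {β : ℝ}

theorem integrable_norm_rpow (hβ : 0 ≤ β) (hβ2 : β ≤ 2) (Z : Lp F 2 μ) :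
    Integrable (fun x => ‖Z x‖ ^ β) μ := by
  have hle : ENNReal.ofReal β ≤ 2 := ENNReal.ofReal_le_of_le_toReal (by simpa using hβ2)
  simpa only [ENNReal.toReal_ofReal hβ] using ((Lp.memLp Z).mono_exponent hle).integrable_norm_rpow'

theorem integral_norm_sub_rpow_le (hβ : 0 ≤ β) (hβ2 : β ≤ 2) (Z W : Lp F 2 μ) :
    ∫ x, ‖(Z - W : Lp F 2 μ) x‖ ^ β ∂μ ≤ 2 ^ β * (∫ x, ‖Z x‖ ^ β ∂μ + ∫ x, ‖W x‖ ^ β ∂μ) := by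
  have hint := fun Z : Lp F 2 μ => integrable_norm_rpow hβ hβ2 Z
  rw [← integral_add (hint Z) (hint W), ← integral_const_mul]
  refine integral_mono_ae (hint _) (((hint Z).add (hint W)).const_mul _) ?_
  filter_upwards [Lp.coeFn_sub Z W] with x hx
  rw [hx, Pi.sub_apply]
  have hmax : ‖Z x - W x‖ ≤ 2 * max ‖Z x‖ ‖W x‖ := by
    linarith [norm_sub_le (Z x) (W x), le_max_left ‖Z x‖ ‖W x‖, le_max_right ‖Z x‖ ‖W x‖]
  calc ‖Z x - W x‖ ^ β ≤ (2 * max ‖Z x‖ ‖W x‖) ^ β := Real.rpow_le_rpow (norm_nonneg _) hmax hβ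
    _ = 2 ^ β * max (‖Z x‖ ^ β) (‖W x‖ ^ β) := by
        rw [Real.mul_rpow zero_le_two (by positivity),
          (Real.monotoneOn_rpow_Ici_of_exponent_nonneg hβ).map_max (norm_nonneg _) (norm_nonneg _)]
    _ ≤ 2 ^ β * (‖Z x‖ ^ β + ‖W x‖ ^ β) := by
        gcongr
        exact max_le_add_of_nonneg (by positivity) (by positivity)

end Lebesgue

namespace GenPoly

variable {N : ℕ} (P : GenPoly N) {α F : Type*} [MeasurableSpace α] {μ : Measure α}
  [NormedAddCommGroup F] [InnerProductSpace ℝ F]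

/-- The Nemytskii operator `Z ↦ K(|Z|) Z` of the flux on `L²`. -/
def fluxLp (Z : Lp F 2 μ) : Lp F 2 μ := P.lipschitzWith_flux.compLp P.flux_zero Z

/-- The dissipation `∫ K(|Z|) |Z|²`. -/
def dissipation (Z : Lp F 2 μ) : ℝ := inner ℝ (P.fluxLp Z) Z

/-- The potential energy `∫ H(|Z|)`, where `H(ξ) = 2 ∫₀^ξ K(s) s ds`. -/
def potentialEnergy (Z : Lp F 2 μ) : ℝ := ∫ x, P.potential (Z x) ∂μ

theorem coeFn_fluxLp (Z : Lp F 2 μ) : P.fluxLp Z =ᵐ[μ] fun x => P.flux (Z x) :=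
  P.lipschitzWith_flux.coeFn_compLp P.flux_zero Z

theorem inner_fluxLp (Z W : Lp F 2 μ) :
    inner ℝ (P.fluxLp Z) W = ∫ x, inner ℝ (P.flux (Z x)) (W x) ∂μ := by
  rw [L2.inner_def]
  refine integral_congr_ae ?_
  filter_upwards [P.coeFn_fluxLp Z] with x hx
  rw [hx]

theorem integrable_inner_flux (Z W : Lp F 2 μ) :
    Integrable (fun x => inner ℝ (P.flux (Z x)) (W x)) μ := by
  refine (L2.integrable_inner (𝕜 := ℝ) (P.fluxLp Z) W).congr ?_
  filter_upwards [P.coeFn_fluxLp Z] with x hx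
  rw [hx]

theorem inner_flux_self_nonneg (v : F) : 0 ≤ inner ℝ (P.flux v) v := by
  rw [P.inner_flux_self]
  exact mul_nonneg (P.K_nonneg (norm_nonneg v)) (sq_nonneg _)

theorem dissipation_nonneg (Z : Lp F 2 μ) : 0 ≤ P.dissipation Z := by
  rw [dissipation, inner_fluxLp]
  exact integral_nonneg fun x => P.inner_flux_self_nonneg _

theorem norm_fluxLp_sq_le (Z : Lp F 2 μ) : ‖P.fluxLp Z‖ ^ 2 ≤ 1 / P.coeff 0 * P.dissipation Z := by
  rw [norm_sq_eq_integral, dissipation, inner_fluxLp, ← integral_const_mul]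
  refine integral_mono_ae ((Lp.memLp _).integrable_norm_pow two_ne_zero)
    ((P.integrable_inner_flux Z Z).const_mul _) ?_
  filter_upwards [P.coeFn_fluxLp Z] with x hx
  rw [hx]
  exact P.norm_flux_sq_le _

theorem dissipation_le (Z : Lp F 2 μ) : P.dissipation Z ≤ 1 / P.coeff 0 * ‖Z‖ ^ 2 := by
  rw [norm_sq_eq_integral, dissipation, inner_fluxLp, ← integral_const_mul]
  refine integral_mono (P.integrable_inner_flux Z Z)
    (((Lp.memLp Z).integrable_norm_pow two_ne_zero).const_mul _) fun x => ?_
  simp only [P.inner_flux_self]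
  exact mul_le_mul_of_nonneg_right (P.K_le (norm_nonneg _)) (by positivity)

theorem integrable_potential (Z : Lp F 2 μ) : Integrable (fun x => P.potential (Z x)) μ := by
  refine ((P.integrable_inner_flux Z Z).const_mul 2).mono'
    (P.continuous_potential.comp_aestronglyMeasurable (Lp.aestronglyMeasurable Z))
    (ae_of_all _ fun x => ?_)
  rw [Real.norm_of_nonneg ((P.inner_flux_self_nonneg _).trans (P.inner_flux_le_potential _))]
  exact P.potential_le _

theorem dissipation_le_potentialEnergy (Z : Lp F 2 μ) : P.dissipation Z ≤ P.potentialEnergy Z := by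
  rw [dissipation, inner_fluxLp]
  exact integral_mono (P.integrable_inner_flux Z Z) (P.integrable_potential Z)
    fun x => P.inner_flux_le_potential _

theorem potentialEnergy_le (Z : Lp F 2 μ) : P.potentialEnergy Z ≤ 2 * P.dissipation Z := by
  rw [dissipation, inner_fluxLp, ← integral_const_mul]
  exact integral_mono (P.integrable_potential Z) ((P.integrable_inner_flux Z Z).const_mul _)
    fun x => P.potential_le _

theorem two_inner_fluxLp_le (Z W : Lp F 2 μ) :
    2 * inner ℝ (P.fluxLp Z) W ≤ P.potentialEnergy (Z + W) - P.potentialEnergy Z := by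
  rw [inner_fluxLp, potentialEnergy, potentialEnergy, ← integral_const_mul,
    ← integral_sub (P.integrable_potential _) (P.integrable_potential _)]
  refine integral_mono_ae ((P.integrable_inner_flux Z W).const_mul 2)
    ((P.integrable_potential _).sub (P.integrable_potential _)) ?_
  filter_upwards [Lp.coeFn_add Z W] with x hx
  simpa only [hx, Pi.add_apply, add_sub_cancel_left] using P.two_inner_flux_le (Z x) (Z x + W x)

theorem potentialEnergy_add_sub_le (Z W : Lp F 2 μ) :
    P.potentialEnergy (Z + W) - P.potentialEnergy Z ≤
      2 * inner ℝ (P.fluxLp Z) W + 4 / P.coeff 0 * ‖W‖ ^ 2 := by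
  have hflux := (P.integrable_inner_flux Z W).const_mul 2
  have hsq := ((Lp.memLp W).integrable_norm_pow two_ne_zero).const_mul (4 / P.coeff 0)
  rw [inner_fluxLp, norm_sq_eq_integral, potentialEnergy, potentialEnergy, ← integral_const_mul,
    ← integral_const_mul, ← integral_add hflux hsq,
    ← integral_sub (P.integrable_potential _) (P.integrable_potential _)]
  refine integral_mono_ae ((P.integrable_potential _).sub (P.integrable_potential _))
    (hflux.add hsq) ?_
  filter_upwards [Lp.coeFn_add Z W] with x hx
  simpa only [hx, Pi.add_apply, add_sub_cancel_left] using P.potential_sub_le (Z x) (Z x + W x)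

theorem hasFDerivAt_potentialEnergy (Z : Lp F 2 μ) :
    HasFDerivAt P.potentialEnergy ((2 : ℝ) • innerSL ℝ (P.fluxLp Z)) Z := by
  have := P.coeff_zero_pos
  rw [hasFDerivAt_iff_isLittleO_nhds_zero]
  refine Asymptotics.IsBigO.trans_isLittleO (g := fun W : Lp F 2 μ => ‖W‖ ^ 2) ?_
    (Asymptotics.isLittleO_norm_pow_id one_lt_two)
  refine Asymptotics.IsBigO.of_bound (4 / P.coeff 0) (Eventually.of_forall fun W => ?_)
  rw [smul_apply, innerSL_apply_apply, smul_eq_mul, Real.norm_of_nonneg,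
    Real.norm_of_nonneg (by positivity)]
  · linarith [P.potentialEnergy_add_sub_le Z W]
  · linarith [P.two_inner_fluxLp_le Z W]

theorem integral_norm_rpow_le [IsFiniteMeasure μ] {η C : ℝ}
    (hC : ∀ ξ : ℝ, 0 ≤ ξ → ξ ^ P.β ≤ η + C * (P.K ξ * ξ ^ 2)) (Z : Lp F 2 μ) :
    ∫ x, ‖Z x‖ ^ P.β ∂μ ≤ η * μ.real univ + C * P.dissipation Z := by
  have hconst : η * μ.real univ = ∫ _, η ∂μ := by rw [integral_const, smul_eq_mul, mul_comm]
  rw [dissipation, inner_fluxLp, ← integral_const_mul, hconst,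
    ← integral_add (integrable_const η) ((P.integrable_inner_flux Z Z).const_mul C)]
  refine integral_mono (integrable_norm_rpow P.β_pos.le P.β_le_two Z)
    ((integrable_const η).add ((P.integrable_inner_flux Z Z).const_mul C)) fun x => ?_
  simp only [P.inner_flux_self]
  exact hC _ (norm_nonneg _)

theorem exists_integral_norm_rpow_le (F : Type*) [NormedAddCommGroup F] [InnerProductSpace ℝ F]
    (μ : Measure α) [IsFiniteMeasure μ] {η : ℝ} (hη : 0 < η) :
    ∃ k : ℝ, 0 < k ∧ ∀ Z : Lp F 2 μ, ∫ x, ‖Z x‖ ^ P.β ∂μ ≤ η + k * P.dissipation Z := by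
  have : 0 ≤ μ.real univ := measureReal_nonneg
  obtain ⟨k, hk, hK⟩ := P.exists_rpow_β_le (η := η / (μ.real univ + 1)) (by positivity)
  refine ⟨k, hk, fun Z => (P.integral_norm_rpow_le hK Z).trans ?_⟩
  gcongr
  rw [div_mul_eq_mul_div, div_le_iff₀ (by positivity)]
  gcongr
  linarith

theorem exists_mul_integral_norm_sub_rpow_le (F : Type*) [NormedAddCommGroup F]
    [InnerProductSpace ℝ F] (μ : Measure α) [IsFiniteMeasure μ] {C η : ℝ} (hC : 0 < C)
    (hη : 0 < η) :
    ∃ k : ℝ, 0 < k ∧ ∀ Z W : Lp F 2 μ,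
      C * ∫ x, ‖(Z - W : Lp F 2 μ) x‖ ^ P.β ∂μ ≤ η + k * (P.dissipation Z + ‖W‖ ^ 2) := by
  have := P.coeff_zero_pos
  set A := C * 2 ^ P.β
  have hA : 0 < A := by positivity
  obtain ⟨k, hk, hkZ⟩ := P.exists_integral_norm_rpow_le F μ (η := η / (2 * A)) (by positivity)
  refine ⟨A * k * (1 + 1 / P.coeff 0), by positivity, fun Z W => ?_⟩
  have hZ := P.dissipation_nonneg Z
  calc C * ∫ x, ‖(Z - W : Lp F 2 μ) x‖ ^ P.β ∂μ
      ≤ C * (2 ^ P.β * (∫ x, ‖Z x‖ ^ P.β ∂μ + ∫ x, ‖W x‖ ^ P.β ∂μ)) := by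
        gcongr
        exact integral_norm_sub_rpow_le P.β_pos.le P.β_le_two Z W
    _ = A * (∫ x, ‖Z x‖ ^ P.β ∂μ + ∫ x, ‖W x‖ ^ P.β ∂μ) := by rw [mul_assoc]
    _ ≤ A * ((η / (2 * A) + k * P.dissipation Z) +
          (η / (2 * A) + k * (1 / P.coeff 0 * ‖W‖ ^ 2))) := by
        gcongr
        · exact hkZ Z
        · exact (hkZ W).trans (by gcongr; exact P.dissipation_le W)
    _ = η + A * k * (P.dissipation Z + 1 / P.coeff 0 * ‖W‖ ^ 2) := by
        field_simp
        ring
    _ ≤ η + A * k * ((1 + 1 / P.coeff 0) * (P.dissipation Z + ‖W‖ ^ 2)) := by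
        gcongr
        have : 0 ≤ 1 / P.coeff 0 * P.dissipation Z := by positivity
        linarith [sq_nonneg ‖W‖]
    _ = η + A * k * (1 + 1 / P.coeff 0) * (P.dissipation Z + ‖W‖ ^ 2) := by ring

end GenPoly

/-! ### Abstract discrete flows -/

section Projection

variable {d : ℕ} {Ω : Set (EuclideanSpace ℝ (Fin d))}
  {𝒯 : Finset (Set (EuclideanSpace ℝ (Fin d)))} {r : ℕ} {β C h : ℝ}
  {S S₀ : Submodule ℝ (Lp ℝ 2 (volume.restrict Ω))}
  {G : Lp ℝ 2 (volume.restrict Ω) →L[ℝ] Lp (EuclideanSpace ℝ (Fin d)) 2 (volume.restrict Ω)}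

theorem MemH1.weakGradient_spec {w : EuclideanSpace ℝ (Fin d) → ℝ} (hw : MemH1 Ω w) :
    MemLp (weakGradient Ω w) 2 (volume.restrict Ω) ∧
      HasWeakGradient Ω w (weakGradient Ω w) := by
  unfold weakGradient
  rw [dif_pos hw.2]
  exact hw.2.choose_spec

theorem IsDiscreteGradient.norm_map_starProjection_le
    (hG : IsDiscreteGradient Ω 𝒯 r β C h S S₀ G) [S.HasOrthogonalProjection]
    (hC : 0 < C) (hh : 0 < h) {w : EuclideanSpace ℝ (Fin d) → ℝ} (hw : MemH1 Ω w)
    {s : Lp ℝ 2 (volume.restrict Ω)} (hs : w =ᵐ[volume.restrict Ω] s) :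
    ‖G (S.starProjection s)‖ ^ 2 ≤ C ^ 4 * h1Norm Ω w ^ 2 := by
  obtain ⟨c, hc, hpoincare⟩ := hG.poincare w _ hw.weakGradient_spec.1 hw.weakGradient_spec.2 s hs
  set L := lpNorm (weakGradient Ω w) 2 (volume.restrict Ω)
  have hconst : G (S.starProjection s) = G (S.starProjection (s - c)) := by
    rw [map_sub, map_sub, S.starProjection_eq_self_iff.2 (hG.const_le hc), hG.map_const c hc,
      sub_zero]
  have hstable : ‖G (S.starProjection s)‖ ≤ C ^ 2 * L := by
    refine le_of_mul_le_mul_left ?_ hh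
    calc h * ‖G (S.starProjection s)‖ = h * ‖G (S.starProjection (s - c))‖ := by rw [hconst]
      _ ≤ C * ‖S.starProjection (s - c)‖ := hG.inverse _ (S.starProjection_apply_mem _)
      _ ≤ C * (C * h * L) := by
          gcongr
          exact (S.norm_starProjection_apply_le _).trans hpoincare
      _ = h * (C ^ 2 * L) := by ring
  calc ‖G (S.starProjection s)‖ ^ 2 ≤ (C ^ 2 * L) ^ 2 := by gcongr
    _ = C ^ 4 * L ^ 2 := by ring
    _ ≤ C ^ 4 * h1Norm Ω w ^ 2 := by
        rw [h1Norm, Real.sq_sqrt (by positivity)]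
        gcongr
        exact le_add_of_nonneg_left (sq_nonneg _)

end Projection

theorem inner_le_half_add {X : Type*} [NormedAddCommGroup X] [InnerProductSpace ℝ X] (x y : X)
    {a : ℝ} (ha : 0 < a) : inner ℝ x y ≤ a / 4 * ‖x‖ ^ 2 + 1 / a * ‖y‖ ^ 2 := by
  have hsq : 0 ≤ 1 / a * (a / 2 * ‖x‖ - ‖y‖) ^ 2 := by positivity
  calc inner ℝ x y ≤ ‖x‖ * ‖y‖ := real_inner_le_norm x y
    _ ≤ ‖x‖ * ‖y‖ + 1 / a * (a / 2 * ‖x‖ - ‖y‖) ^ 2 := le_add_of_nonneg_right hsq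
    _ = a / 4 * ‖x‖ ^ 2 + 1 / a * ‖y‖ ^ 2 := by
        field_simp
        ring

section Flow

variable {N : ℕ} {P : GenPoly N} {α X V : Type*} [MeasurableSpace α] {μ : Measure α}
  [NormedAddCommGroup X] [InnerProductSpace ℝ X] [NormedAddCommGroup V] [InnerProductSpace ℝ V]
  {S S₀ : Submodule ℝ X} {G : X →L[ℝ] Lp V 2 μ} {κ C : ℝ} {u u' F : ℝ → X}
  {z z' : ℝ → Lp V 2 μ} {q ψ χ : ℝ → ℝ}

/-- The curve `u` in `S` solves `(u', w) + (K(|Z|) Z, G w) = (F, w)` for all `w ∈ S`, where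
`Z = G u + z`: this is the semidiscrete problem in Hilbert space form, with `G` the discrete
gradient and `z` that of the boundary data. The functions `q`, `ψ`, `χ` measure the sizes of the
source, of the boundary data and of its time derivative. -/
structure IsDiscreteFlow (P : GenPoly N) (S : Submodule ℝ X) (G : X →L[ℝ] Lp V 2 μ) (κ : ℝ)
    (u u' F : ℝ → X) (z z' : ℝ → Lp V 2 μ) (q ψ χ : ℝ → ℝ) : Prop where
  mem : ∀ t, 0 ≤ t → u t ∈ S
  deriv_mem : ∀ t, 0 < t → u' t ∈ S
  hasDerivAt : ∀ t, 0 < t → HasDerivAt u (u' t) t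
  hasDerivAt_data : ∀ t, 0 < t → HasDerivAt z (z' t) t
  cont : ContinuousWithinAt u (Ici 0) 0
  cont_data : ContinuousWithinAt z (Ici 0) 0
  norm_source_le : ∀ t, 0 ≤ t → ‖F t‖ ≤ q t
  norm_data_sq_le : ∀ t, 0 ≤ t → ‖z t‖ ^ 2 ≤ κ * ψ t
  norm_deriv_data_sq_le : ∀ t, 0 ≤ t → ‖z' t‖ ^ 2 ≤ κ * χ t
  eqn : ∀ t, 0 < t → ∀ w ∈ S,
    inner ℝ (u' t) w + inner ℝ (P.fluxLp (G (u t) + z t)) (G w) = inner ℝ (F t) w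

theorem GenPoly.two_inner_fluxLp_le_dissipation (P : GenPoly N) (Z : Lp V 2 μ) {W : Lp V 2 μ}
    {b : ℝ} (hW : ‖W‖ ^ 2 ≤ κ * b) :
    2 * inner ℝ (P.fluxLp Z) W ≤ P.dissipation Z / 2 + 2 * κ / P.coeff 0 * b := by
  have ha := P.coeff_zero_pos
  have hflux : P.coeff 0 / 4 * ‖P.fluxLp Z‖ ^ 2 ≤ P.dissipation Z / 4 := by
    calc P.coeff 0 / 4 * ‖P.fluxLp Z‖ ^ 2
        ≤ P.coeff 0 / 4 * (1 / P.coeff 0 * P.dissipation Z) := by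
          gcongr
          exact P.norm_fluxLp_sq_le Z
      _ = P.dissipation Z / 4 := by field_simp
  have hdata : 1 / P.coeff 0 * ‖W‖ ^ 2 ≤ κ / P.coeff 0 * b := by
    calc 1 / P.coeff 0 * ‖W‖ ^ 2 ≤ 1 / P.coeff 0 * (κ * b) := by gcongr
      _ = κ / P.coeff 0 * b := by ring
  have hyoung := inner_le_half_add (P.fluxLp Z) W ha
  calc 2 * inner ℝ (P.fluxLp Z) W ≤ P.dissipation Z / 2 + 2 * (κ / P.coeff 0 * b) := by linarith
    _ = P.dissipation Z / 2 + 2 * κ / P.coeff 0 * b := by ring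

section Oscillation

variable [S₀.HasOrthogonalProjection]

theorem starProjection_orthogonal_mem (hS₀ : S₀ ≤ S) {v : X} (hv : v ∈ S) :
    S₀ᗮ.starProjection v ∈ S := by
  rw [Submodule.starProjection_orthogonal_val]
  exact S.sub_mem hv (hS₀ (S₀.starProjection_apply_mem v))

theorem map_starProjection_orthogonal {Y : Type*} [NormedAddCommGroup Y] [NormedSpace ℝ Y]
    {G : X →L[ℝ] Y} (hG : ∀ c ∈ S₀, G c = 0) (v : X) : G (S₀ᗮ.starProjection v) = G v := by
  rw [Submodule.starProjection_orthogonal_val, map_sub, hG _ (S₀.starProjection_apply_mem v),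
    sub_zero]

theorem inner_starProjection_starProjection (K : Submodule ℝ X) [K.HasOrthogonalProjection]
    (v w : X) :
    inner ℝ (K.starProjection v) (K.starProjection w) = inner ℝ (K.starProjection v) w := by
  rw [← K.inner_starProjection_left_eq_right,
    K.starProjection_eq_self_iff.2 (K.starProjection_apply_mem v)]

theorem norm_starProjection_orthogonal_le (v : X) {c : X} (hc : c ∈ S₀) :
    ‖S₀ᗮ.starProjection v‖ ≤ ‖v - c‖ := by
  have hc0 : S₀ᗮ.starProjection c = 0 := by
    rw [Submodule.starProjection_orthogonal_val, S₀.starProjection_eq_self_iff.2 hc, sub_self]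
  calc ‖S₀ᗮ.starProjection v‖ = ‖S₀ᗮ.starProjection (v - c)‖ := by rw [map_sub, hc0, sub_zero]
    _ ≤ ‖v - c‖ := S₀ᗮ.norm_starProjection_apply_le _

end Oscillation

namespace IsDiscreteFlow

theorem hasDerivAt_potentialEnergy (hf : IsDiscreteFlow P S G κ u u' F z z' q ψ χ) {t : ℝ}
    (ht : 0 < t) : HasDerivAt (fun t => P.potentialEnergy (G (u t) + z t))
      (2 * inner ℝ (P.fluxLp (G (u t) + z t)) (G (u' t) + z' t)) t := by
  have hZ : HasDerivAt (fun t => G (u t) + z t) (G (u' t) + z' t) t :=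
    (G.hasFDerivAt.comp_hasDerivAt t (hf.hasDerivAt t ht)).add (hf.hasDerivAt_data t ht)
  simpa [Function.comp_def] using
    (P.hasFDerivAt_potentialEnergy (G (u t) + z t)).comp_hasDerivAt t hZ

theorem deriv_potentialEnergy_le (hf : IsDiscreteFlow P S G κ u u' F z z' q ψ χ) {t : ℝ}
    (ht : 0 < t) : 2 * inner ℝ (P.fluxLp (G (u t) + z t)) (G (u' t) + z' t) ≤
      q t ^ 2 + P.dissipation (G (u t) + z t) / 2 + 2 * κ / P.coeff 0 * χ t := by
  set Z := G (u t) + z t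
  have htest : ‖u' t‖ ^ 2 + inner ℝ (P.fluxLp Z) (G (u' t)) = inner ℝ (F t) (u' t) := by
    rw [← real_inner_self_eq_norm_sq]
    exact hf.eqn t ht _ (hf.deriv_mem t ht)
  have hsource : 2 * inner ℝ (F t) (u' t) ≤ q t ^ 2 + 2 * ‖u' t‖ ^ 2 := by
    have hq : ‖F t‖ ^ 2 ≤ q t ^ 2 := by
      gcongr
      exact hf.norm_source_le t ht.le
    nlinarith [real_inner_le_norm (F t) (u' t), sq_nonneg (‖F t‖ - ‖u' t‖), sq_nonneg ‖u' t‖]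
  have hdata := P.two_inner_fluxLp_le_dissipation Z (hf.norm_deriv_data_sq_le t ht.le)
  rw [inner_add_right]
  linarith

variable [S₀.HasOrthogonalProjection]

theorem deriv_oscillation_le (hf : IsDiscreteFlow P S G κ u u' F z z' q ψ χ)
    (hS₀ : S₀ ≤ S) (hG : ∀ c ∈ S₀, G c = 0) {t : ℝ} (ht : 0 < t) :
    2 * inner ℝ (S₀ᗮ.starProjection (u t)) (S₀ᗮ.starProjection (u' t)) ≤
      2 * q t * ‖S₀ᗮ.starProjection (u t)‖ - P.dissipation (G (u t) + z t) +
        2 * κ / P.coeff 0 * ψ t := by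
  set Z := G (u t) + z t
  set v := S₀ᗮ.starProjection (u t)
  have htest : inner ℝ (u' t) v + inner ℝ (P.fluxLp Z) (G (u t)) = inner ℝ (F t) v := by
    rw [← map_starProjection_orthogonal hG (u t)]
    exact hf.eqn t ht _ (starProjection_orthogonal_mem hS₀ (hf.mem t ht.le))
  have hdiss : inner ℝ (P.fluxLp Z) (G (u t)) =
      P.dissipation Z - inner ℝ (P.fluxLp Z) (z t) := by
    rw [eq_sub_iff_add_eq, ← inner_add_right]
    rfl
  have hsource : inner ℝ (F t) v ≤ q t * ‖v‖ :=
    (real_inner_le_norm _ _).trans (by gcongr; exact hf.norm_source_le t ht.le)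
  have hdata := P.two_inner_fluxLp_le_dissipation Z (hf.norm_data_sq_le t ht.le)
  have hD := P.dissipation_nonneg Z
  rw [inner_starProjection_starProjection, real_inner_comm]
  linarith

theorem norm_oscillation_rpow_le (hf : IsDiscreteFlow P S G κ u u' F z z' q ψ χ)
    (hsob : ∀ s ∈ S, ∃ c ∈ S₀, ‖s - c‖ ^ P.β ≤ C * ∫ x, ‖G s x‖ ^ P.β ∂μ) {t : ℝ} (ht : 0 ≤ t) :
    (‖S₀ᗮ.starProjection (u t)‖ ^ 2) ^ (P.β / 2) ≤
      C * ∫ x, ‖((G (u t) + z t) - z t : Lp V 2 μ) x‖ ^ P.β ∂μ := by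
  obtain ⟨c, hc, hle⟩ := hsob (u t) (hf.mem t ht)
  rw [add_sub_cancel_right, ← Real.rpow_natCast _ 2, ← Real.rpow_mul (norm_nonneg _),
    Nat.cast_ofNat, mul_div_cancel₀ P.β two_ne_zero]
  exact (Real.rpow_le_rpow (norm_nonneg _) (norm_starProjection_orthogonal_le _ hc)
    P.β_pos.le).trans hle

/-- The energies of a discrete flow: `y` is the squared norm of the component of `u` orthogonal to
`S₀`, and `H`, `D`, `E` are the potential energy, the dissipation and the gradient energy of
`G u + z`. -/
def energySystem [IsFiniteMeasure μ] (hf : IsDiscreteFlow P S G κ u u' F z z' q ψ χ) (hκ : 0 < κ)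
    (hS₀ : S₀ ≤ S) (hG : ∀ c ∈ S₀, G c = 0) {Cη : ℝ → ℝ}
    (hy : ∀ η, 0 < η → ∀ t, 0 ≤ t → (‖S₀ᗮ.starProjection (u t)‖ ^ 2) ^ (P.β / 2) ≤
      η + Cη η * (P.dissipation (G (u t) + z t) + ψ t))
    (hE : ∀ η, 0 < η → ∀ t, 0 ≤ t → ∫ x, ‖(G (u t) + z t) x‖ ^ P.β ∂μ ≤
      η + Cη η * P.dissipation (G (u t) + z t)) :
    EnergySystem P.β (2 * κ / P.coeff 0) Cη q ψ χ where
  y := fun t => ‖S₀ᗮ.starProjection (u t)‖ ^ 2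
  y' := fun t => 2 * inner ℝ (S₀ᗮ.starProjection (u t)) (S₀ᗮ.starProjection (u' t))
  H := fun t => P.potentialEnergy (G (u t) + z t)
  H' := fun t => 2 * inner ℝ (P.fluxLp (G (u t) + z t)) (G (u' t) + z' t)
  D := fun t => P.dissipation (G (u t) + z t)
  E := fun t => ∫ x, ‖(G (u t) + z t) x‖ ^ P.β ∂μ
  y_deriv := fun t ht =>
    (S₀ᗮ.starProjection.hasFDerivAt.comp_hasDerivAt t (hf.hasDerivAt t ht)).norm_sq
  H_deriv := fun _ ht => hf.hasDerivAt_potentialEnergy ht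
  y_cont := (S₀ᗮ.starProjection.continuous.continuousAt.comp_continuousWithinAt hf.cont).norm.pow 2
  H_cont := (P.hasFDerivAt_potentialEnergy _).continuousAt.comp_continuousWithinAt
    ((G.continuous.continuousAt.comp_continuousWithinAt hf.cont).add hf.cont_data)
  y_nonneg := fun _ _ => sq_nonneg _
  D_nonneg := fun _ _ => P.dissipation_nonneg _
  E_nonneg := fun _ _ => integral_nonneg fun _ => Real.rpow_nonneg (norm_nonneg _) _
  ψ_nonneg := fun t ht =>
    nonneg_of_mul_nonneg_right ((sq_nonneg _).trans (hf.norm_data_sq_le t ht)) hκ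
  q_nonneg := fun t ht => (norm_nonneg _).trans (hf.norm_source_le t ht)
  χ_nonneg := fun t ht =>
    nonneg_of_mul_nonneg_right ((sq_nonneg _).trans (hf.norm_deriv_data_sq_le t ht)) hκ
  y_le := fun t ht => by
    rw [Real.sqrt_sq (norm_nonneg _)]
    exact hf.deriv_oscillation_le hS₀ hG ht
  H_le := fun _ ht => hf.deriv_potentialEnergy_le ht
  D_le_H := fun _ _ => P.dissipation_le_potentialEnergy _
  H_le_D := fun _ _ => P.potentialEnergy_le _
  y_rpow_le := hy
  E_le := hE

end IsDiscreteFlow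

theorem GenPoly.exists_integral_rpow_le_dissipation (P : GenPoly N) (V : Type*)
    [NormedAddCommGroup V] [InnerProductSpace ℝ V] (μ : Measure α) [IsFiniteMeasure μ]
    (hκ : 0 < κ) (hC : 0 < C) {η : ℝ} (hη : 0 < η) :
    ∃ k : ℝ, 0 < k ∧ (∀ Z : Lp V 2 μ, ∫ x, ‖Z x‖ ^ P.β ∂μ ≤ η + k * P.dissipation Z) ∧
      ∀ (Z : Lp V 2 μ) {W : Lp V 2 μ} {b : ℝ}, ‖W‖ ^ 2 ≤ κ * b →
        C * ∫ x, ‖(Z - W : Lp V 2 μ) x‖ ^ P.β ∂μ ≤ η + k * (P.dissipation Z + b) := by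
  obtain ⟨k, hk, hkZ⟩ := P.exists_integral_norm_rpow_le V μ hη
  obtain ⟨l, hl, hlZ⟩ := P.exists_mul_integral_norm_sub_rpow_le V μ hC hη
  refine ⟨k + l * (1 + κ), by positivity, fun Z => (hkZ Z).trans ?_, fun Z W b hW => ?_⟩
  · have := P.dissipation_nonneg Z
    gcongr
    exact le_add_of_nonneg_right (by positivity)
  have hD := P.dissipation_nonneg Z
  have hb : 0 ≤ b := nonneg_of_mul_nonneg_right ((sq_nonneg _).trans hW) hκ
  calc C * ∫ x, ‖(Z - W : Lp V 2 μ) x‖ ^ P.β ∂μ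
      ≤ η + l * (P.dissipation Z + ‖W‖ ^ 2) := hlZ Z W
    _ ≤ η + l * ((1 + κ) * (P.dissipation Z + b)) := by
        gcongr
        linarith [mul_nonneg hκ.le hD]
    _ ≤ η + (k + l * (1 + κ)) * (P.dissipation Z + b) := by
        rw [← mul_assoc]
        gcongr
        exact le_add_of_nonneg_left hk.le

theorem exists_energySystem_of_isDiscreteFlow (P : GenPoly N) (X V : Type*) [NormedAddCommGroup X]
    [InnerProductSpace ℝ X] [NormedAddCommGroup V] [InnerProductSpace ℝ V] (μ : Measure α)
    [IsFiniteMeasure μ] (hκ : 0 < κ) (hC : 0 < C) :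
    ∃ Cη : ℝ → ℝ, (∀ η, 0 < η → 0 < Cη η) ∧
      ∀ {S S₀ : Submodule ℝ X} [S₀.HasOrthogonalProjection] {G : X →L[ℝ] Lp V 2 μ}
        {u u' F : ℝ → X} {z z' : ℝ → Lp V 2 μ} {q ψ χ : ℝ → ℝ}, S₀ ≤ S → (∀ c ∈ S₀, G c = 0) →
        (∀ s ∈ S, ∃ c ∈ S₀, ‖s - c‖ ^ P.β ≤ C * ∫ x, ‖G s x‖ ^ P.β ∂μ) →
        IsDiscreteFlow P S G κ u u' F z z' q ψ χ →
        ∃ E : EnergySystem P.β (2 * κ / P.coeff 0) Cη q ψ χ,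
          (∀ t, E.E t = ∫ x, ‖(G (u t) + z t) x‖ ^ P.β ∂μ) ∧ E.y 0 ≤ ‖u 0‖ ^ 2 ∧
          E.H 0 ≤ 2 / P.coeff 0 * ‖G (u 0) + z 0‖ ^ 2 := by
  choose! Cη hCη hE hosc using fun (η : ℝ) (hη : 0 < η) =>
    P.exists_integral_rpow_le_dissipation V μ hκ hC hη
  refine ⟨Cη, hCη, fun {S S₀ _ G u u' F z z' q ψ χ} hS₀ hG hsob hf => ?_⟩
  refine ⟨hf.energySystem hκ hS₀ hG (fun η hη t ht => ?_) (fun η hη t _ => hE η hη _),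
    fun _ => rfl, ?_, ?_⟩
  · exact (hf.norm_oscillation_rpow_le hsob ht).trans (hosc η hη _ (hf.norm_data_sq_le t ht))
  · exact pow_le_pow_left₀ (norm_nonneg _) (by
      simpa only [sub_zero] using norm_starProjection_orthogonal_le (u 0) S₀.zero_mem) 2
  · calc P.potentialEnergy (G (u 0) + z 0) ≤ 2 * P.dissipation (G (u 0) + z 0) :=
          P.potentialEnergy_le _
      _ ≤ 2 * (1 / P.coeff 0 * ‖G (u 0) + z 0‖ ^ 2) := by
          gcongr
          exact P.dissipation_le _
      _ = 2 / P.coeff 0 * ‖G (u 0) + z 0‖ ^ 2 := by ring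

end Flow

/-! ### The semidiscrete problem -/

section Solution

variable {d N : ℕ} {P : GenPoly N} {Ω : Set (EuclideanSpace ℝ (Fin d))}
  {𝒯 : Finset (Set (EuclideanSpace ℝ (Fin d)))} {r : ℕ} {σ β C h : ℝ}
  {S S₀ : Submodule ℝ (Lp ℝ 2 (volume.restrict Ω))}
  {G : Lp ℝ 2 (volume.restrict Ω) →L[ℝ] Lp (EuclideanSpace ℝ (Fin d)) 2 (volume.restrict Ω)}
  {u : ℝ → EuclideanSpace ℝ (Fin d) → ℝ} {v w p : EuclideanSpace ℝ (Fin d) → ℝ}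

open Classical in
/-- The class in `L²(Ω)` of a square integrable function, and `0` for any other function: a total
version of `MemLp.toLp`, so that it can be composed with a curve of functions. -/
def toL2 (Ω : Set (EuclideanSpace ℝ (Fin d))) (w : EuclideanSpace ℝ (Fin d) → ℝ) :
    Lp ℝ 2 (volume.restrict Ω) :=
  if h : MemLp w 2 (volume.restrict Ω) then h.toLp w else 0

theorem toL2_of_memLp (hw : MemLp w 2 (volume.restrict Ω)) : toL2 Ω w = hw.toLp w :=
  dif_pos hw

theorem ae_eq_toL2 (hw : MemLp w 2 (volume.restrict Ω)) :
    w =ᵐ[volume.restrict Ω] toL2 Ω w := by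
  rw [toL2_of_memLp hw]
  exact hw.coeFn_toLp.symm

theorem toL2_eq {s : Lp ℝ 2 (volume.restrict Ω)} (hw : w =ᵐ[volume.restrict Ω] s) :
    toL2 Ω w = s :=
  Lp.ext ((ae_eq_toL2 ((memLp_congr_ae hw).2 (Lp.memLp s))).symm.trans hw)

theorem toL2_add (hv : MemLp v 2 (volume.restrict Ω)) (hw : MemLp w 2 (volume.restrict Ω)) :
    toL2 Ω (v + w) = toL2 Ω v + toL2 Ω w := by
  rw [toL2_of_memLp hv, toL2_of_memLp hw, toL2_of_memLp (hv.add hw), MemLp.toLp_add]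

theorem toL2_sub (hv : MemLp v 2 (volume.restrict Ω)) (hw : MemLp w 2 (volume.restrict Ω)) :
    toL2 Ω (v - w) = toL2 Ω v - toL2 Ω w := by
  rw [toL2_of_memLp hv, toL2_of_memLp hw, toL2_of_memLp (hv.sub hw), MemLp.toLp_sub]

theorem toL2_const_smul (a : ℝ) (hw : MemLp w 2 (volume.restrict Ω)) :
    toL2 Ω (a • w) = a • toL2 Ω w := by
  rw [toL2_of_memLp hw, toL2_of_memLp (hw.const_smul a), MemLp.toLp_const_smul]

theorem norm_toL2 (hw : MemLp w 2 (volume.restrict Ω)) :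
    ‖toL2 Ω w‖ = (eLpNorm w 2 (volume.restrict Ω)).toReal := by
  rw [Lp.norm_def, eLpNorm_congr_ae (ae_eq_toL2 hw)]

theorem l2Norm_eq_norm_toL2 (hw : MemLp w 2 (volume.restrict Ω)) : l2Norm Ω w = ‖toL2 Ω w‖ :=
  lpNorm_eq_norm (ae_eq_toL2 hw)

theorem l2Norm_sq_le_h1Norm_sq (Ω : Set (EuclideanSpace ℝ (Fin d)))
    (w : EuclideanSpace ℝ (Fin d) → ℝ) : l2Norm Ω w ^ 2 ≤ h1Norm Ω w ^ 2 := by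
  rw [h1Norm, Real.sq_sqrt (by positivity)]
  exact le_add_of_nonneg_right (sq_nonneg _)

theorem inner_eq_integral_mul {s s' : Lp ℝ 2 (volume.restrict Ω)}
    (hv : v =ᵐ[volume.restrict Ω] s) (hw : w =ᵐ[volume.restrict Ω] s') :
    inner ℝ s s' = ∫ x in Ω, v x * w x := by
  rw [L2.inner_def]
  refine integral_congr_ae ?_
  filter_upwards [hv, hw] with x hvx hwx
  rw [← hvx, ← hwx, RCLike.inner_apply', conj_trivial]

theorem HasL2TimeDeriv.hasDerivWithinAt {t : ℝ} (h : HasL2TimeDeriv Ω u v t) (ht : 0 ≤ t)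
    (hu : ∀ s, 0 ≤ s → MemLp (u s) 2 (volume.restrict Ω))
    (hv : MemLp v 2 (volume.restrict Ω)) :
    HasDerivWithinAt (fun s => toL2 Ω (u s)) (toL2 Ω v) (Ici 0) t := by
  rw [hasDerivWithinAt_iff_tendsto_slope, tendsto_iff_norm_sub_tendsto_zero]
  refine Tendsto.congr' ?_ ((ENNReal.tendsto_toReal ENNReal.zero_ne_top).comp h)
  filter_upwards [self_mem_nhdsWithin] with s hs
  have hdiff := (hu s hs.1).sub (hu t ht)
  rw [slope_def_module, ← toL2_sub (hu s hs.1) (hu t ht), ← toL2_const_smul _ hdiff,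
    ← toL2_sub (hdiff.const_smul _) hv, norm_toL2 ((hdiff.const_smul _).sub hv)]
  rfl

theorem continuousWithinAt_toL2 (hu : ∀ s, 0 ≤ s → MemLp (u s) 2 (volume.restrict Ω))
    (h : Tendsto (fun t => eLpNorm (u t - u 0) 2 (volume.restrict Ω)) (𝓝[>] 0) (𝓝 0)) :
    ContinuousWithinAt (fun s => toL2 Ω (u s)) (Ici 0) 0 := by
  rw [← continuousWithinAt_Ioi_iff_Ici, ContinuousWithinAt, tendsto_iff_norm_sub_tendsto_zero]
  refine Tendsto.congr' ?_ ((ENNReal.tendsto_toReal ENNReal.zero_ne_top).comp h)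
  filter_upwards [self_mem_nhdsWithin] with s hs
  have hs0 : 0 ≤ s := le_of_lt hs
  rw [← toL2_sub (hu s hs0) (hu 0 le_rfl), norm_toL2 ((hu s hs0).sub (hu 0 le_rfl))]
  rfl

theorem add_mem_feSpace (hv : v ∈ feSpace 𝒯 r) (hw : w ∈ feSpace 𝒯 r) : v + w ∈ feSpace 𝒯 r := by
  intro T hT
  obtain ⟨p, hp, hpv⟩ := hv T hT
  obtain ⟨q, hq, hqw⟩ := hw T hT
  refine ⟨p + q, (MvPolynomial.totalDegree_add p q).trans (max_le hp hq), fun x hx => ?_⟩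
  rw [Pi.add_apply, hpv x hx, hqw x hx, map_add]

theorem gradEnergy_eq_integral {Z : Lp (EuclideanSpace ℝ (Fin d)) 2 (volume.restrict Ω)}
    (hβ : 0 < β) (hw : gradient w =ᵐ[volume.restrict Ω] Z) :
    gradEnergy Ω β w = ∫ x in Ω, ‖Z x‖ ^ β := by
  have hmeas : AEStronglyMeasurable (gradient w) (volume.restrict Ω) :=
    (Lp.aestronglyMeasurable Z).congr hw.symm
  have hnonneg : 0 ≤ ∫ x in Ω, ‖gradient w x‖ ^ β :=
    integral_nonneg fun x => Real.rpow_nonneg (norm_nonneg _) _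
  rw [gradEnergy, lpNorm_eq_integral_norm_rpow_toReal (by simpa using hβ) (by simp) hmeas,
    ENNReal.toReal_ofReal hβ.le, Real.rpow_inv_rpow hnonneg hβ.ne']
  exact integral_congr_ae (hw.fun_comp fun y => ‖y‖ ^ β)

namespace IsDiscreteGradient

theorem memLp (hG : IsDiscreteGradient Ω 𝒯 r β C h S S₀ G) (hw : w ∈ feSpace 𝒯 r) :
    MemLp w 2 (volume.restrict Ω) := by
  obtain ⟨s, -, hs, -⟩ := hG.exists_class w hw
  exact (memLp_congr_ae hs).2 (Lp.memLp s)

theorem toL2_mem (hG : IsDiscreteGradient Ω 𝒯 r β C h S S₀ G) (hw : w ∈ feSpace 𝒯 r) :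
    toL2 Ω w ∈ S := by
  obtain ⟨s, hsS, hs, -⟩ := hG.exists_class w hw
  rwa [toL2_eq hs]

theorem gradient_ae_eq (hG : IsDiscreteGradient Ω 𝒯 r β C h S S₀ G) (hw : w ∈ feSpace 𝒯 r) :
    gradient w =ᵐ[volume.restrict Ω] G (toL2 Ω w) := by
  obtain ⟨s, -, hs, hgrad⟩ := hG.exists_class w hw
  rwa [toL2_eq hs]

theorem toL2_eq_starProjection (hG : IsDiscreteGradient Ω 𝒯 r β C h S S₀ G)
    [S.HasOrthogonalProjection] (hw : MemLp w 2 (volume.restrict Ω))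
    (hp : IsL2Projection Ω 𝒯 r w p) : toL2 Ω p = S.starProjection (toL2 Ω w) := by
  symm
  refine Submodule.eq_starProjection_of_mem_of_inner_eq_zero (hG.toL2_mem hp.1) fun s hs => ?_
  obtain ⟨v, hv, hvs⟩ := hG.exists_rep s hs
  rw [inner_sub_left, inner_eq_integral_mul (ae_eq_toL2 hw) hvs,
    inner_eq_integral_mul (ae_eq_toL2 (hG.memLp hp.1)) hvs, hp.2 v hv, sub_self]

theorem gradient_add_ae_eq (hG : IsDiscreteGradient Ω 𝒯 r β C h S S₀ G)
    [S.HasOrthogonalProjection] (hv : v ∈ feSpace 𝒯 r) (hw : MemLp w 2 (volume.restrict Ω))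
    (hp : IsL2Projection Ω 𝒯 r w p) :
    gradient (v + p) =ᵐ[volume.restrict Ω]
      (G (toL2 Ω v) + G (S.starProjection (toL2 Ω w)) :
        Lp (EuclideanSpace ℝ (Fin d)) 2 (volume.restrict Ω)) := by
  rw [← hG.toL2_eq_starProjection hw hp, ← map_add,
    ← toL2_add (hG.memLp hv) (hG.memLp hp.1)]
  exact hG.gradient_ae_eq (add_mem_feSpace hv hp.1)

end IsDiscreteGradient

section Flow

variable [S.HasOrthogonalProjection] {f φ φt πφ ρt : ℝ → EuclideanSpace ℝ (Fin d) → ℝ}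
  {ρ0 : EuclideanSpace ℝ (Fin d) → ℝ}

namespace IsData

theorem memLp_ftilde (hdata : IsData Ω f φ φt ρ0) {t : ℝ} (ht : 0 ≤ t) :
    MemLp (ftilde f φt t) 2 (volume.restrict Ω) :=
  (hdata.f_mem t ht).sub (hdata.φt_mem t ht).1

theorem hasDerivWithinAt_toL2 (hdata : IsData Ω f φ φt ρ0) {t : ℝ} (ht : 0 ≤ t) :
    HasDerivWithinAt (fun s => toL2 Ω (φ s)) (toL2 Ω (φt t)) (Ici 0) t :=
  (hdata.φ_deriv t ht).hasDerivWithinAt ht (fun s hs => (hdata.φ_mem s hs).1) (hdata.φt_mem t ht).1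

end IsData

namespace IsSemidiscreteSolution

theorem inner_add_inner_fluxLp (hG : IsDiscreteGradient Ω 𝒯 r β C h S S₀ G)
    (hdata : IsData Ω f φ φt ρ0) (hsol : IsSemidiscreteSolution P Ω 𝒯 r f φ φt ρ0 πφ ρt)
    {t : ℝ} (ht : 0 ≤ t) (hv : v ∈ feSpace 𝒯 r)
    (heqn : ∀ w ∈ feSpace 𝒯 r, (∫ x in Ω, v x * w x) +
        (∫ x in Ω, P.K ‖gradient (ρt t + πφ t) x‖ *
          inner ℝ (gradient (ρt t + πφ t) x) (gradient w x)) =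
      ∫ x in Ω, ftilde f φt t x * w x)
    {s : Lp ℝ 2 (volume.restrict Ω)} (hs : s ∈ S) :
    inner ℝ (toL2 Ω v) s + inner ℝ (P.fluxLp (G (toL2 Ω (ρt t)) +
      G (S.starProjection (toL2 Ω (φ t))))) (G s) = inner ℝ (toL2 Ω (ftilde f φt t)) s := by
  obtain ⟨w, hw, hws⟩ := hG.exists_rep s hs
  have hgradw := hG.gradient_ae_eq hw
  rw [toL2_eq hws] at hgradw
  rw [inner_eq_integral_mul (ae_eq_toL2 (hG.memLp hv)) hws,
    inner_eq_integral_mul (ae_eq_toL2 (hdata.memLp_ftilde ht)) hws, ← heqn w hw, P.inner_fluxLp]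
  congr 1
  refine integral_congr_ae ?_
  filter_upwards [hG.gradient_add_ae_eq (hsol.mem t ht) (hdata.φ_mem t ht).1 (hsol.proj t ht),
    hgradw] with x hρx hwx
  rw [hρx, hwx, GenPoly.flux, real_inner_smul_left]

theorem exists_isDiscreteFlow (hG : IsDiscreteGradient Ω 𝒯 r β C h S S₀ G) (hC : 0 < C)
    (hh : 0 < h) (hdata : IsData Ω f φ φt ρ0)
    (hsol : IsSemidiscreteSolution P Ω 𝒯 r f φ φt ρ0 πφ ρt) :
    ∃ u', IsDiscreteFlow P S G (C ^ 4) (fun t => toL2 Ω (ρt t)) u'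
      (fun t => toL2 Ω (ftilde f φt t)) (fun t => G (S.starProjection (toL2 Ω (φ t))))
      (fun t => G (S.starProjection (toL2 Ω (φt t)))) (fun t => l2Norm Ω (ftilde f φt t))
      (fun t => h1Norm Ω (φ t) ^ 2) (fun t => h1Norm Ω (φt t) ^ 2) := by
  choose! v hv hderiv heqn using hsol.eqn
  have hρ : ∀ t, 0 ≤ t → MemLp (ρt t) 2 (volume.restrict Ω) := fun t ht =>
    hG.memLp (hsol.mem t ht)
  let A := G ∘L S.starProjection
  exact ⟨fun t => toL2 Ω (v t), {
    mem := fun t ht => hG.toL2_mem (hsol.mem t ht)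
    deriv_mem := fun t ht => hG.toL2_mem (hv t ht)
    hasDerivAt := fun t ht =>
      ((hderiv t ht).hasDerivWithinAt ht.le hρ (hG.memLp (hv t ht))).hasDerivAt (Ici_mem_nhds ht)
    hasDerivAt_data := fun t ht =>
      A.hasFDerivAt.comp_hasDerivAt t
        ((hdata.hasDerivWithinAt_toL2 ht.le).hasDerivAt (Ici_mem_nhds ht))
    cont := continuousWithinAt_toL2 hρ hsol.cont_zero
    cont_data := A.continuous.continuousAt.comp_continuousWithinAt
      (hdata.hasDerivWithinAt_toL2 le_rfl).continuousWithinAt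
    norm_source_le := fun t ht => (l2Norm_eq_norm_toL2 (hdata.memLp_ftilde ht)).ge
    norm_data_sq_le := fun t ht => hG.norm_map_starProjection_le hC hh (hdata.φ_mem t ht)
      (ae_eq_toL2 (hdata.φ_mem t ht).1)
    norm_deriv_data_sq_le := fun t ht => hG.norm_map_starProjection_le hC hh (hdata.φt_mem t ht)
      (ae_eq_toL2 (hdata.φt_mem t ht).1)
    eqn := fun t ht s hs =>
      inner_add_inner_fluxLp hG hdata hsol ht.le (hv t ht) (heqn t ht) hs }⟩

theorem toL2_zero (hG : IsDiscreteGradient Ω 𝒯 r β C h S S₀ G) (hdata : IsData Ω f φ φt ρ0)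
    (hsol : IsSemidiscreteSolution P Ω 𝒯 r f φ φt ρ0 πφ ρt) :
    toL2 Ω (ρt 0) = S.starProjection (toL2 Ω ρ0 - toL2 Ω (φ 0)) := by
  have hφ := (hdata.φ_mem 0 le_rfl).1
  rw [hG.toL2_eq_starProjection (hdata.ρ0_mem.1.sub hφ) hsol.init, toL2_sub hdata.ρ0_mem.1 hφ]

theorem norm_toL2_zero_sq_le (hG : IsDiscreteGradient Ω 𝒯 r β C h S S₀ G)
    (hdata : IsData Ω f φ φt ρ0) (hsol : IsSemidiscreteSolution P Ω 𝒯 r f φ φt ρ0 πφ ρt) :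
    ‖toL2 Ω (ρt 0)‖ ^ 2 ≤ 2 * (h1Norm Ω ρ0 ^ 2 + l2Norm Ω (φ 0) ^ 2) := by
  have hle : ‖toL2 Ω (ρt 0)‖ ≤ l2Norm Ω ρ0 + l2Norm Ω (φ 0) := by
    rw [toL2_zero hG hdata hsol, l2Norm_eq_norm_toL2 hdata.ρ0_mem.1,
      l2Norm_eq_norm_toL2 (hdata.φ_mem 0 le_rfl).1]
    exact (S.norm_starProjection_apply_le _).trans (norm_sub_le _ _)
  calc ‖toL2 Ω (ρt 0)‖ ^ 2 ≤ (l2Norm Ω ρ0 + l2Norm Ω (φ 0)) ^ 2 := by gcongr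
    _ ≤ 2 * (l2Norm Ω ρ0 ^ 2 + l2Norm Ω (φ 0) ^ 2) := add_sq_le
    _ ≤ 2 * (h1Norm Ω ρ0 ^ 2 + l2Norm Ω (φ 0) ^ 2) := by
        linarith [l2Norm_sq_le_h1Norm_sq Ω ρ0]

theorem norm_gradient_zero_sq_le (hG : IsDiscreteGradient Ω 𝒯 r β C h S S₀ G) (hC : 0 < C)
    (hh : 0 < h) (hdata : IsData Ω f φ φt ρ0)
    (hsol : IsSemidiscreteSolution P Ω 𝒯 r f φ φt ρ0 πφ ρt) :
    ‖G (toL2 Ω (ρt 0)) + G (S.starProjection (toL2 Ω (φ 0)))‖ ^ 2 ≤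
      C ^ 4 * h1Norm Ω ρ0 ^ 2 := by
  rw [toL2_zero hG hdata hsol, ← map_add, ← map_add, sub_add_cancel]
  exact hG.norm_map_starProjection_le hC hh hdata.ρ0_mem (ae_eq_toL2 hdata.ρ0_mem.1)

end IsSemidiscreteSolution

end Flow

theorem exists_energySystem_of_isSemidiscreteSolution (P : GenPoly N) (hd : 0 < d)
    (hdβ : 0 ≤ P.β * (1 + d / 2) - d) (hΩ : Bornology.IsBounded Ω) (r : ℕ) (hσ : 0 < σ) :
    ∃ (C₁ C₂ : ℝ) (Cη : ℝ → ℝ), 0 < C₁ ∧ 0 < C₂ ∧ (∀ η, 0 < η → 0 < Cη η) ∧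
      ∀ {h 𝒯}, IsQuasiUniformMesh Ω σ h 𝒯 → ∀ {f φ φt ρ0}, IsData Ω f φ φt ρ0 →
      ∀ {πφ ρt}, IsSemidiscreteSolution P Ω 𝒯 r f φ φt ρ0 πφ ρt →
      ∃ E : EnergySystem P.β C₁ Cη (fun t => l2Norm Ω (ftilde f φt t))
          (fun t => h1Norm Ω (φ t) ^ 2) (fun t => h1Norm Ω (φt t) ^ 2),
        (∀ t, 0 ≤ t → gradEnergy Ω P.β (ρt t + πφ t) = E.E t) ∧
        E.H 0 + E.y 0 ≤ C₂ * (h1Norm Ω ρ0 ^ 2 + l2Norm Ω (φ 0) ^ 2) := by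
  have ha := P.coeff_zero_pos
  have : IsFiniteMeasure (volume.restrict Ω) := isFiniteMeasure_restrict.2 hΩ.measure_lt_top.ne
  obtain ⟨C, hC, hmesh⟩ := exists_isDiscreteGradient hd hΩ r hσ P.one_lt_β P.β_le_two hdβ
  have hC4 : 0 < C ^ 4 := by positivity
  obtain ⟨Cη, hCη, hflow⟩ := exists_energySystem_of_isDiscreteFlow P
    (Lp ℝ 2 (volume.restrict Ω)) (EuclideanSpace ℝ (Fin d)) (volume.restrict Ω) hC4 hC
  refine ⟨2 * C ^ 4 / P.coeff 0, 2 * C ^ 4 / P.coeff 0 + 2, Cη, by positivity, by positivity, hCη,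
    fun {h 𝒯} hm {f φ φt ρ0} hdata {πφ ρt} hsol => ?_⟩
  obtain ⟨S, S₀, G, hG⟩ := hmesh hm
  have := hG.finite
  have := hG.finite_const
  have hh := hm.h_pos hd hΩ
  obtain ⟨u', hf⟩ := hsol.exists_isDiscreteFlow hG hC hh hdata
  obtain ⟨E, hE, hy0, hH0⟩ := hflow hG.const_le hG.map_const hG.sobolev hf
  refine ⟨E, fun t ht => ?_, ?_⟩
  · rw [hE, gradEnergy_eq_integral P.β_pos
      (hG.gradient_add_ae_eq (hsol.mem t ht) (hdata.φ_mem t ht).1 (hsol.proj t ht))]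
  calc E.H 0 + E.y 0
      ≤ 2 / P.coeff 0 * (C ^ 4 * h1Norm Ω ρ0 ^ 2) +
          2 * (h1Norm Ω ρ0 ^ 2 + l2Norm Ω (φ 0) ^ 2) := by
        refine add_le_add (hH0.trans ?_) (hy0.trans (hsol.norm_toL2_zero_sq_le hG hdata))
        gcongr
        exact hsol.norm_gradient_zero_sq_le hG hC hh hdata
    _ = 2 * C ^ 4 / P.coeff 0 * h1Norm Ω ρ0 ^ 2 +
          2 * (h1Norm Ω ρ0 ^ 2 + l2Norm Ω (φ 0) ^ 2) := by ring
    _ ≤ 2 * C ^ 4 / P.coeff 0 * (h1Norm Ω ρ0 ^ 2 + l2Norm Ω (φ 0) ^ 2) +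
          2 * (h1Norm Ω ρ0 ^ 2 + l2Norm Ω (φ 0) ^ 2) := by
        gcongr
        exact le_add_of_nonneg_right (sq_nonneg _)
    _ = (2 * C ^ 4 / P.coeff 0 + 2) * (h1Norm Ω ρ0 ^ 2 + l2Norm Ω (φ 0) ^ 2) := by ring

end Solution

/-! ### Limits and bounds at infinity -/

theorem eventually_le_of_limsupInfty_ne_top {u : ℝ → ℝ} (h : limsupInfty u ≠ ⊤) :
    ∀ᶠ t in atTop, u t ≤ (limsupInfty u).toReal + 1 := by
  have hlt : limsupInfty u < ENNReal.ofReal ((limsupInfty u).toReal + 1) := by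
    rw [ENNReal.lt_ofReal_iff_toReal_lt h]
    linarith
  filter_upwards [eventually_lt_of_limsup_lt hlt] with t ht
  exact (ENNReal.ofReal_le_ofReal_iff (by positivity)).1 ht.le

theorem tendsto_zero_of_limsupInfty_eq_zero {u : ℝ → ℝ} (hu : ∀ t, 0 ≤ u t)
    (h : limsupInfty u = 0) : Tendsto u atTop (𝓝 0) := by
  refine tendsto_order.2 ⟨fun b hb => Eventually.of_forall fun t => hb.trans_le (hu t),
    fun b hb => ?_⟩
  have hlt : limsupInfty u < ENNReal.ofReal b := by rwa [h, ENNReal.ofReal_pos]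
  filter_upwards [eventually_lt_of_limsup_lt hlt] with t ht
  exact (ENNReal.ofReal_lt_ofReal_iff hb).1 ht

theorem limsupInfty_eq_zero {u : ℝ → ℝ} (h : Tendsto u atTop (𝓝 0)) : limsupInfty u = 0 := by
  rw [← ENNReal.ofReal_zero]
  exact (ENNReal.tendsto_ofReal h).limsup_eq

theorem limsupInfty_le {u : ℝ → ℝ} {b : ℝ} (h : ∀ᶠ t in atTop, u t ≤ b) :
    limsupInfty u ≤ ENNReal.ofReal b :=
  limsup_le_of_le (by isBoundedDefault) (h.mono fun _ ht => ENNReal.ofReal_le_ofReal ht)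

theorem limsupInfty_congr {u v : ℝ → ℝ} (h : u =ᶠ[atTop] v) : limsupInfty u = limsupInfty v :=
  limsup_congr (h.fun_comp ENNReal.ofReal)

theorem ofReal_mul_one_add_add_rpow {C p : ℝ} (hC : 0 ≤ C) (hp : 0 ≤ p) {m l : ENNReal}
    (hm : m ≠ ⊤) (hl : l ≠ ⊤) :
    ENNReal.ofReal (C * (1 + m.toReal + l.toReal ^ p)) = ENNReal.ofReal C * (1 + m + l ^ p) := by
  rw [ENNReal.ofReal_mul hC, ENNReal.ofReal_add (by positivity) (by positivity),
    ENNReal.ofReal_add zero_le_one ENNReal.toReal_nonneg, ENNReal.ofReal_toReal hm,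
    ← ENNReal.ofReal_rpow_of_nonneg ENNReal.toReal_nonneg hp, ENNReal.ofReal_toReal hl,
    ENNReal.ofReal_one]

theorem EnergySystem.exists_limsupInfty_E_le {β C₁ : ℝ} {Cη : ℝ → ℝ} (hβ : 1 < β) (hβ2 : β ≤ 2)
    (hC₁ : 0 < C₁) (hCη : 0 < Cη 1) :
    ∃ C : ℝ, 0 < C ∧ ∀ {q ψ χ : ℝ → ℝ} (S : EnergySystem β C₁ Cη q ψ χ),
      limsupInfty S.E ≤ ENNReal.ofReal C *
        (1 + limsupInfty χ + limsupInfty (dataSize β q ψ) ^ (2 / β)) := by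
  obtain ⟨C, hC, hE⟩ := exists_eventually_E_le hβ hβ2 hC₁ hCη
  set p := 2 / β
  have hp : 0 < p := by positivity
  have hC' : 0 < C * (2 + 2 ^ p) := by positivity
  refine ⟨C * (2 + 2 ^ p), hC', fun {q ψ χ} S => ?_⟩
  set m := limsupInfty χ
  set l := limsupInfty (dataSize β q ψ)
  rcases eq_or_ne m ⊤ with hm | hm
  · rw [hm, add_top, top_add, ENNReal.mul_top (ENNReal.ofReal_pos.2 hC').ne']
    exact le_top
  rcases eq_or_ne l ⊤ with hl | hl
  · rw [hl, ENNReal.top_rpow_of_pos hp, add_top, ENNReal.mul_top (ENNReal.ofReal_pos.2 hC').ne']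
    exact le_top
  rw [← ofReal_mul_one_add_add_rpow hC'.le hp.le hm hl]
  refine limsupInfty_le ?_
  filter_upwards [hE S (l.toReal + 1) (m.toReal + 1) (by positivity) (by positivity)
    (eventually_le_of_limsupInfty_ne_top hl) (eventually_le_of_limsupInfty_ne_top hm)] with t ht
  have hl0 : 0 ≤ l.toReal := ENNReal.toReal_nonneg
  have hm0 : 0 ≤ m.toReal := ENNReal.toReal_nonneg
  have hlp : 0 ≤ l.toReal ^ p := by positivity
  have h2m : 0 ≤ (2 : ℝ) ^ p * m.toReal := by positivity
  calc S.E t ≤ C * (1 + (m.toReal + 1) + (1 + l.toReal) ^ p) := by rwa [add_comm 1 l.toReal]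
    _ ≤ C * ((2 + 2 ^ p) * (1 + m.toReal + l.toReal ^ p)) := by
        gcongr
        linarith [one_add_rpow_le hl0 hp.le]
    _ = C * (2 + 2 ^ p) * (1 + m.toReal + l.toReal ^ p) := (mul_assoc _ _ _).symm

theorem GenPoly.le_β_mul {N : ℕ} (P : GenPoly N) {d : ℕ} (hdeg : P.a ≤ 4 / ((d : ℝ) + 2)) :
    0 ≤ P.β * (1 + d / 2) - d := by
  rw [le_div_iff₀ (by positivity)] at hdeg
  rw [GenPoly.β]
  linarith

section Bounds

variable {d N : ℕ} {P : GenPoly N} {Ω : Set (EuclideanSpace ℝ (Fin d))}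
  {f φ φt ρ : ℝ → EuclideanSpace ℝ (Fin d) → ℝ} {ρ0 : EuclideanSpace ℝ (Fin d) → ℝ}

theorem gData_nonneg (t : ℝ) : 0 ≤ gData P Ω f φ φt t :=
  add_nonneg (Real.rpow_nonneg lpNorm_nonneg _) (sq_nonneg _)

theorem integral_envelope_nonneg {F : ℝ → ℝ} (hF : IsEnvelope (gData P Ω f φ φt) F) {t : ℝ}
    (ht : 0 ≤ t) : 0 ≤ ∫ s in (0 : ℝ)..t, Real.exp (-(1 / 2) * (t - s)) *
      (h1Norm Ω (φt s) ^ 2 + F s ^ (2 / P.β)) := by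
  refine intervalIntegral.integral_nonneg ht fun s hs => ?_
  have : 0 ≤ F s := (gData_nonneg s).trans (hF.le s hs.1)
  positivity

theorem bigA_nonneg {F : ℝ → ℝ} (hF : IsEnvelope (gData P Ω f φ φt) F) {t : ℝ} (ht : 0 ≤ t) :
    0 ≤ bigA P Ω φ φt ρ0 F t :=
  add_nonneg (by positivity) (integral_envelope_nonneg hF ht)

theorem one_add_add_integral_le_mul_bigA {F : ℝ → ℝ} (hF : IsEnvelope (gData P Ω f φ φt) F)
    {C H₀ : ℝ} (hC : 0 ≤ C) (hH₀ : H₀ ≤ C * (h1Norm Ω ρ0 ^ 2 + l2Norm Ω (φ 0) ^ 2)) {t : ℝ}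
    (ht : 0 ≤ t) :
    1 + H₀ + ∫ s in (0 : ℝ)..t, Real.exp (-(1 / 2) * (t - s)) *
        (h1Norm Ω (φt s) ^ 2 + F s ^ (2 / P.β)) ≤ (1 + C) * bigA P Ω φ φt ρ0 F t := by
  have hI := integral_envelope_nonneg hF ht
  rw [bigA]
  set I := ∫ s in (0 : ℝ)..t, Real.exp (-(1 / 2) * (t - s)) *
    (h1Norm Ω (φt s) ^ 2 + F s ^ (2 / P.β))
  have hCI : 0 ≤ C * (1 + I) := by positivity
  linarith [sq_nonneg (h1Norm Ω ρ0), sq_nonneg (l2Norm Ω (φ 0))]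

theorem limsupInfty_lpNorm_eq_zero {β : ℝ} (hβ : 0 < β)
    (h : Tendsto (fun t => gradEnergy Ω β (ρ t)) atTop (𝓝 0)) :
    limsupInfty (fun t => lpNorm (gradient (ρ t)) (ENNReal.ofReal β) (volume.restrict Ω)) = 0 := by
  have hroot := h.rpow_const (p := β⁻¹) (Or.inr (by positivity))
  rw [Real.zero_rpow (by positivity)] at hroot
  exact limsupInfty_eq_zero (hroot.congr fun t => Real.rpow_rpow_inv lpNorm_nonneg hβ.ne')

theorem tendsto_h1Norm_sq_zero (h : limsupInfty (fun t => h1Norm Ω (φ t)) = 0) :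
    Tendsto (fun t => h1Norm Ω (φ t) ^ 2) atTop (𝓝 0) := by
  rw [← zero_pow (M₀ := ℝ) two_ne_zero]
  exact (tendsto_zero_of_limsupInfty_eq_zero (fun _ => Real.sqrt_nonneg _) h).pow 2

end Bounds

end Forchheimer

end

theorem theorem4p2_general {d : ℕ} (hd : 0 < d) {N : ℕ} (P : Forchheimer.GenPoly N)
    (hdeg : P.a ≤ 4 / ((d : ℝ) + 2))
    (Ω : Set (EuclideanSpace ℝ (Fin d))) (hΩb : Bornology.IsBounded Ω)
    (r : ℕ) (σ : ℝ) (hσ : 0 < σ) :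
    ∃ C : ℝ, 0 < C ∧
      ∀ (h : ℝ) (𝒯 : Finset (Set (EuclideanSpace ℝ (Fin d)))),
      Forchheimer.IsQuasiUniformMesh Ω σ h 𝒯 →
      ∀ (f φ φt : ℝ → EuclideanSpace ℝ (Fin d) → ℝ) (ρ0 : EuclideanSpace ℝ (Fin d) → ℝ),
      Forchheimer.IsData Ω f φ φt ρ0 →
      ∀ πφ ρt : ℝ → EuclideanSpace ℝ (Fin d) → ℝ,
      Forchheimer.IsSemidiscreteSolution P Ω 𝒯 r f φ φt ρ0 πφ ρt →
        (∀ F : ℝ → ℝ, Forchheimer.IsEnvelope (Forchheimer.gData P Ω f φ φt) F →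
          ∀ t : ℝ, 0 ≤ t →
            Forchheimer.gradEnergy Ω P.β (ρt t + πφ t) ≤ C * Forchheimer.bigA P Ω φ φt ρ0 F t) ∧
        Forchheimer.limsupInfty (fun t => Forchheimer.gradEnergy Ω P.β (ρt t + πφ t)) ≤
          ENNReal.ofReal C *
            (1 + Forchheimer.limsupInfty (fun t => Forchheimer.h1Norm Ω (φt t) ^ 2) +
              Forchheimer.limsupInfty (Forchheimer.gData P Ω f φ φt) ^ (2 / P.β)) ∧
        (Forchheimer.limsupInfty
              (fun t => Forchheimer.l2Norm Ω (Forchheimer.ftilde f φt t)) = 0 →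
          Forchheimer.limsupInfty (fun t => Forchheimer.h1Norm Ω (φ t)) = 0 →
          Forchheimer.limsupInfty (fun t => Forchheimer.h1Norm Ω (φt t)) = 0 →
          Forchheimer.limsupInfty (fun t =>
            lpNorm (gradient (ρt t + πφ t)) (ENNReal.ofReal P.β) (volume.restrict Ω)) = 0) := by
  have hβ := P.one_lt_β
  have hβ2 := P.β_le_two
  obtain ⟨C₁, C₂, Cη, hC₁, hC₂, hCη, hsys⟩ :=
    Forchheimer.exists_energySystem_of_isSemidiscreteSolution P hd (P.le_β_mul hdeg) hΩb r hσ
  obtain ⟨A, hA, hEnv⟩ :=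
    Forchheimer.EnergySystem.exists_E_le_of_envelope hβ hβ2 hC₁ (hCη 1 one_pos)
  obtain ⟨B, hB, hlim⟩ :=
    Forchheimer.EnergySystem.exists_limsupInfty_E_le hβ hβ2 hC₁ (hCη 1 one_pos)
  refine ⟨A * (1 + C₂) + B, by positivity, fun h 𝒯 hm f φ φt ρ0 hdata πφ ρt hsol => ?_⟩
  obtain ⟨E, hE, hinit⟩ := hsys hm hdata hsol
  have hE_ev : (fun t => Forchheimer.gradEnergy Ω P.β (ρt t + πφ t)) =ᶠ[atTop] E.E :=
    (eventually_ge_atTop 0).mono hE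
  refine ⟨fun F hF t ht => ?_, ?_, fun hf hφ hφt => ?_⟩
  · calc Forchheimer.gradEnergy Ω P.β (ρt t + πφ t) = E.E t := hE t ht
      _ ≤ A * ((1 + C₂) * Forchheimer.bigA P Ω φ φt ρ0 F t) :=
          (hEnv E F hF.cont hF.mono hF.le t ht (hdata.φt_int t ht)).trans (by
            rw [add_assoc 1]
            gcongr
            exact Forchheimer.one_add_add_integral_le_mul_bigA hF hC₂.le hinit ht)
      _ ≤ (A * (1 + C₂) + B) * Forchheimer.bigA P Ω φ φt ρ0 F t := by
          rw [← mul_assoc]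
          exact mul_le_mul_of_nonneg_right (le_add_of_nonneg_right hB.le)
            (Forchheimer.bigA_nonneg hF ht)
  · rw [Forchheimer.limsupInfty_congr hE_ev]
    exact (hlim E).trans
      (mul_le_mul' (ENNReal.ofReal_le_ofReal (le_add_of_nonneg_left (by positivity))) le_rfl)
  · have hq := Forchheimer.tendsto_zero_of_limsupInfty_eq_zero (fun _ => lpNorm_nonneg) hf
    have hE_zero := E.tendsto_E hβ hβ2 hC₁ hCη hq (Forchheimer.tendsto_h1Norm_sq_zero hφ)
      (Forchheimer.tendsto_h1Norm_sq_zero hφt)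
    exact Forchheimer.limsupInfty_lpNorm_eq_zero P.β_pos (hE_zero.congr' hE_ev.symm)

theorem theorem4p2 {d : ℕ} (hd : 2 ≤ d) {N : ℕ} (hN : 1 ≤ N) (P : Forchheimer.GenPoly N)
    (hdeg : P.a ≤ 4 / ((d : ℝ) + 2))
    (Ω : Set (EuclideanSpace ℝ (Fin d))) (hΩo : IsOpen Ω) (hΩb : Bornology.IsBounded Ω)
    (r : ℕ) (σ : ℝ) (hσ : 0 < σ) :
    ∃ C : ℝ, 0 < C ∧
      ∀ (h : ℝ) (𝒯 : Finset (Set (EuclideanSpace ℝ (Fin d)))),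
      Forchheimer.IsQuasiUniformMesh Ω σ h 𝒯 →
      ∀ (f φ φt : ℝ → EuclideanSpace ℝ (Fin d) → ℝ) (ρ0 : EuclideanSpace ℝ (Fin d) → ℝ),
      Forchheimer.IsData Ω f φ φt ρ0 →
      ∀ πφ ρt : ℝ → EuclideanSpace ℝ (Fin d) → ℝ,
      Forchheimer.IsSemidiscreteSolution P Ω 𝒯 r f φ φt ρ0 πφ ρt →
        (∀ F : ℝ → ℝ, Forchheimer.IsEnvelope (Forchheimer.gData P Ω f φ φt) F →
          ∀ t : ℝ, 0 ≤ t →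
            Forchheimer.gradEnergy Ω P.β (ρt t + πφ t) ≤ C * Forchheimer.bigA P Ω φ φt ρ0 F t) ∧
        Forchheimer.limsupInfty (fun t => Forchheimer.gradEnergy Ω P.β (ρt t + πφ t)) ≤
          ENNReal.ofReal C *
            (1 + Forchheimer.limsupInfty (fun t => Forchheimer.h1Norm Ω (φt t) ^ 2) +
              Forchheimer.limsupInfty (Forchheimer.gData P Ω f φ φt) ^ (2 / P.β)) ∧
        (Forchheimer.limsupInfty
              (fun t => Forchheimer.l2Norm Ω (Forchheimer.ftilde f φt t)) = 0 →
          Forchheimer.limsupInfty (fun t => Forchheimer.h1Norm Ω (φ t)) = 0 →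
          Forchheimer.limsupInfty (fun t => Forchheimer.h1Norm Ω (φt t)) = 0 →
          Forchheimer.limsupInfty (fun t =>
            lpNorm (gradient (ρt t + πφ t)) (ENNReal.ofReal P.β) (volume.restrict Ω)) = 0) :=
  theorem4p2_general (by omega) P hdeg Ω hΩb r σ hσ
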